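/- All Hilbert spaces are complex and separable, $\mathcal L(\mathcal X;\mathcal Y)$ is the set of bounded operators, $\mathcal L(\mathcal X)=\mathcal L(\mathcal X;\mathcal X)$, $\otimes$ is the Hilbert space tensor product, a set is total if its span is dense, and "unitary" means surjective isometry. For a vector $\psi\in\mathcal F$, $|\psi\rangle$ denotes the operator $\mathbb C\to\mathcal F$, $z\mapsto z\psi$, and $\langle\psi|=|\psi\rangle^\dagger$. Associativity isomorphisms of tensor products are suppressed. **Setting.** Let $I$ be a countable set, $\mathcal H_0$ a Hilbert space, $\mathcal H_{A_i},\mathcal H_{B_i}$ ($i\in I$) nonzero Hilbert spaces, $U_{\mathcal A}:\mathcal H_0\oplus\bigoplus_{i\in I}\mathcal H_{A_i}\otimes\mathcal H_{B_i}\to\mathcal H$ a unitary, and let $P_0:\mathcal H\to\mathcal H_0$ and $P_i:\mathcal H\to\mathcal H_{A_i}\otimes\mathcal H_{B_i}$ be $U_{\mathcal A}^\dagger$ followed by the projection onto the corresponding summand. Let $\mathcal A\subseteq\mathcal L(\mathcal H)$ be the atomic $*$-algebra $\mathcal A=U_{\mathcal A}\bigl(0\oplus\bigoplus_{i\in I}\mathcal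 L(\mathcal H_{A_i})\otimes 1_{B_i}\bigr)U_{\mathcal A}^\dagger$. For $V\in\mathcal L(\mathcal H;\mathcal H\otimes\mathcal H_E)$ and $K\in\mathcal L(\mathcal H)$ put $L_{V,K}(X)=V^\dagger(X\otimes 1_E)V-K^\dagger X-XK$ for $X\in\mathcal L(\mathcal H)$. **Normal forms.** A *normal form* of $(V,K)$ consists of operators $V_0\in\mathcal L(\mathcal H;\mathcal H_0\otimes\mathcal H_E)$ and $K_0\in\mathcal L(\mathcal H;\mathcal H_0)$; for all $i,j\in I$ a Hilbert space $\mathcal H_{F_{ij}}$, an operator $A_{ij}\in\mathcal L(\mathcal H_{A_j};\mathcal H_{A_i}\otimes\mathcal H_{F_{ij}})$ and an isometry $U_{ij}\in\mathcal L(\mathcal H_{F_{ij}}\otimes\mathcal H_{B_j};\mathcal H_{B_i}\otimes\mathcal H_E)$; and for all $i\in I$ operators $B_i\in\mathcal L(\mathcal H_{B_i};\mathcal H_{B_i}\otimes\mathcal H_E)$, $K_{A_i}\in\mathcal L(\mathcal H_{A_i})$ and a self-adjoint $H_{B_i}\in\mathcal L(\mathcal H_{B_i})$, such that $U_{ik}^\dagger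 U_{il}=\delta_{kl}1$ for all $i,k,l\in I$ and, with $V_{ij}=(1_{A_i}\otimes U_{ij})(A_{ij}\otimes 1_{B_j})$, $$V=(P_0^\dagger\otimes 1_E)V_0+\sum_{i,j\in I}(P_i^\dagger\otimes 1_E)V_{ij}P_j+\sum_{i\in I}(P_i^\dagger\otimes 1_E)(1_{A_i}\otimes B_i)P_i,$$ $$K=\sum_{i,j\in I}P_i^\dagger(1_{A_i}\otimes B_i^\dagger)V_{ij}P_j+\tfrac12\sum_{i\in I}P_i^\dagger(1_{A_i}\otimes B_i^\dagger B_i)P_i+\sum_{i\in I}P_i^\dagger(K_{A_i}\otimes 1_{B_i})P_i+i\sum_{i\in I}P_i^\dagger(1_{A_i}\otimes H_{B_i})P_i+P_0^\dagger K_0,$$ where each of the series converges (unconditionally) in the strong operator topology. The normal form is *minimal* if a) for all $i\in I$, $\{((X\otimes 1_{F_{ii}})A_{ii}-A_{ii}X)\psi \mid X\in\mathcal L(\mathcal H_{A_i}),\ \psi\in\mathcal H_{A_i}\}$ is total in $\mathcal H_{A_i}\otimes\mathcal H_{F_{ii}}$, and b) for all $i\ne j$ in $I$, $\{(X\otimes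 1_{F_{ij}})A_{ij}\psi \mid X\in\mathcal L(\mathcal H_{A_i}),\ \psi\in\mathcal H_{A_j}\}$ is total in $\mathcal H_{A_i}\otimes\mathcal H_{F_{ij}}$. **Theorem.** If $L_{V,K}(\mathcal A)\subseteq\mathcal A$, then $(V,K)$ has a minimal normal form. Moreover, let $V\in\mathcal L(\mathcal H;\mathcal H\otimes\mathcal H_E)$, $\tilde V\in\mathcal L(\mathcal H;\mathcal H\otimes\mathcal H_{\tilde E})$, $K,\tilde K\in\mathcal L(\mathcal H)$ be such that $L=L_{V,K}$ and $\tilde L=L_{\tilde V,\tilde K}$ map $\mathcal A$ into $\mathcal A$, and let minimal normal forms of $(V,K)$ and of $(\tilde V,\tilde K)$ be given, the data of the latter being marked by tildes. 1. If $L(X)=\tilde L(X)$ for all $X\in\mathcal A$, then there are unitaries $W_{ij}\in\mathcal L(\mathcal H_{F_{ij}};\mathcal H_{\tilde F_{ij}})$ ($i,j\in I$), vectors $\tilde\psi_i\in\mathcal H_{\tilde F_{ii}}$ with $\sup_i\|\tilde\psi_i\|<\infty$ and reals $\mu_i$ with $\sup_i|\mu_i|<\infty$ such that for all $i\in I$ $$\tilde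 A_{ii}=(1_{A_i}\otimes W_{ii})A_{ii}+1_{A_i}\otimes|\tilde\psi_i\rangle,\qquad \tilde K_{A_i}=K_{A_i}+(1_{A_i}\otimes\langle\tilde\psi_i|W_{ii})A_{ii}+\tfrac12\|\tilde\psi_i\|^2+i\mu_i,$$ and $\tilde A_{ij}=(1_{A_i}\otimes W_{ij})A_{ij}$ for all $i\ne j$. 2. If $\mathcal H_{\tilde E}=\mathcal H_E$, $\tilde V=V$ and $\tilde K=K$, then $\tilde V_0=V_0$ and $\tilde K_0=K_0$, and for all $W_{ij},\tilde\psi_i,\mu_i$ as in 1 (which exist by 1) and all $i,j\in I$ $$\tilde B_i=B_i-U_{ii}(|W_{ii}^\dagger\tilde\psi_i\rangle\otimes 1_{B_i}),\qquad \tilde H_{B_i}=H_{B_i}+\tfrac i2(G_i-G_i^\dagger)-\mu_i1_{B_i},\qquad \tilde U_{ij}=U_{ij}(W_{ij}^\dagger\otimes 1_{B_j}),$$ where $G_i=B_i^\dagger U_{ii}(|W_{ii}^\dagger\tilde\psi_i\rangle\otimes 1_{B_i})$. -/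

import Mathlib

open scoped TensorProduct InnerProduct

universe u v

namespace GKLS



noncomputable section

/-! ### Hilbert space tensor products -/

section Tensor

variable {A A' B B' C F : Type*}
  [NormedAddCommGroup A] [InnerProductSpace ℂ A]
  [NormedAddCommGroup A'] [InnerProductSpace ℂ A']
  [NormedAddCommGroup B] [InnerProductSpace ℂ B]
  [NormedAddCommGroup B'] [InnerProductSpace ℂ B']
  [NormedAddCommGroup C] [InnerProductSpace ℂ C]
  [NormedAddCommGroup F] [InnerProductSpace ℂ F]

/-- The Hilbert space tensor product: the completion of the algebraic tensor product with its
inner product `⟪a ⊗ b, a' ⊗ b'⟫ = ⟪a, a'⟫ ⟪b, b'⟫`. -/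
def HTensor (A B : Type*) [NormedAddCommGroup A] [InnerProductSpace ℂ A]
    [NormedAddCommGroup B] [InnerProductSpace ℂ B] : Type _ :=
  UniformSpace.Completion (A ⊗[ℂ] B)

/-- The Hilbert space tensor product. -/
infixl:100 " ⊗ₕ " => HTensor

instance : NormedAddCommGroup (A ⊗ₕ B) :=
  inferInstanceAs (NormedAddCommGroup (UniformSpace.Completion (A ⊗[ℂ] B)))

instance : InnerProductSpace ℂ (A ⊗ₕ B) :=
  inferInstanceAs (InnerProductSpace ℂ (UniformSpace.Completion (A ⊗[ℂ] B)))

instance : CompleteSpace (A ⊗ₕ B) :=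
  inferInstanceAs (CompleteSpace (UniformSpace.Completion (A ⊗[ℂ] B)))

/-- The dense isometric inclusion of the algebraic tensor product. -/
def hincl (A B : Type*) [NormedAddCommGroup A] [InnerProductSpace ℂ A]
    [NormedAddCommGroup B] [InnerProductSpace ℂ B] : A ⊗[ℂ] B →ₗᵢ[ℂ] A ⊗ₕ B :=
  UniformSpace.Completion.toComplₗᵢ (𝕜 := ℂ) (E := A ⊗[ℂ] B)

theorem denseRange_hincl : DenseRange (hincl A B) :=
  UniformSpace.Completion.denseRange_coe (α := A ⊗[ℂ] B)

/-- The elementary tensor `a ⊗ b`. -/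
def htmul (a : A) (b : B) : A ⊗ₕ B := hincl A B (a ⊗ₜ[ℂ] b)

theorem inner_htmul (a a' : A) (b b' : B) :
    inner ℂ (htmul a b) (htmul a' b') = inner ℂ a a' * inner ℂ b b' := by
  rw [htmul, htmul, LinearIsometry.inner_map_map, TensorProduct.inner_tmul]

/-- The bounded operator `f ⊗ g`. -/
def hmap (f : A →L[ℂ] A') (g : B →L[ℂ] B') : A ⊗ₕ B →L[ℂ] A' ⊗ₕ B' :=
  (TensorProduct.mapL f g).completion

theorem hmap_hincl (f : A →L[ℂ] A') (g : B →L[ℂ] B') (x : A ⊗[ℂ] B) :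
    hmap f g (hincl A B x) = hincl A' B' (TensorProduct.mapL f g x) :=
  (TensorProduct.mapL f g).completion_apply_coe x

theorem hmap_htmul (f : A →L[ℂ] A') (g : B →L[ℂ] B') (a : A) (b : B) :
    hmap f g (htmul a b) = htmul (f a) (g b) :=
  hmap_hincl f g (a ⊗ₜ b)

/-- `X ⊗ 1`. -/
abbrev hR (X : A →L[ℂ] A') (B : Type*) [NormedAddCommGroup B] [InnerProductSpace ℂ B] :
    A ⊗ₕ B →L[ℂ] A' ⊗ₕ B := hmap X (ContinuousLinearMap.id ℂ B)

/-- `1 ⊗ Y`. -/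
abbrev hL (A : Type*) [NormedAddCommGroup A] [InnerProductSpace ℂ A] (Y : B →L[ℂ] B') :
    A ⊗ₕ B →L[ℂ] A ⊗ₕ B' := hmap (ContinuousLinearMap.id ℂ A) Y

/-- `1 ⊗ |ψ⟩ : A → A ⊗ F`, `a ↦ a ⊗ ψ`. -/
def ketR (A : Type*) [NormedAddCommGroup A] [InnerProductSpace ℂ A] (ψ : F) : A →L[ℂ] A ⊗ₕ F :=
  (hincl A F).toContinuousLinearMap ∘L (TensorProduct.mkL ℂ A F).flip ψ

/-- `|ψ⟩ ⊗ 1 : B → F ⊗ B`, `b ↦ ψ ⊗ b`. -/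
def ketL (ψ : F) (B : Type*) [NormedAddCommGroup B] [InnerProductSpace ℂ B] : B →L[ℂ] F ⊗ₕ B :=
  (hincl F B).toContinuousLinearMap ∘L TensorProduct.mkL ℂ F B ψ

theorem ketR_apply (ψ : F) (a : A) : ketR A ψ a = htmul a ψ := rfl

theorem ketL_apply (ψ : F) (b : B) : ketL ψ B b = htmul ψ b := rfl

/-- A linear isometry with dense range stays one after tensoring with an identity on the right. -/
theorem denseRange_rTensor (f : A →ₗᵢ[ℂ] A') (hf : DenseRange f) :
    DenseRange (f.rTensor B) := by
  have key : (⊤ : Submodule ℂ (A' ⊗[ℂ] B)) ≤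
      (LinearMap.range (f.rTensor B).toLinearMap).topologicalClosure := by
    rw [← TensorProduct.span_tmul_eq_top, Submodule.span_le]
    rintro _ ⟨a, b, rfl⟩
    have hc : Continuous fun x : A' => x ⊗ₜ[ℂ] b := by fun_prop
    refine hf.induction_on (p := fun a => a ⊗ₜ[ℂ] b ∈
      (LinearMap.range (f.rTensor B).toLinearMap).topologicalClosure) a
      ((Submodule.isClosed_topologicalClosure _).preimage hc) fun x => ?_
    exact Submodule.le_topologicalClosure _ ⟨x ⊗ₜ b, by simp⟩
  intro x
  exact key (Submodule.mem_top (x := x))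

/-- The same with the identity on the left. -/
theorem denseRange_lTensor (f : A →ₗᵢ[ℂ] A') (hf : DenseRange f) :
    DenseRange (f.lTensor B) := by
  have key : (⊤ : Submodule ℂ (B ⊗[ℂ] A')) ≤
      (LinearMap.range (f.lTensor B).toLinearMap).topologicalClosure := by
    rw [← TensorProduct.span_tmul_eq_top, Submodule.span_le]
    rintro _ ⟨b, a, rfl⟩
    have hc : Continuous fun x : A' => b ⊗ₜ[ℂ] x := by fun_prop
    refine hf.induction_on (p := fun a => b ⊗ₜ[ℂ] a ∈
      (LinearMap.range (f.lTensor B).toLinearMap).topologicalClosure) a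
      ((Submodule.isClosed_topologicalClosure _).preimage hc) fun x => ?_
    exact Submodule.le_topologicalClosure _ ⟨b ⊗ₜ x, by simp⟩
  intro x
  exact key (Submodule.mem_top (x := x))

/-- The dense isometric inclusion of `(A ⊗ B) ⊗ C` into the iterated Hilbert tensor product. -/
def inclL (A B C : Type*) [NormedAddCommGroup A] [InnerProductSpace ℂ A]
    [NormedAddCommGroup B] [InnerProductSpace ℂ B]
    [NormedAddCommGroup C] [InnerProductSpace ℂ C] :
    (A ⊗[ℂ] B) ⊗[ℂ] C →ₗᵢ[ℂ] (A ⊗ₕ B) ⊗ₕ C :=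
  (hincl (A ⊗ₕ B) C).comp ((hincl A B).rTensor C)

/-- The dense isometric inclusion of `A ⊗ (B ⊗ C)` into the iterated Hilbert tensor product. -/
def inclR (A B C : Type*) [NormedAddCommGroup A] [InnerProductSpace ℂ A]
    [NormedAddCommGroup B] [InnerProductSpace ℂ B]
    [NormedAddCommGroup C] [InnerProductSpace ℂ C] :
    A ⊗[ℂ] (B ⊗[ℂ] C) →ₗᵢ[ℂ] A ⊗ₕ (B ⊗ₕ C) :=
  (hincl A (B ⊗ₕ C)).comp ((hincl B C).lTensor A)

theorem denseRange_inclL : DenseRange (inclL A B C) :=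
  (denseRange_hincl (A := A ⊗ₕ B) (B := C)).comp (denseRange_rTensor _ denseRange_hincl)
    (hincl (A ⊗ₕ B) C).continuous

theorem denseRange_inclR : DenseRange (inclR A B C) :=
  (denseRange_hincl (A := A) (B := B ⊗ₕ C)).comp (denseRange_lTensor _ denseRange_hincl)
    (hincl A (B ⊗ₕ C)).continuous

/-- The canonical unitary `(A ⊗ B) ⊗ C ≃ A ⊗ (B ⊗ C)`. -/
def hassoc (A B C : Type*) [NormedAddCommGroup A] [InnerProductSpace ℂ A]
    [NormedAddCommGroup B] [InnerProductSpace ℂ B]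
    [NormedAddCommGroup C] [InnerProductSpace ℂ C] :
    (A ⊗ₕ B) ⊗ₕ C ≃ₗᵢ[ℂ] A ⊗ₕ (B ⊗ₕ C) :=
  LinearEquiv.extendOfIsometry (TensorProduct.assocIsometry ℂ A B C).toLinearEquiv
    (inclL A B C).toLinearMap (inclR A B C).toLinearMap denseRange_inclL denseRange_inclR
    (fun x => by
      simp only [LinearIsometry.coe_toLinearMap, LinearIsometry.norm_map]
      exact (TensorProduct.assocIsometry ℂ A B C).norm_map x)

theorem hassoc_htmul (a : A) (b : B) (c : C) :
    hassoc A B C (htmul (htmul a b) c) = htmul a (htmul b c) := by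
  have h := LinearEquiv.extendOfIsometry_eq
    (TensorProduct.assocIsometry ℂ A B C).toLinearEquiv
    (inclL A B C).toLinearMap (inclR A B C).toLinearMap denseRange_inclL denseRange_inclR
    (fun x => by
      simp only [LinearIsometry.coe_toLinearMap, LinearIsometry.norm_map]
      exact (TensorProduct.assocIsometry ℂ A B C).norm_map x) ((a ⊗ₜ b) ⊗ₜ c)
  exact h

/-- `hassoc` as a bounded operator. -/
abbrev assocL (A B C : Type*) [NormedAddCommGroup A] [InnerProductSpace ℂ A]
    [NormedAddCommGroup B] [InnerProductSpace ℂ B]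
    [NormedAddCommGroup C] [InnerProductSpace ℂ C] :
    (A ⊗ₕ B) ⊗ₕ C →L[ℂ] A ⊗ₕ (B ⊗ₕ C) :=
  ((hassoc A B C).toContinuousLinearEquiv : _ →L[ℂ] _)

/-- The inverse of `hassoc` as a bounded operator. -/
abbrev assocR (A B C : Type*) [NormedAddCommGroup A] [InnerProductSpace ℂ A]
    [NormedAddCommGroup B] [InnerProductSpace ℂ B]
    [NormedAddCommGroup C] [InnerProductSpace ℂ C] :
    A ⊗ₕ (B ⊗ₕ C) →L[ℂ] (A ⊗ₕ B) ⊗ₕ C :=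
  ((hassoc A B C).symm.toContinuousLinearEquiv : _ →L[ℂ] _)

/-- A unitary as a bounded operator. -/
abbrev unitaryL (W : A ≃ₗᵢ[ℂ] B) : A →L[ℂ] B := (W.toContinuousLinearEquiv : A →L[ℂ] B)

/-- A subset is total if its linear span is dense. -/
def IsTotal (S : Set A) : Prop := Dense (Submodule.span ℂ S : Set A)

/-- The series `∑ f n` converges to `S` in the strong operator topology. -/
def SOTHasSum {ι : Type*} (f : ι → A →L[ℂ] B) (S : A →L[ℂ] B) : Prop :=
  ∀ x, HasSum (fun n => f n x) (S x)

/-- The operator `1 ⊗ Y : A ⊗ B → (A ⊗ B') ⊗ E` for `Y : B → B' ⊗ E`. -/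
def ampR (A : Type*) [NormedAddCommGroup A] [InnerProductSpace ℂ A] (Y : B →L[ℂ] B' ⊗ₕ C) :
    A ⊗ₕ B →L[ℂ] (A ⊗ₕ B') ⊗ₕ C :=
  assocR A B' C ∘L hL A Y

/-- The operator `(1 ⊗ U)(a ⊗ 1) : A' ⊗ B' → (A ⊗ B) ⊗ E` for `a : A' → A ⊗ F` and
`U : F ⊗ B' → B ⊗ E`. -/
def semilocal (U : F ⊗ₕ B' →L[ℂ] B ⊗ₕ C) (a : A' →L[ℂ] A ⊗ₕ F) :
    A' ⊗ₕ B' →L[ℂ] (A ⊗ₕ B) ⊗ₕ C :=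
  ampR A U ∘L assocL A F B' ∘L hR a B'

end Tensor

/-! ### GKLS generators and atomic algebras -/

section Generator

variable {H E : Type*}
  [NormedAddCommGroup H] [InnerProductSpace ℂ H] [CompleteSpace H]
  [NormedAddCommGroup E] [InnerProductSpace ℂ E]

/-- `X ↦ V† (X ⊗ 1) V - K† X - X K`. -/
def generator (V : H →L[ℂ] H ⊗ₕ E) (K : H →L[ℂ] H) (X : H →L[ℂ] H) : H →L[ℂ] H :=
  V† ∘L hR X E ∘L V - K† ∘L X - X ∘L K

end Generator

section Atomic

variable {I : Type*} {H H₀ : Type*} {A B : I → Type*}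
  [NormedAddCommGroup H] [InnerProductSpace ℂ H] [CompleteSpace H]
  [NormedAddCommGroup H₀] [InnerProductSpace ℂ H₀]
  [∀ i, NormedAddCommGroup (A i)] [∀ i, InnerProductSpace ℂ (A i)]
  [∀ i, NormedAddCommGroup (B i)] [∀ i, InnerProductSpace ℂ (B i)]

/-- The Hilbert space `H₀ ⊕ ⨁ i, A i ⊗ B i`. -/
abbrev BlockSpace (H₀ : Type*) {I : Type*} (A B : I → Type*)
    [NormedAddCommGroup H₀] [InnerProductSpace ℂ H₀]
    [∀ i, NormedAddCommGroup (A i)] [∀ i, InnerProductSpace ℂ (A i)]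
    [∀ i, NormedAddCommGroup (B i)] [∀ i, InnerProductSpace ℂ (B i)] : Type _ :=
  WithLp 2 (H₀ × lp (fun i => A i ⊗ₕ B i) 2)

/-- `P₀ : H → H₀`. -/
def proj₀ (U : BlockSpace H₀ A B ≃ₗᵢ[ℂ] H) : H →L[ℂ] H₀ :=
  WithLp.fstL 2 ℂ H₀ (lp (fun i => A i ⊗ₕ B i) 2) ∘L unitaryL U.symm

/-- `P i : H → A i ⊗ B i`. -/
def proj (U : BlockSpace H₀ A B ≃ₗᵢ[ℂ] H) (i : I) : H →L[ℂ] A i ⊗ₕ B i :=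
  lp.evalCLM ℂ (fun i => A i ⊗ₕ B i) 2 i ∘L
    WithLp.sndL 2 ℂ H₀ (lp (fun i => A i ⊗ₕ B i) 2) ∘L unitaryL U.symm

/-- `𝒜 = U (0 ⊕ ⨁ i, L(A i) ⊗ 1) U†`: the elements of `𝒜` are the operators that act as `0` on
the summand `H₀` and as `x i ⊗ 1` on the summands `A i ⊗ B i`, for a bounded family `x`. -/
def IsAtomicWith (𝒜 : NonUnitalStarSubalgebra ℂ (H →L[ℂ] H))
    (U : BlockSpace H₀ A B ≃ₗᵢ[ℂ] H) : Prop :=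
  ∀ X : H →L[ℂ] H, X ∈ 𝒜 ↔ ∃ x : ∀ i, A i →L[ℂ] A i,
    BddAbove (Set.range fun i => ‖x i‖) ∧
    proj₀ U ∘L X = 0 ∧ ∀ i, proj U i ∘L X = hR (x i) (B i) ∘L proj U i

end Atomic

/-! ### Normal forms -/

/-- The data `(V₀, K₀, F i j, U i j, A i j, B i, K_A i, H_B i)` of a normal form
(the operators `A i j`, `B i` are the fields `a`, `b`). -/
structure NormalFormData {I : Type v} (H H₀ E : Type u) (A B : I → Type u)
    [NormedAddCommGroup H] [InnerProductSpace ℂ H]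
    [NormedAddCommGroup H₀] [InnerProductSpace ℂ H₀]
    [NormedAddCommGroup E] [InnerProductSpace ℂ E]
    [∀ i, NormedAddCommGroup (A i)] [∀ i, InnerProductSpace ℂ (A i)]
    [∀ i, NormedAddCommGroup (B i)] [∀ i, InnerProductSpace ℂ (B i)] where
  F : I → I → Type u
  [nF : ∀ i j, NormedAddCommGroup (F i j)]
  [iF : ∀ i j, InnerProductSpace ℂ (F i j)]
  [cF : ∀ i j, CompleteSpace (F i j)]
  [sF : ∀ i j, TopologicalSpace.SeparableSpace (F i j)]
  V₀ : H →L[ℂ] H₀ ⊗ₕ E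
  K₀ : H →L[ℂ] H₀
  U : ∀ i j, F i j ⊗ₕ B j →L[ℂ] B i ⊗ₕ E
  a : ∀ i j, A j →L[ℂ] A i ⊗ₕ F i j
  b : ∀ i, B i →L[ℂ] B i ⊗ₕ E
  KA : ∀ i, A i →L[ℂ] A i
  HB : ∀ i, B i →L[ℂ] B i

attribute [instance] NormalFormData.nF NormalFormData.iF NormalFormData.cF NormalFormData.sF

namespace NormalFormData

variable {I : Type v} {H H₀ E E' : Type u} {A B : I → Type u}
  [NormedAddCommGroup H] [InnerProductSpace ℂ H] [CompleteSpace H]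
  [NormedAddCommGroup H₀] [InnerProductSpace ℂ H₀] [CompleteSpace H₀]
  [NormedAddCommGroup E] [InnerProductSpace ℂ E]
  [NormedAddCommGroup E'] [InnerProductSpace ℂ E']
  [∀ i, NormedAddCommGroup (A i)] [∀ i, InnerProductSpace ℂ (A i)] [∀ i, CompleteSpace (A i)]
  [∀ i, NormedAddCommGroup (B i)] [∀ i, InnerProductSpace ℂ (B i)] [∀ i, CompleteSpace (B i)]

/-- `V i j = (1 ⊗ U i j)(A i j ⊗ 1)`. -/
def vsc (D : NormalFormData H H₀ E A B) (i j : I) : A j ⊗ₕ B j →L[ℂ] (A i ⊗ₕ B i) ⊗ₕ E :=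
  semilocal (D.U i j) (D.a i j)

/-- `D` is a normal form of the pair `(V, K)`:

* `V = (P₀† ⊗ 1) V₀ + ∑ i j, (P i† ⊗ 1) (V i j) (P j) + ∑ i, (P i† ⊗ 1)(1 ⊗ B i)(P i)`,
* `K = ∑ i j, P i† (1 ⊗ B i†) (V i j) (P j) + 1/2 ∑ i, P i† (1 ⊗ B i† B i) (P i)
      + ∑ i, P i† (K_A i ⊗ 1) (P i) + i ∑ i, P i† (1 ⊗ H_B i) (P i) + P₀† K₀`,

where all series converge strongly, the `U i j` are isometries with
`U i k† U i l = 0` for `k ≠ l`, and the `H_B i` are self-adjoint. -/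
structure IsNormalForm (D : NormalFormData H H₀ E A B) (P : BlockSpace H₀ A B ≃ₗᵢ[ℂ] H)
    (V : H →L[ℂ] H ⊗ₕ E) (K : H →L[ℂ] H) : Prop where
  isometry_U : ∀ i j, Isometry (D.U i j)
  orthogonal_U : ∀ i k l, k ≠ l → (D.U i k)† ∘L D.U i l = 0
  selfAdjoint_HB : ∀ i, IsSelfAdjoint (D.HB i)
  V_eq : ∃ S T : H →L[ℂ] H ⊗ₕ E,
    SOTHasSum (fun ij : I × I => hR ((proj P ij.1)†) E ∘L D.vsc ij.1 ij.2 ∘L proj P ij.2) S ∧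
    SOTHasSum (fun i => hR ((proj P i)†) E ∘L ampR (A i) (D.b i) ∘L proj P i) T ∧
    V = hR ((proj₀ P)†) E ∘L D.V₀ + S + T
  K_eq : ∃ S T KAlg HComm : H →L[ℂ] H,
    SOTHasSum (fun ij : I × I => (proj P ij.1)† ∘L hL (A ij.1) ((D.b ij.1)†) ∘L
      assocL (A ij.1) (B ij.1) E ∘L D.vsc ij.1 ij.2 ∘L proj P ij.2) S ∧
    SOTHasSum (fun i => (proj P i)† ∘L hL (A i) ((D.b i)† ∘L D.b i) ∘L proj P i) T ∧
    SOTHasSum (fun i => (proj P i)† ∘L hR (D.KA i) (B i) ∘L proj P i) KAlg ∧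
    SOTHasSum (fun i => (proj P i)† ∘L hL (A i) (D.HB i) ∘L proj P i) HComm ∧
    K = S + (1 / 2 : ℂ) • T + KAlg + Complex.I • HComm + (proj₀ P)† ∘L D.K₀

/-- The two minimality conditions. -/
structure IsMinimal (D : NormalFormData H H₀ E A B) : Prop where
  gkls : ∀ i, IsTotal {φ : A i ⊗ₕ D.F i i | ∃ (X : A i →L[ℂ] A i) (ψ : A i),
    φ = (hR X (D.F i i) ∘L D.a i i - D.a i i ∘L X) ψ}
  stinespring : ∀ i j, i ≠ j → IsTotal {φ : A i ⊗ₕ D.F i j | ∃ (X : A i →L[ℂ] A i) (ψ : A j),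
    φ = (hR X (D.F i j) ∘L D.a i j) ψ}

/-- The relations, through unitaries `W i j`, vectors `ψ i` and reals `μ i`, between the `A i j`
and `K_A i` of two normal forms. -/
structure AreRelated (D : NormalFormData H H₀ E A B) (D' : NormalFormData H H₀ E' A B)
    (W : ∀ i j, D.F i j ≃ₗᵢ[ℂ] D'.F i j) (ψ : ∀ i, D'.F i i) (μ : I → ℝ) : Prop where
  bdd_ψ : BddAbove (Set.range fun i => ‖ψ i‖)
  bdd_μ : BddAbove (Set.range fun i => |μ i|)
  a_diag : ∀ i, D'.a i i = hL (A i) (unitaryL (W i i)) ∘L D.a i i + ketR (A i) (ψ i)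
  KA_eq : ∀ i, D'.KA i = D.KA i +
    (ketR (A i) (ψ i))† ∘L hL (A i) (unitaryL (W i i)) ∘L D.a i i +
    (1 / 2 * (‖ψ i‖ : ℂ) ^ 2 + Complex.I * (μ i : ℂ)) • ContinuousLinearMap.id ℂ (A i)
  a_offDiag : ∀ i j, i ≠ j → D'.a i j = hL (A i) (unitaryL (W i j)) ∘L D.a i j

/-- `U i i (|W i i† ψ i⟩ ⊗ 1) : B i → B i ⊗ E`. -/
def shift (D : NormalFormData H H₀ E A B) (D' : NormalFormData H H₀ E' A B)
    (W : ∀ i j, D.F i j ≃ₗᵢ[ℂ] D'.F i j) (ψ : ∀ i, D'.F i i) (i : I) : B i →L[ℂ] B i ⊗ₕ E :=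
  D.U i i ∘L ketL ((W i i).symm (ψ i)) (B i)

end NormalFormData

end

end GKLS

namespace GKLS

noncomputable section

/-! ### Calculus of Hilbert space tensor products -/

section TensorCalculus

variable {A A' A'' B B' B'' C F G : Type*}
  [NormedAddCommGroup A] [InnerProductSpace ℂ A]
  [NormedAddCommGroup A'] [InnerProductSpace ℂ A']
  [NormedAddCommGroup A''] [InnerProductSpace ℂ A'']
  [NormedAddCommGroup B] [InnerProductSpace ℂ B]
  [NormedAddCommGroup B'] [InnerProductSpace ℂ B']
  [NormedAddCommGroup B''] [InnerProductSpace ℂ B'']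
  [NormedAddCommGroup C] [InnerProductSpace ℂ C]
  [NormedAddCommGroup F] [InnerProductSpace ℂ F]
  [NormedAddCommGroup G] [InnerProductSpace ℂ G]

/-! Everything is read off from slices (⟨φ|⊗1) v (|ψ⟩⊗1). They determine v, and an operator |φ⟩⟨φ'|
⊗ 1 only selects which slices occur. Testing L on P_i†(|φ⟩⟨φ'|⊗1)P_i therefore writes the matrix
elements of L(X) as inner products of slices of the blocks of V and K (`inner_generator_block`). If
L(X) lies in 𝒜, those between different summands vanish, and those inside the j-th summand depend on
B_j only through a scalar multiple of ⟨b, b'⟩.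

Existence. Fix unit vectors α_i, let b_i be the (α_i, α_i)-slice of the i-th diagonal block of V,
let T be the sum of the 1 ⊗ b_i, and let S be what is left of V outside H₀. The diagonal slices of S
are those of V, centred by subtracting ⟨φ,ψ⟩ times the one at (α_i, α_i). The same centring of the
relations eliminates K. Hence slices s, t of one block of S satisfy s†t ∈ ℂ1, and slices in
different columns of one row have orthogonal ranges. The closed span of the slices of a block is
then a Hilbert space of multiples of isometries. It serves as F_ij, and evaluation f ⊗ b ↦ f b
serves as U_ij (`nonempty_factorization`). Completing the square in K leaves `remainder`. Its
off-diagonal blocks vanish, and the slices of its diagonal blocks are scalars up to multiples of one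
skew-adjoint operator, which gives K_A ⊗ 1 + i (1 ⊗ H_B).

Uniqueness. In a normal form the U_ij, b_i and H_B disappear from the diagonal matrix elements of L.
So L fixes the Gram matrix of the slices of A_ij for i ≠ j, and that of the centred slices of A_ii.
Minimality makes these families total, so equal Gram matrices yield the unitaries W_ij. Undoing the
centring yields ψ_i, and the freedom left in K_A is the imaginary number iμ_i
(`exists_unitary_gkls`). For a single pair (V, K) the slices of the blocks of V and K themselves are
compared (`AreRelated.relations`). -/

theorem dense_span_htmul :
    Dense (Submodule.span ℂ (Set.range fun p : A × B => htmul p.1 p.2) : Set (A ⊗ₕ B)) := by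
  refine (denseRange_hincl (A := A) (B := B)).mono ?_
  rintro _ ⟨x, rfl⟩
  induction x using TensorProduct.induction_on with
  | zero => simp
  | tmul a b => exact Submodule.subset_span ⟨(a, b), rfl⟩
  | add x y hx hy => rw [map_add]; exact Submodule.add_mem _ hx hy

theorem hext {M : Type*} [NormedAddCommGroup M] [NormedSpace ℂ M] {f g : A ⊗ₕ B →L[ℂ] M}
    (h : ∀ a b, f (htmul a b) = g (htmul a b)) : f = g := by
  refine ContinuousLinearMap.ext_on dense_span_htmul ?_
  rintro _ ⟨p, rfl⟩
  exact h p.1 p.2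

theorem inner_ext_of_dense {M : Type*} [NormedAddCommGroup M] [InnerProductSpace ℂ M] {S : Set M}
    (hS : Dense (Submodule.span ℂ S : Set M)) {x y : M}
    (h : ∀ s ∈ S, inner ℂ s x = inner ℂ s y) : x = y := by
  refine hS.eq_of_inner_right (𝕜 := ℂ) fun z hz => ?_
  induction hz using Submodule.span_induction with
  | mem z hz => exact h z hz
  | zero => simp
  | add a b _ _ ha hb => rw [inner_add_left, inner_add_left, ha, hb]
  | smul c a _ ha => rw [inner_smul_left, inner_smul_left, ha]

theorem hinner_ext {x y : A ⊗ₕ B}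
    (h : ∀ a b, inner ℂ (htmul a b) x = inner ℂ (htmul a b) y) : x = y := by
  refine inner_ext_of_dense dense_span_htmul ?_
  rintro _ ⟨p, rfl⟩
  exact h p.1 p.2

theorem htmul_add_left (a a' : A) (b : B) : htmul (a + a') b = htmul a b + htmul a' b :=
  (ketR A b).map_add a a'

theorem htmul_smul_left (c : ℂ) (a : A) (b : B) : htmul (c • a) b = c • htmul a b :=
  (ketR A b).map_smul c a

theorem htmul_sub_left (a a' : A) (b : B) : htmul (a - a') b = htmul a b - htmul a' b :=
  (ketR A b).map_sub a a'

@[simp] theorem htmul_zero_left (b : B) : htmul (0 : A) b = 0 := (ketR A b).map_zero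

@[simp] theorem htmul_zero_right (a : A) : htmul a (0 : B) = 0 := (ketL a B).map_zero

theorem norm_htmul (a : A) (b : B) : ‖htmul a b‖ = ‖a‖ * ‖b‖ := by
  rw [htmul, LinearIsometry.norm_map, TensorProduct.norm_tmul]

theorem continuous_htmul : Continuous fun p : A × B => htmul p.1 p.2 :=
  (hincl A B).continuous.comp TensorProduct.continuous_tmul

theorem hmap_comp (f : A' →L[ℂ] A'') (f' : A →L[ℂ] A') (g : B' →L[ℂ] B'') (g' : B →L[ℂ] B') :
    hmap f g ∘L hmap f' g' = hmap (f ∘L f') (g ∘L g') :=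
  hext fun a b => by simp [hmap_htmul]

theorem hmap_comp_apply (f : A' →L[ℂ] A'') (f' : A →L[ℂ] A') (g : B' →L[ℂ] B'') (g' : B →L[ℂ] B')
    (x : A ⊗ₕ B) : hmap f g (hmap f' g' x) = hmap (f ∘L f') (g ∘L g') x := by
  rw [← hmap_comp]; rfl

@[simp] theorem hmap_id : hmap (ContinuousLinearMap.id ℂ A) (ContinuousLinearMap.id ℂ B) =
    ContinuousLinearMap.id ℂ (A ⊗ₕ B) :=
  hext fun a b => by simp [hmap_htmul]

theorem hmap_adjoint [CompleteSpace A] [CompleteSpace A'] [CompleteSpace B] [CompleteSpace B']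
    (f : A →L[ℂ] A') (g : B →L[ℂ] B') : (hmap f g)† = hmap (f†) (g†) := by
  refine hext fun a b => hinner_ext fun a' b' => ?_
  rw [ContinuousLinearMap.adjoint_inner_right, hmap_htmul, hmap_htmul, inner_htmul, inner_htmul,
    ContinuousLinearMap.adjoint_inner_right, ContinuousLinearMap.adjoint_inner_right]

theorem adjoint_id [CompleteSpace A] :
    (ContinuousLinearMap.id ℂ A)† = ContinuousLinearMap.id ℂ A :=
  ContinuousLinearMap.adjoint_id

theorem hR_adjoint [CompleteSpace A] [CompleteSpace A'] [CompleteSpace B]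
    (f : A →L[ℂ] A') : (hR f B)† = hR (f†) B := by
  rw [hR, hmap_adjoint, adjoint_id]

theorem hL_adjoint [CompleteSpace A] [CompleteSpace B] [CompleteSpace B']
    (g : B →L[ℂ] B') : (hL A g)† = hL A (g†) := by
  rw [hL, hmap_adjoint, adjoint_id]

/-- The map `⟨φ| ⊗ 1 : A ⊗ G → G`. -/
def bra (φ : A) (G : Type*) [NormedAddCommGroup G] [InnerProductSpace ℂ G] [CompleteSpace G] :
    A ⊗ₕ G →L[ℂ] G := (ketL φ G)†

section Bra

variable [CompleteSpace G]

theorem inner_bra_right (φ : A) (g : G) (x : A ⊗ₕ G) :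
    inner ℂ g (bra φ G x) = inner ℂ (htmul φ g) x :=
  ContinuousLinearMap.adjoint_inner_right _ _ _

theorem inner_bra_left (φ : A) (g : G) (x : A ⊗ₕ G) :
    inner ℂ (bra φ G x) g = inner ℂ x (htmul φ g) :=
  ContinuousLinearMap.adjoint_inner_left _ _ _

theorem bra_htmul (φ a : A) (g : G) : bra φ G (htmul a g) = (inner ℂ φ a : ℂ) • g :=
  ext_inner_left ℂ fun z => by rw [inner_bra_right, inner_htmul, inner_smul_right]

theorem bra_ext {x y : A ⊗ₕ G} (h : ∀ φ, bra φ G x = bra φ G y) : x = y :=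
  hinner_ext fun a b => by rw [← inner_bra_right, h, inner_bra_right]

theorem bra_hL [CompleteSpace F] (g : G →L[ℂ] F) (φ : A) (x : A ⊗ₕ G) :
    bra φ F (hL A g x) = g (bra φ G x) := by
  have : bra φ F ∘L hL A g = g ∘L bra φ G :=
    hext fun a b => by simp [hmap_htmul, bra_htmul]
  exact congrArg (· x) this

theorem bra_hR [CompleteSpace A] [CompleteSpace A'] (f : A →L[ℂ] A') (φ : A') (x : A ⊗ₕ G) :
    bra φ G (hR f G x) = bra ((f†) φ) G x := by
  have : bra φ G ∘L hR f G = bra ((f†) φ) G :=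
    hext fun a b => by simp [hmap_htmul, bra_htmul, ContinuousLinearMap.adjoint_inner_left]
  exact congrArg (· x) this

theorem norm_bra_le (φ : A) (x : A ⊗ₕ G) : ‖bra φ G x‖ ≤ ‖φ‖ * ‖x‖ := by
  by_cases h : ‖bra φ G x‖ = 0
  · rw [h]; positivity
  have h1 : ‖bra φ G x‖ * ‖bra φ G x‖ ≤ (‖φ‖ * ‖x‖) * ‖bra φ G x‖ := by
    -- Cauchy–Schwarz with φ ⊗ g for g = (⟨φ|⊗1)x bounds ‖g‖² by ‖φ‖ ‖g‖ ‖x‖; one factor ‖g‖ ≠ 0 is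
    -- then cancelled.
    have h2 := norm_inner_le_norm (𝕜 := ℂ) (htmul φ (bra φ G x)) x
    rw [← inner_bra_right, norm_htmul, inner_self_eq_norm_sq_to_K] at h2
    have h3 : ‖((‖bra φ G x‖ : ℂ)) ^ 2‖ = ‖bra φ G x‖ * ‖bra φ G x‖ := by
      rw [norm_pow, Complex.norm_real, norm_norm, sq]
    have h4 : ‖((‖bra φ G x‖ : ℂ)) ^ 2‖ ≤ ‖φ‖ * ‖bra φ G x‖ * ‖x‖ := h2
    rw [h3] at h4
    linarith
  exact le_of_mul_le_mul_right h1 (lt_of_le_of_ne (norm_nonneg _) (Ne.symm h))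

/-- The factorization |φ⟩⟨φ'| ⊗ 1 = (|φ⟩⊗1)(⟨φ'|⊗1) is what reduces the generator to inner products
of slices. -/
theorem inner_hR_rankOne (φ φ' : A) (x y : A ⊗ₕ G) :
    inner ℂ x (hR (InnerProductSpace.rankOne ℂ φ φ') G y) =
      inner ℂ (bra φ G x) (bra φ' G y) := by
  have : hR (InnerProductSpace.rankOne ℂ φ φ') G = ketL φ G ∘L bra φ' G :=
    hext fun a b => by
      simp [hmap_htmul, bra_htmul, ketL_apply, InnerProductSpace.rankOne_apply,
        htmul_smul_left]
  rw [this, inner_bra_left]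
  rfl

end Bra

theorem assocL_htmul (a : A) (b : B) (c : C) :
    assocL A B C (htmul (htmul a b) c) = htmul a (htmul b c) := hassoc_htmul a b c

@[simp] theorem assocL_assocR (x : A ⊗ₕ (B ⊗ₕ C)) : assocL A B C (assocR A B C x) = x :=
  (hassoc A B C).apply_symm_apply x

theorem inner_assocL (x y : (A ⊗ₕ B) ⊗ₕ C) :
    inner ℂ (assocL A B C x) (assocL A B C y) = inner ℂ x y :=
  (hassoc A B C).inner_map_map x y

theorem norm_assocR (x : A ⊗ₕ (B ⊗ₕ C)) : ‖assocR A B C x‖ = ‖x‖ :=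
  (hassoc A B C).symm.norm_map x

theorem norm_assocL (x : (A ⊗ₕ B) ⊗ₕ C) : ‖assocL A B C x‖ = ‖x‖ :=
  (hassoc A B C).norm_map x

theorem hext₃ {M : Type*} [NormedAddCommGroup M] [NormedSpace ℂ M]
    {f g : (A ⊗ₕ B) ⊗ₕ C →L[ℂ] M}
    (h : ∀ a b c, f (htmul (htmul a b) c) = g (htmul (htmul a b) c)) : f = g := by
  refine hext fun x c => ?_
  have : f ∘L ketR (A ⊗ₕ B) c = g ∘L ketR (A ⊗ₕ B) c := hext fun a b => h a b c
  exact congrArg (· x) this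

theorem assocL_hR_hR (f : A →L[ℂ] A') (x : (A ⊗ₕ B) ⊗ₕ C) :
    assocL A' B C (hR (hR f B) C x) = hR f (B ⊗ₕ C) (assocL A B C x) := by
  have : assocL A' B C ∘L hR (hR f B) C = hR f (B ⊗ₕ C) ∘L assocL A B C :=
    hext₃ fun a b c => by
      simp only [ContinuousLinearMap.comp_apply, hmap_htmul, assocL_htmul]; rfl
  exact congrArg (· x) this

/-- Isometries stay isometric after tensoring with identities. -/
theorem norm_hL_of_isometry {g : B →L[ℂ] B'} (hg : ∀ b b', inner ℂ (g b) (g b') = inner ℂ b b')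
    (x : A ⊗ₕ B) : ‖hL A g x‖ = ‖x‖ := by
  let g' : B →ₗᵢ[ℂ] B' := g.toLinearMap.isometryOfInner hg
  refine (denseRange_hincl (A := A) (B := B)).induction_on (p := fun x => ‖hL A g x‖ = ‖x‖) x
    (isClosed_eq (by fun_prop) continuous_norm) fun x => ?_
  rw [hL, hmap_hincl, LinearIsometry.norm_map, LinearIsometry.norm_map]
  have h : TensorProduct.mapL (ContinuousLinearMap.id ℂ A) g x = g'.lTensor A x := by
    rw [TensorProduct.mapL_apply, LinearIsometry.lTensor_apply]; rfl
  rw [h, LinearIsometry.norm_map]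

end TensorCalculus

/-! ### Separability of tensor products and of isometrically embedded spaces. -/

section Separable

open TopologicalSpace

instance {A B : Type*} [NormedAddCommGroup A] [InnerProductSpace ℂ A]
    [NormedAddCommGroup B] [InnerProductSpace ℂ B] [SeparableSpace A] [SeparableSpace B] : SeparableSpace (A ⊗ₕ B) := by
  have h1 : IsSeparable (Set.range fun p : A × B => htmul p.1 p.2) :=
    isSeparable_range continuous_htmul
  have h2 := (h1.span (R := ℂ)).closure
  rw [dense_span_htmul.closure_eq] at h2
  exact isSeparable_univ_iff.1 h2

theorem separableSpace_of_isometry {A B : Type*} [NormedAddCommGroup A] [NormedAddCommGroup B]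
    {f : A → B} (hf : Isometry f) [SeparableSpace B] :
    SeparableSpace A := by
  have : SecondCountableTopology B := UniformSpace.secondCountable_of_separable B
  have := hf.isEmbedding.secondCountableTopology
  infer_instance

end Separable

theorem hmap_zero_left {A A' B B' : Type*}
    [NormedAddCommGroup A] [InnerProductSpace ℂ A] [NormedAddCommGroup A'] [InnerProductSpace ℂ A']
    [NormedAddCommGroup B] [InnerProductSpace ℂ B] [NormedAddCommGroup B'] [InnerProductSpace ℂ B']
    (g : B →L[ℂ] B') : hmap (0 : A →L[ℂ] A') g = 0 :=
  hext fun a b => by simp [hmap_htmul]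

/-! ### Orthogonal decompositions of a Hilbert space -/

section Decomposition

open Filter Topology

/-- The maps `p₀`, `p i` are the coordinates of a Hilbert space decomposed into an orthogonal
sum. -/
structure IsDecomposition {I M G₀ : Type*} {G : I → Type*}
    [NormedAddCommGroup M] [InnerProductSpace ℂ M] [CompleteSpace M]
    [NormedAddCommGroup G₀] [InnerProductSpace ℂ G₀] [CompleteSpace G₀]
    [∀ i, NormedAddCommGroup (G i)] [∀ i, InnerProductSpace ℂ (G i)] [∀ i, CompleteSpace (G i)]
    (p₀ : M →L[ℂ] G₀) (p : ∀ i, M →L[ℂ] G i) : Prop where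
  apply_adjoint_self : ∀ i y, p i (((p i)†) y) = y
  apply_adjoint_of_ne : ∀ i j, i ≠ j → ∀ y, p i (((p j)†) y) = 0
  zero_apply_adjoint_zero : ∀ y, p₀ ((p₀†) y) = y
  zero_apply_adjoint : ∀ j y, p₀ (((p j)†) y) = 0
  eq_zero : ∀ x, p₀ x = 0 → (∀ i, p i x = 0) → x = 0

namespace IsDecomposition

variable {I M G₀ : Type*} {G : I → Type*}
  [NormedAddCommGroup M] [InnerProductSpace ℂ M] [CompleteSpace M]
  [NormedAddCommGroup G₀] [InnerProductSpace ℂ G₀] [CompleteSpace G₀]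
  [∀ i, NormedAddCommGroup (G i)] [∀ i, InnerProductSpace ℂ (G i)] [∀ i, CompleteSpace (G i)]
  {p₀ : M →L[ℂ] G₀} {p : ∀ i, M →L[ℂ] G i}

theorem apply_adjoint_zero (h : IsDecomposition p₀ p) (i : I) (y : G₀) : p i ((p₀†) y) = 0 :=
  ext_inner_left ℂ fun z => by
    rw [← ContinuousLinearMap.adjoint_inner_left, ContinuousLinearMap.adjoint_inner_right,
      h.zero_apply_adjoint, inner_zero_left, inner_zero_right]

theorem ext (h : IsDecomposition p₀ p) {x y : M} (h₀ : p₀ x = p₀ y) (hi : ∀ i, p i x = p i y) :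
    x = y :=
  sub_eq_zero.1 <| h.eq_zero _ (by rw [map_sub, h₀, sub_self]) fun i => by
    rw [map_sub, hi, sub_self]

theorem inner_adjoint_adjoint (h : IsDecomposition p₀ p) (i : I) (y z : G i) :
    inner ℂ (((p i)†) y) (((p i)†) z) = inner ℂ y z := by
  rw [ContinuousLinearMap.adjoint_inner_left, h.apply_adjoint_self]

theorem norm_adjoint (h : IsDecomposition p₀ p) (i : I) (y : G i) : ‖((p i)†) y‖ = ‖y‖ := by
  rw [@norm_eq_sqrt_re_inner ℂ, h.inner_adjoint_adjoint, ← @norm_eq_sqrt_re_inner ℂ]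

/-- The inclusions of the summands. -/
def incl (h : IsDecomposition p₀ p) (i : I) : G i →ₗᵢ[ℂ] M :=
  ((((p i)†) : G i →L[ℂ] M) : G i →ₗ[ℂ] M).isometryOfInner (h.inner_adjoint_adjoint i)

theorem incl_apply (h : IsDecomposition p₀ p) (i : I) (y : G i) : h.incl i y = ((p i)†) y := rfl

theorem orthogonalFamily (h : IsDecomposition p₀ p) : OrthogonalFamily ℂ G h.incl :=
  fun i j hij y z => by
    rw [incl_apply, incl_apply, ContinuousLinearMap.adjoint_inner_left,
      h.apply_adjoint_of_ne i j hij, inner_zero_right]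

theorem norm_sum_sq (h : IsDecomposition p₀ p) (l : ∀ i, G i) (s : Finset I) :
    ‖∑ i ∈ s, ((p i)†) (l i)‖ ^ 2 = ∑ i ∈ s, ‖l i‖ ^ 2 := by
  classical exact h.orthogonalFamily.norm_sum l s

/-- Bessel's inequality: z is the projection of x onto finitely many summands, so ⟨z, x⟩ = ‖z‖². -/
theorem sum_norm_sq_le (h : IsDecomposition p₀ p) (x : M) (s : Finset I) :
    ∑ i ∈ s, ‖p i x‖ ^ 2 ≤ ‖x‖ ^ 2 := by
  set z := ∑ i ∈ s, ((p i)†) (p i x) with hz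
  have h1 : ‖z‖ ^ 2 = ∑ i ∈ s, ‖p i x‖ ^ 2 := h.norm_sum_sq _ _
  have h2 : (inner ℂ z x : ℂ) = ((∑ i ∈ s, ‖p i x‖ ^ 2 : ℝ) : ℂ) := by
    rw [hz, sum_inner]
    push_cast
    refine Finset.sum_congr rfl fun i _ => ?_
    rw [ContinuousLinearMap.adjoint_inner_left, inner_self_eq_norm_sq_to_K]
    rfl
  have h3 : ‖z‖ ^ 2 ≤ ‖z‖ * ‖x‖ := by
    have := norm_inner_le_norm (𝕜 := ℂ) z x
    rwa [h2, ← h1, Complex.norm_real, Real.norm_of_nonneg (by positivity)] at this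
  rw [← h1]
  nlinarith [sq_nonneg (‖z‖ - ‖x‖), norm_nonneg z, norm_nonneg x]

theorem summable_norm_sq (h : IsDecomposition p₀ p) (x : M) : Summable fun i => ‖p i x‖ ^ 2 :=
  summable_of_sum_le (fun _ => by positivity) fun s => h.sum_norm_sq_le x s

theorem summable_adjoint (h : IsDecomposition p₀ p) {l : ∀ i, G i}
    (hl : Summable fun i => ‖l i‖ ^ 2) : Summable fun i => ((p i)†) (l i) :=
  (h.orthogonalFamily.summable_iff_norm_sq_summable l).2 hl

theorem hasSum (h : IsDecomposition p₀ p) (x : M) :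
    HasSum (fun i => ((p i)†) (p i x)) (x - (p₀†) (p₀ x)) := by
  classical
  obtain ⟨z, hz⟩ := h.summable_adjoint (h.summable_norm_sq x)
  have hzx : z = x - (p₀†) (p₀ x) := by
    refine h.ext ?_ fun i => ?_
    · have h1 := p₀.hasSum hz
      simp only [h.zero_apply_adjoint] at h1
      rw [h1.unique hasSum_zero, map_sub, h.zero_apply_adjoint_zero, sub_self]
    · have h1 := (p i).hasSum hz
      have h2 : HasSum (fun j => (p i) (((p j)†) (p j x))) (p i (((p i)†) (p i x))) :=
        hasSum_single i fun j hj => h.apply_adjoint_of_ne i j hj.symm _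
      rw [h1.unique h2, map_sub, h.apply_adjoint_self, h.apply_adjoint_zero, sub_zero]
  rwa [← hzx]

variable {N D₀ : Type*} {D : I → Type*}
  [NormedAddCommGroup N] [InnerProductSpace ℂ N] [CompleteSpace N]
  [NormedAddCommGroup D₀] [InnerProductSpace ℂ D₀] [CompleteSpace D₀]
  [∀ i, NormedAddCommGroup (D i)] [∀ i, InnerProductSpace ℂ (D i)] [∀ i, CompleteSpace (D i)]
  {q₀ : N →L[ℂ] D₀} {q : ∀ i, N →L[ℂ] D i}

/-- Bounded block diagonal operators. -/
theorem exists_blockDiagonal [Countable I] (h : IsDecomposition p₀ p) (k : IsDecomposition q₀ q)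
    (t : ∀ i, G i →L[ℂ] D i) (C : ℝ) (ht : ∀ i, ‖t i‖ ≤ C) :
    ∃ T : M →L[ℂ] N, SOTHasSum (fun i => ((q i)†) ∘L t i ∘L p i) T := by
  have hs : ∀ x, Summable fun i => (((q i)†) ∘L t i ∘L p i) x := fun x => by
    refine k.summable_adjoint (l := fun i => t i (p i x)) ?_
    refine Summable.of_nonneg_of_le (fun _ => by positivity) (fun i => ?_)
      ((h.summable_norm_sq x).mul_left (C ^ 2))
    rw [← mul_pow]
    gcongr
    exact (t i).le_of_opNorm_le (ht i) _
  -- The pointwise limit of the partial sums is bounded by Banach–Steinhaus. Countability of I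
  -- enters here: it makes the filter `atTop` on finite subsets countably generated.
  refine ⟨continuousLinearMapOfTendsto (l := atTop)
    (fun s : Finset I => ∑ i ∈ s, ((q i)†) ∘L t i ∘L p i)
    (f := fun x => ∑' i, (((q i)†) ∘L t i ∘L p i) x) ?_, fun x => (hs x).hasSum⟩
  rw [tendsto_pi_nhds]
  intro x
  simp only [sum_apply]
  exact (hs x).hasSum

/-- An operator whose blocks in each row have pairwise orthogonal ranges is the sum of its
blocks. -/
theorem hasSum_blocks (h : IsDecomposition p₀ p) (k : IsDecomposition q₀ q)
    (S : M →L[ℂ] N) (h₀ : ∀ y, S ((p₀†) y) = 0) (k₀ : ∀ x, q₀ (S x) = 0)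
    (ho : ∀ i j l, j ≠ l → ∀ y z, inner ℂ (q i (S (((p j)†) y))) (q i (S (((p l)†) z))) = (0 : ℂ)) :
    SOTHasSum (fun ij : I × I => ((q ij.1)†) ∘L (q ij.1 ∘L S ∘L ((p ij.2)†)) ∘L p ij.2) S := by
  classical
  intro x
  set f : I × I → N := fun ij => ((q ij.1)†) (q ij.1 (S (((p ij.2)†) (p ij.2 x)))) with hf
  have hort : ∀ a b : I × I, a ≠ b → inner ℂ (f a) (f b) = (0 : ℂ) := by
    rintro ⟨i, j⟩ ⟨i', j'⟩ hab
    by_cases hi : i = i'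
    · subst hi
      have hj : j ≠ j' := fun e => hab (by rw [e])
      simp only [hf]
      rw [k.inner_adjoint_adjoint]
      exact ho i j j' hj _ _
    · exact k.orthogonalFamily hi _ _
  have hnorm : ∀ s : Finset (I × I), ‖∑ a ∈ s, f a‖ ^ 2 = ∑ a ∈ s, ‖f a‖ ^ 2 := fun s => by
    have : ((‖∑ a ∈ s, f a‖ ^ 2 : ℝ) : ℂ) = ((∑ a ∈ s, ‖f a‖ ^ 2 : ℝ) : ℂ) := by
      push_cast
      have e := inner_self_eq_norm_sq_to_K (𝕜 := ℂ) (∑ a ∈ s, f a)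
      refine Eq.trans e.symm ?_
      rw [sum_inner]
      refine Finset.sum_congr rfl fun a ha => ?_
      rw [inner_sum, Finset.sum_eq_single a (fun b _ hb => hort a b hb.symm)
        (fun h => absurd ha h), inner_self_eq_norm_sq_to_K]
      rfl
    exact_mod_cast this
  -- On a rectangle the blocks add up to S cut down to finitely many rows and columns, so Bessel for
  -- rows and for columns bounds the sum. Any finite set of blocks lies in a rectangle.
  have hrect : ∀ s t : Finset I, ∑ a ∈ s ×ˢ t, ‖f a‖ ^ 2 ≤ (‖S‖ * ‖x‖) ^ 2 := fun s t => by
    rw [← hnorm]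
    have e : ∑ a ∈ s ×ˢ t, f a = ∑ i ∈ s, ((q i)†) (q i (S (∑ j ∈ t, ((p j)†) (p j x)))) := by
      rw [Finset.sum_product]
      simp only [hf, map_sum]
    rw [e, k.norm_sum_sq]
    refine (k.sum_norm_sq_le _ _).trans ?_
    gcongr
    refine (S.le_opNorm _).trans ?_
    gcongr
    have := h.sum_norm_sq_le x t
    rw [← h.norm_sum_sq] at this
    exact (sq_le_sq₀ (norm_nonneg _) (norm_nonneg _)).1 this
  have hsq : Summable fun a => ‖f a‖ ^ 2 := by
    refine summable_of_sum_le (fun _ => by positivity) (c := (‖S‖ * ‖x‖) ^ 2) fun s => ?_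
    refine le_trans (Finset.sum_le_sum_of_subset_of_nonneg (t := s.image Prod.fst ×ˢ s.image Prod.snd)
      Finset.subset_product (fun _ _ _ => by positivity)) (hrect _ _)
  have hsum : Summable f := by
    rw [summable_iff_vanishing_norm]
    intro ε hε
    obtain ⟨s, hs⟩ := summable_iff_vanishing_norm.1 hsq (ε ^ 2) (by positivity)
    refine ⟨s, fun t ht => ?_⟩
    have h1 := hs t ht
    rw [← hnorm, Real.norm_of_nonneg (by positivity)] at h1
    exact lt_of_pow_lt_pow_left₀ 2 hε.le h1
  obtain ⟨z, hz⟩ := hsum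
  -- Unconditional summability is known by now; summing along rows identifies the limit as S x.
  have hrow : ∀ i, HasSum (fun j => f (i, j)) (((q i)†) (q i (S x))) := fun i => by
    have h1 := ((((q i)†) ∘L q i ∘L S).hasSum (h.hasSum x))
    have h2 : (((q i)†) ∘L q i ∘L S) (x - (p₀†) (p₀ x)) = ((q i)†) (q i (S x)) := by
      simp [h₀]
    rwa [h2] at h1
  have h3 := hz.prod_fiberwise hrow
  have h4 := k.hasSum (S x)
  rw [k₀, map_zero, sub_zero] at h4
  rw [h4.unique h3]
  exact hz

end IsDecomposition

end Decomposition

/-! ### The coordinates of the block space, and their amplification by E. -/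

section BlockDecomposition

variable {I : Type*} {H H₀ : Type*} {A B : I → Type*}
  [NormedAddCommGroup H] [InnerProductSpace ℂ H]
  [NormedAddCommGroup H₀] [InnerProductSpace ℂ H₀]
  [∀ i, NormedAddCommGroup (A i)] [∀ i, InnerProductSpace ℂ (A i)]
  [∀ i, NormedAddCommGroup (B i)] [∀ i, InnerProductSpace ℂ (B i)]

theorem proj_adjoint [CompleteSpace H] [DecidableEq I] (P : BlockSpace H₀ A B ≃ₗᵢ[ℂ] H) (i : I) (y : A i ⊗ₕ B i) :
    ((proj P i)†) y = P (WithLp.toLp 2 (0, lp.single 2 i y)) := by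
  refine ext_inner_right ℂ fun x => ?_
  rw [ContinuousLinearMap.adjoint_inner_left]
  obtain ⟨x, rfl⟩ := P.surjective x
  rw [P.inner_map_map, WithLp.prod_inner_apply]
  simp [proj, lp.inner_single_left]
  rfl

theorem proj₀_adjoint [CompleteSpace H] [CompleteSpace H₀] (P : BlockSpace H₀ A B ≃ₗᵢ[ℂ] H) (y : H₀) :
    ((proj₀ P)†) y = P (WithLp.toLp 2 (y, 0)) := by
  refine ext_inner_right ℂ fun x => ?_
  rw [ContinuousLinearMap.adjoint_inner_left]
  obtain ⟨x, rfl⟩ := P.surjective x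
  rw [P.inner_map_map, WithLp.prod_inner_apply]
  simp [proj₀]

theorem proj_apply (P : BlockSpace H₀ A B ≃ₗᵢ[ℂ] H) (i : I) (x : BlockSpace H₀ A B) :
    proj P i (P x) = x.snd i := by
  simp [proj]
  rfl

theorem proj₀_apply (P : BlockSpace H₀ A B ≃ₗᵢ[ℂ] H) (x : BlockSpace H₀ A B) :
    proj₀ P (P x) = x.fst := by
  simp [proj₀]

theorem isDecomposition_proj [CompleteSpace H] [CompleteSpace H₀]
    (P : BlockSpace H₀ A B ≃ₗᵢ[ℂ] H) :
    IsDecomposition (proj₀ P) (proj P) := by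
  classical
  refine ⟨fun i y => ?_, fun i j hij y => ?_, fun y => ?_, fun j y => ?_, fun x h₀ h => ?_⟩
  · rw [proj_adjoint, proj_apply]
    exact lp.single_apply_self (E := fun i => A i ⊗ₕ B i) 2 i y
  · rw [proj_adjoint, proj_apply]
    exact lp.single_apply_ne (E := fun i => A i ⊗ₕ B i) 2 j y hij
  · rw [proj₀_adjoint, proj₀_apply]; rfl
  · rw [proj_adjoint, proj₀_apply]; rfl
  · obtain ⟨x, rfl⟩ := P.surjective x
    rw [proj₀_apply] at h₀
    simp only [proj_apply] at h
    have : x = 0 := by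
      refine WithLp.ofLp_injective 2 (Prod.ext h₀ ?_)
      ext i
      exact h i
    rw [this, map_zero]

variable {E : Type*} [NormedAddCommGroup E] [InnerProductSpace ℂ E] [CompleteSpace E]

theorem IsDecomposition.hR {M G₀ : Type*} {G : I → Type*}
    [NormedAddCommGroup M] [InnerProductSpace ℂ M] [CompleteSpace M]
    [NormedAddCommGroup G₀] [InnerProductSpace ℂ G₀] [CompleteSpace G₀]
    [∀ i, NormedAddCommGroup (G i)] [∀ i, InnerProductSpace ℂ (G i)] [∀ i, CompleteSpace (G i)]
    {p₀ : M →L[ℂ] G₀} {p : ∀ i, M →L[ℂ] G i} (h : IsDecomposition p₀ p) :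
    IsDecomposition (GKLS.hR p₀ E) (fun i => GKLS.hR (p i) E) := by
  refine ⟨fun i y => ?_, fun i j hij y => ?_, fun y => ?_, fun j y => ?_, fun x h₀ hi => ?_⟩
  · rw [hR_adjoint, hmap_comp_apply]
    have : p i ∘L ((p i)†) = ContinuousLinearMap.id ℂ _ :=
      ContinuousLinearMap.ext (h.apply_adjoint_self i)
    rw [this, ContinuousLinearMap.id_comp, hmap_id]
    rfl
  · rw [hR_adjoint, hmap_comp_apply]
    have : p i ∘L ((p j)†) = 0 := ContinuousLinearMap.ext (h.apply_adjoint_of_ne i j hij)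
    rw [this, ContinuousLinearMap.id_comp, hmap_zero_left]
    rfl
  · rw [hR_adjoint, hmap_comp_apply]
    have : p₀ ∘L (p₀†) = ContinuousLinearMap.id ℂ _ :=
      ContinuousLinearMap.ext h.zero_apply_adjoint_zero
    rw [this, ContinuousLinearMap.id_comp, hmap_id]
    rfl
  · rw [hR_adjoint, hmap_comp_apply]
    have : p₀ ∘L ((p j)†) = 0 := ContinuousLinearMap.ext (h.zero_apply_adjoint j)
    rw [this, ContinuousLinearMap.id_comp, hmap_zero_left]
    rfl
  -- Expanding m in its components shows that a vector whose coordinates all vanish is orthogonal to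
  -- every m ⊗ e.
  · refine hinner_ext fun m e => ?_
    rw [inner_zero_right]
    have h1 : ∀ i y, inner ℂ (htmul (((p i)†) y) e) x = (0 : ℂ) := fun i y => by
      have : htmul (((p i)†) y) e = ((GKLS.hR (p i) E)†) (htmul y e) := by
        rw [hR_adjoint, hmap_htmul]; rfl
      rw [this, ContinuousLinearMap.adjoint_inner_left, hi, inner_zero_right]
    have h2 : ∀ y, inner ℂ (htmul ((p₀†) y) e) x = (0 : ℂ) := fun y => by
      have : htmul ((p₀†) y) e = ((GKLS.hR p₀ E)†) (htmul y e) := by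
        rw [hR_adjoint, hmap_htmul]; rfl
      rw [this, ContinuousLinearMap.adjoint_inner_left, h₀, inner_zero_right]
    have h3 := (ketR M e).hasSum (h.hasSum m)
    have h4 := (innerSL ℂ x).hasSum h3
    have h5 : ∀ i, inner ℂ x (htmul (((p i)†) (p i m)) e) = (0 : ℂ) := fun i => by
      rw [← inner_conj_symm, h1, map_zero]
    simp only [innerSL_apply_apply, ketR_apply, h5, htmul_sub_left] at h4
    have h6 := h4.unique hasSum_zero
    rw [inner_sub_right, sub_eq_zero] at h6
    rw [← inner_conj_symm, h6, inner_conj_symm, h2]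

end BlockDecomposition

/-! ### Slices of operators between tensor products -/

section Slice

variable {A A' B B' E F G : Type*}
  [NormedAddCommGroup A] [InnerProductSpace ℂ A]
  [NormedAddCommGroup A'] [InnerProductSpace ℂ A']
  [NormedAddCommGroup B] [InnerProductSpace ℂ B]
  [NormedAddCommGroup B'] [InnerProductSpace ℂ B']
  [NormedAddCommGroup E] [InnerProductSpace ℂ E]
  [NormedAddCommGroup F] [InnerProductSpace ℂ F] [CompleteSpace F]
  [NormedAddCommGroup G] [InnerProductSpace ℂ G] [CompleteSpace G]

/-- The slice `(⟨φ| ⊗ 1) v (|ψ⟩ ⊗ 1)` of `v`. -/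
def slice (φ : A) (ψ : A') (v : A' ⊗ₕ B' →L[ℂ] A ⊗ₕ G) : B' →L[ℂ] G :=
  bra φ G ∘L v ∘L ketL ψ B'

theorem slice_apply (φ : A) (ψ : A') (v : A' ⊗ₕ B' →L[ℂ] A ⊗ₕ G) (b : B') :
    slice φ ψ v b = bra φ G (v (htmul ψ b)) := rfl

theorem slice_ext {v w : A' ⊗ₕ B' →L[ℂ] A ⊗ₕ G}
    (h : ∀ φ ψ b, slice φ ψ v b = slice φ ψ w b) : v = w :=
  hext fun a b => bra_ext fun φ => h φ a b

theorem slice_add (φ : A) (ψ : A') (v w : A' ⊗ₕ B' →L[ℂ] A ⊗ₕ G) (b : B') :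
    slice φ ψ (v + w) b = slice φ ψ v b + slice φ ψ w b :=
  (bra φ G).map_add _ _

theorem slice_sub (φ : A) (ψ : A') (v w : A' ⊗ₕ B' →L[ℂ] A ⊗ₕ G) (b : B') :
    slice φ ψ (v - w) b = slice φ ψ v b - slice φ ψ w b :=
  (bra φ G).map_sub _ _

theorem slice_smul (φ : A) (ψ : A') (c : ℂ) (v : A' ⊗ₕ B' →L[ℂ] A ⊗ₕ G) (b : B') :
    slice φ ψ (c • v) b = c • slice φ ψ v b :=
  (bra φ G).map_smul _ _

theorem slice_hL (φ ψ : A) (g : B' →L[ℂ] G) (b : B') :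
    slice φ ψ (hL A g) b = (inner ℂ φ ψ : ℂ) • g b := by
  rw [slice_apply, hmap_htmul, bra_htmul]; rfl

theorem slice_hR (φ : A) (ψ : A') (f : A' →L[ℂ] A) (b : G) :
    slice φ ψ (hR f G) b = (inner ℂ φ (f ψ) : ℂ) • b := by
  rw [slice_apply, hmap_htmul, bra_htmul]; rfl

theorem slice_hL_comp (φ : A) (ψ : A') (g : G →L[ℂ] F) (v : A' ⊗ₕ B' →L[ℂ] A ⊗ₕ G) (b : B') :
    slice φ ψ (hL A g ∘L v) b = g (slice φ ψ v b) :=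
  bra_hL g φ _

theorem bra_assocL_htmul (φ : A) (x : A ⊗ₕ F) (b : B') :
    bra φ (F ⊗ₕ B') (assocL A F B' (htmul x b)) = htmul (bra φ F x) b := by
  have : bra φ (F ⊗ₕ B') ∘L assocL A F B' ∘L ketR (A ⊗ₕ F) b = ketR F b ∘L bra φ F :=
    hext fun a f => by
      simp only [ContinuousLinearMap.comp_apply, ketR_apply, assocL_htmul, bra_htmul,
        htmul_smul_left]
  exact congrArg (· x) this

/-- The left factor F is where the slices of `a` live, so a factorization through U can be checked
and compared on slices alone. -/
theorem slice_semilocal (φ : A) (ψ : A') (U : F ⊗ₕ B' →L[ℂ] B ⊗ₕ E) (a : A' →L[ℂ] A ⊗ₕ F)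
    (b : B') :
    slice φ ψ (assocL A B E ∘L semilocal U a) b = U (htmul (bra φ F (a ψ)) b) := by
  rw [slice_apply]
  simp only [semilocal, ampR, ContinuousLinearMap.comp_apply, assocL_assocR]
  rw [bra_hL, hmap_htmul, bra_assocL_htmul]
  rfl

theorem slice_ampR (φ ψ : A) (g : B' →L[ℂ] B ⊗ₕ E) (b : B') :
    slice φ ψ (assocL A B E ∘L ampR A g) b = (inner ℂ φ ψ : ℂ) • g b := by
  rw [← slice_hL]
  simp only [slice_apply, ampR, ContinuousLinearMap.comp_apply, assocL_assocR]

theorem norm_slice_le (φ : A) (ψ : A') (v : A' ⊗ₕ B' →L[ℂ] A ⊗ₕ G) :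
    ‖slice φ ψ v‖ ≤ ‖φ‖ * ‖ψ‖ * ‖v‖ := by
  refine ContinuousLinearMap.opNorm_le_bound _ (by positivity) fun b => ?_
  refine (norm_bra_le _ _).trans ?_
  calc ‖φ‖ * ‖v (htmul ψ b)‖ ≤ ‖φ‖ * (‖v‖ * ‖htmul ψ b‖) := by
        gcongr; exact v.le_opNorm _
    _ = ‖φ‖ * ‖ψ‖ * ‖v‖ * ‖b‖ := by rw [norm_htmul]; ring

end Slice

/-! ### Spaces of multiples of isometries -/

section ScalarSpace

variable {B G : Type u} [NormedAddCommGroup B] [InnerProductSpace ℂ B]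
  [NormedAddCommGroup G] [InnerProductSpace ℂ G]

/-- A space of operators `s` with `s† t = ⟪s β, t β⟫ 1` is an inner product space. -/
@[reducible] def scalarInnerProductSpace (S : Submodule ℂ (B →L[ℂ] G)) (β : B) (hβ : ‖β‖ = 1)
    (hS : ∀ s ∈ S, ∀ t ∈ S, ∀ b b', inner ℂ (s b) (t b') = inner ℂ (s β) (t β) * inner ℂ b b') :
    InnerProductSpace ℂ S :=
  { (inferInstance : NormedSpace ℂ S) with
    inner := fun s t => inner ℂ (s.1 β) (t.1 β)
    -- The operator norm of s equals ‖s β‖, because s is a multiple of an isometry. The inner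
    -- product thus induces the given norm, and completeness of closed subspaces is inherited.
    norm_sq_eq_re_inner := fun s => by
      have h1 : ‖s.1 β‖ ≤ ‖s‖ := by
        have := s.1.le_opNorm β
        rwa [hβ, mul_one] at this
      have h2 : ‖s‖ ≤ ‖s.1 β‖ := by
        refine s.1.opNorm_le_bound (norm_nonneg _) fun b => ?_
        have h3 := hS s.1 s.2 s.1 s.2 b b
        rw [inner_self_eq_norm_sq_to_K, inner_self_eq_norm_sq_to_K, inner_self_eq_norm_sq_to_K,
          ← mul_pow] at h3
        have h4 : ‖s.1 b‖ ^ 2 = (‖s.1 β‖ * ‖b‖) ^ 2 := by exact_mod_cast h3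
        exact ((sq_le_sq₀ (norm_nonneg _) (by positivity)).1 h4.le)
      rw [le_antisymm h1 h2 |>.symm, ← inner_self_eq_norm_sq (𝕜 := ℂ)]
    conj_inner_symm := fun s t => inner_conj_symm _ _
    add_left := fun s t r => inner_add_left _ _ _
    smul_left := fun s t r => inner_smul_left _ _ _ }

end ScalarSpace

/-- A factorization `v = (1 ⊗ U)(a ⊗ 1)` with `U` isometric, expressed through the slices of `v`,
where the slices of `a` are total. -/
structure Factorization {A A' B' G : Type u}
    [NormedAddCommGroup A] [InnerProductSpace ℂ A]
    [NormedAddCommGroup A'] [InnerProductSpace ℂ A']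
    [NormedAddCommGroup B'] [InnerProductSpace ℂ B']
    [NormedAddCommGroup G] [InnerProductSpace ℂ G] [CompleteSpace G]
    (v : A' ⊗ₕ B' →L[ℂ] A ⊗ₕ G) where
  F : Type u
  [nF : NormedAddCommGroup F]
  [iF : InnerProductSpace ℂ F]
  [cF : CompleteSpace F]
  [sF : TopologicalSpace.SeparableSpace F]
  a : A' →L[ℂ] A ⊗ₕ F
  U : F ⊗ₕ B' →L[ℂ] G
  inner_U : ∀ x y, inner ℂ (U x) (U y) = inner ℂ x y
  U_htmul : ∀ φ ψ b, U (htmul (bra φ F (a ψ)) b) = slice φ ψ v b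
  total : IsTotal (Set.range fun p : A × A' => bra p.1 F (a p.2))

attribute [instance] Factorization.nF Factorization.iF Factorization.cF Factorization.sF

section Factorization

variable {A A' B' G : Type u}
  [NormedAddCommGroup A] [InnerProductSpace ℂ A]
  [NormedAddCommGroup A'] [InnerProductSpace ℂ A']
  [NormedAddCommGroup B'] [InnerProductSpace ℂ B']
  [NormedAddCommGroup G] [InnerProductSpace ℂ G]

/-- The constant c is found at b = b' = β. The resulting identity is sesquilinear and separately
continuous in (s, t), so it passes to the closed span in one variable at a time. -/
theorem scalar_of_mem_closure_span (S : Set (B' →L[ℂ] G)) (β : B') (hβ : ‖β‖ = 1)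
    (hS : ∀ s ∈ S, ∀ t ∈ S, ∃ c : ℂ, ∀ b b', inner ℂ (s b) (t b') = c * inner ℂ b b')
    {s t : B' →L[ℂ] G} (hs : s ∈ (Submodule.span ℂ S).topologicalClosure)
    (ht : t ∈ (Submodule.span ℂ S).topologicalClosure) (b b' : B') :
    inner ℂ (s b) (t b') = inner ℂ (s β) (t β) * inner ℂ b b' := by
  have h1 : ∀ s ∈ S, ∀ t ∈ S, ∀ b b',
      inner ℂ (s b) (t b') = inner ℂ (s β) (t β) * inner ℂ b b' := by
    intro s hs t ht b b'
    obtain ⟨c, hc⟩ := hS s hs t ht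
    rw [hc, hc β β, inner_self_eq_norm_sq_to_K, hβ]
    simp
  have h2 : ∀ s ∈ S, ∀ t ∈ (Submodule.span ℂ S).topologicalClosure, ∀ b b',
      inner ℂ (s b) (t b') = inner ℂ (s β) (t β) * inner ℂ b b' := by
    intro s hs t ht b b'
    let g : (B' →L[ℂ] G) →L[ℂ] ℂ :=
      innerSL ℂ (s b) ∘L ContinuousLinearMap.apply ℂ G b' -
        (inner ℂ b b' : ℂ) • (innerSL ℂ (s β) ∘L ContinuousLinearMap.apply ℂ G β)
    have hg : (Submodule.span ℂ S).topologicalClosure ≤ LinearMap.ker (g : _ →ₗ[ℂ] ℂ) := by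
      refine Submodule.topologicalClosure_minimal _ (Submodule.span_le.2 fun t ht => ?_)
        g.isClosed_ker
      simp only [SetLike.mem_coe, LinearMap.mem_ker]
      simp [g, h1 s hs t ht b b', mul_comm]
    have := hg ht
    simp only [LinearMap.mem_ker] at this
    simp [g, sub_eq_zero] at this
    rw [this, mul_comm]
  -- The identity is antilinear in s; its complex conjugate is linear and cuts out the kernel of a
  -- bounded functional.
  let g : (B' →L[ℂ] G) →L[ℂ] ℂ :=
      innerSL ℂ (t b') ∘L ContinuousLinearMap.apply ℂ G b -
        (inner ℂ b' b : ℂ) • (innerSL ℂ (t β) ∘L ContinuousLinearMap.apply ℂ G β)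
  have hg : (Submodule.span ℂ S).topologicalClosure ≤ LinearMap.ker (g : _ →ₗ[ℂ] ℂ) := by
    refine Submodule.topologicalClosure_minimal _ (Submodule.span_le.2 fun s hs => ?_)
        g.isClosed_ker
    have := congrArg (starRingEnd ℂ) (h2 s hs t ht b b')
    rw [map_mul, inner_conj_symm, inner_conj_symm, inner_conj_symm] at this
    simp only [SetLike.mem_coe, LinearMap.mem_ker]
    simp [g, this, mul_comm]
  have := hg hs
  simp only [LinearMap.mem_ker] at this
  simp [g, sub_eq_zero] at this
  have := congrArg (starRingEnd ℂ) this
  rw [map_mul, inner_conj_symm, inner_conj_symm, inner_conj_symm] at this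
  rw [this, mul_comm]

variable [CompleteSpace G]

/-- A Hilbert space of multiples of isometries that contains the slices of `v` as a total set
gives rise to a factorization. -/
theorem nonempty_factorization_of_scalar {F : Type u} [NormedAddCommGroup F]
    [InnerProductSpace ℂ F] [CompleteSpace F] [TopologicalSpace.SeparableSpace G]
    (v : A' ⊗ₕ B' →L[ℂ] A ⊗ₕ G) (τ : F →ₗ[ℂ] B' →L[ℂ] G) (β : B') (hβ : ‖β‖ = 1)
    (hτ : ∀ f g b b', inner ℂ (τ f b) (τ g b') = inner ℂ f g * inner ℂ b b')
    (f : A → A' → F) (hf : ∀ φ ψ, τ (f φ ψ) = slice φ ψ v)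
    (hd : IsTotal (Set.range fun p : A × A' => f p.1 p.2)) :
    Nonempty (Factorization v) := by
  -- Evaluation at β is isometric. It transfers separability from G to F, and its adjoint recovers
  -- an element of F from its value at β.
  let J : F →ₗᵢ[ℂ] G := LinearMap.isometryOfInner
    ((LinearMap.applyₗ β) ∘ₗ (ContinuousLinearMap.coeLM ℂ) ∘ₗ τ) fun s t => by
      have := hτ s t β β
      rw [inner_self_eq_norm_sq_to_K, hβ] at this
      simpa using this
  have hsep : TopologicalSpace.SeparableSpace F := separableSpace_of_isometry J.isometry
  let U₀ : F ⊗[ℂ] B' →ₗ[ℂ] G := TensorProduct.lift ((ContinuousLinearMap.coeLM ℂ) ∘ₗ τ)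
  have hU₀ : ∀ (s : F) (b : B'), U₀ (s ⊗ₜ b) = τ s b := fun _ _ => rfl
  have hU₀i : ∀ x y, inner ℂ (U₀ x) (U₀ y) = inner ℂ x y := by
    intro x y
    induction x using TensorProduct.induction_on with
    | zero => simp
    | add x x' hx hx' => rw [map_add, inner_add_left, inner_add_left, hx, hx']
    | tmul s b =>
      induction y using TensorProduct.induction_on with
      | zero => simp
      | add x x' hx hx' => rw [map_add, inner_add_right, inner_add_right, hx, hx']
      | tmul t b' => rw [hU₀, hU₀, TensorProduct.inner_tmul, hτ]
  have hU₀n : ∀ x, ‖U₀ x‖ = ‖hincl F B' x‖ := fun x => by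
    rw [LinearIsometry.norm_map]
    exact (U₀.isometryOfInner hU₀i).norm_map x
  let U : F ⊗ₕ B' →L[ℂ] G := U₀.extendOfNorm (hincl F B').toLinearMap
  have hU : ∀ x, U (hincl F B' x) = U₀ x := fun x =>
    LinearMap.extendOfNorm_eq (f := U₀) (e := (hincl F B').toLinearMap) denseRange_hincl
      ⟨1, fun x => by rw [one_mul, hU₀n]; rfl⟩ x
  have hUn : ∀ x, ‖U x‖ = ‖x‖ := fun x =>
    denseRange_hincl.induction_on (p := fun x => ‖U x‖ = ‖x‖) x
      (isClosed_eq (by fun_prop) continuous_norm) fun x => by rw [hU, hU₀n]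
  -- With a = (1⊗J†) v (1⊗|β⟩), the slice of a at (φ,ψ) is J†J f(φ,ψ) = f(φ,ψ).
  have hbra : ∀ φ ψ, bra φ F (hL A (J.toContinuousLinearMap†) (v (htmul ψ β))) = f φ ψ := by
    intro φ ψ
    rw [bra_hL]
    refine ext_inner_right ℂ fun t => ?_
    rw [ContinuousLinearMap.adjoint_inner_left, ← J.inner_map_map]
    have : J (f φ ψ) = slice φ ψ v β := congrArg (· β) (hf φ ψ)
    rw [this]
    rfl
  refine ⟨{
    F := F
    a := hL A (J.toContinuousLinearMap†) ∘L v ∘L ketR A' β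
    U := U
    inner_U := (LinearIsometry.mk U.toLinearMap hUn).inner_map_map
    U_htmul := fun φ ψ b => ?_
    total := ?_ }⟩
  · simp only [ContinuousLinearMap.comp_apply, ketR_apply]
    rw [hbra, htmul, hU, hU₀, hf]
  · simpa only [ContinuousLinearMap.comp_apply, ketR_apply, hbra] using hd

/-- The norm closure of the span of the slices of v is itself the space F: its elements are
multiples of isometries, and ⟨s β, t β⟩ is a complete inner product on it. -/
theorem nonempty_factorization [TopologicalSpace.SeparableSpace G] [Nontrivial B']
    (v : A' ⊗ₕ B' →L[ℂ] A ⊗ₕ G)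
    (hv : ∀ φ ψ φ' ψ', ∃ c : ℂ, ∀ b b',
      inner ℂ (slice φ ψ v b) (slice φ' ψ' v b') = c * inner ℂ b b') :
    Nonempty (Factorization v) := by
  obtain ⟨β, hβ⟩ := exists_norm_eq B' zero_le_one
  set R : Set (B' →L[ℂ] G) := Set.range fun p : A × A' => slice p.1 p.2 v with hR
  set S := (Submodule.span ℂ R).topologicalClosure with hSdef
  have hS : ∀ s ∈ S, ∀ t ∈ S, ∀ b b',
      inner ℂ (s b) (t b') = inner ℂ (s β) (t β) * inner ℂ b b' := fun s hs t ht =>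
    scalar_of_mem_closure_span R β hβ (by
      rintro _ ⟨p, rfl⟩ _ ⟨q, rfl⟩
      exact hv p.1 p.2 q.1 q.2) hs ht
  have hcomplete : CompleteSpace S := (Submodule.isClosed_topologicalClosure _).completeSpace_coe
  have hmem : ∀ r ∈ R, r ∈ S := fun r hr =>
    Submodule.le_topologicalClosure _ (Submodule.subset_span hr)
  refine @nonempty_factorization_of_scalar A A' B' G _ _ _ _ _ _ _ _ _ S _
    (scalarInnerProductSpace S β hβ hS) hcomplete _ v S.subtype β hβ
    (fun s t => hS s.1 s.2 t.1 t.2) (fun φ ψ => ⟨slice φ ψ v, hmem _ ⟨(φ, ψ), rfl⟩⟩)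
    (fun _ _ => rfl) ?_
  -- What remains is to move density of the span from the ambient operator space to the subtype S.
  have h2 : (Set.range fun p : A × A' => (⟨slice p.1 p.2 v, hmem _ ⟨p, rfl⟩⟩ : S)) =
      (Subtype.val ⁻¹' R : Set S) := by
    ext s
    simp only [Set.mem_range, Set.mem_preimage, hR, Subtype.ext_iff]
  have h3 : (Submodule.span ℂ (Subtype.val ⁻¹' R : Set S)).map S.subtype = Submodule.span ℂ R := by
    rw [Submodule.map_span]
    congr 1
    exact Set.image_preimage_eq_of_subset fun r hr => ⟨⟨r, hmem r hr⟩, rfl⟩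
  have h4 : Dense (Submodule.span ℂ (Subtype.val ⁻¹' R : Set S) : Set S) := by
    intro s
    rw [closure_subtype]
    have h5 : (Subtype.val '' (Submodule.span ℂ (Subtype.val ⁻¹' R : Set S) : Set S)) =
        (Submodule.span ℂ R : Set (B' →L[ℂ] G)) := by
      rw [← h3]; rfl
    rw [h5]
    exact s.2
  rw [← h2] at h4
  exact h4

end Factorization

/-! ### Blocks of generators -/

section Blocks

variable {I : Type*} {H H₀ E : Type*} {A B : I → Type*}
  [NormedAddCommGroup H] [InnerProductSpace ℂ H] [CompleteSpace H]
  [NormedAddCommGroup H₀] [InnerProductSpace ℂ H₀]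
  [NormedAddCommGroup E] [InnerProductSpace ℂ E] [CompleteSpace E]
  [∀ i, NormedAddCommGroup (A i)] [∀ i, InnerProductSpace ℂ (A i)]
  [∀ i, NormedAddCommGroup (B i)] [∀ i, InnerProductSpace ℂ (B i)]

/-- The block `(P i ⊗ 1) V P j†`. -/
def blockV (P : BlockSpace H₀ A B ≃ₗᵢ[ℂ] H) (V : H →L[ℂ] H ⊗ₕ E) (i j : I) :
    A j ⊗ₕ B j →L[ℂ] A i ⊗ₕ (B i ⊗ₕ E) :=
  assocL (A i) (B i) E ∘L hR (proj P i) E ∘L V ∘L (proj P j)†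

/-- The block `P i K P j†`. -/
def blockK (P : BlockSpace H₀ A B ≃ₗᵢ[ℂ] H) (K : H →L[ℂ] H) (i j : I) :
    A j ⊗ₕ B j →L[ℂ] A i ⊗ₕ B i :=
  proj P i ∘L K ∘L (proj P j)†

/-- The operator that acts as `x ⊗ 1` on the `i`-th block and as `0` elsewhere. -/
def embed (P : BlockSpace H₀ A B ≃ₗᵢ[ℂ] H) (i : I) (x : A i →L[ℂ] A i) : H →L[ℂ] H :=
  (proj P i)† ∘L hR x (B i) ∘L proj P i

variable {P : BlockSpace H₀ A B ≃ₗᵢ[ℂ] H} {𝒜 : NonUnitalStarSubalgebra ℂ (H →L[ℂ] H)}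

theorem embed_mem [CompleteSpace H₀] (h𝒜 : IsAtomicWith 𝒜 P) (i : I) (x : A i →L[ℂ] A i) : embed P i x ∈ 𝒜 := by
  classical
  have hP := isDecomposition_proj P
  refine (h𝒜 _).2 ⟨Pi.single i x, ⟨‖x‖, ?_⟩, ?_, fun j => ?_⟩
  · rintro _ ⟨j, rfl⟩
    by_cases h : j = i
    · subst h; simp
    · simp [Pi.single_eq_of_ne h]
  · ext y
    exact hP.zero_apply_adjoint i _
  · ext y
    by_cases h : j = i
    · subst h
      simp only [embed, ContinuousLinearMap.comp_apply, Pi.single_eq_same]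
      exact hP.apply_adjoint_self j _
    · simp only [embed, ContinuousLinearMap.comp_apply, Pi.single_eq_of_ne h, hR, hmap_zero_left]
      exact hP.apply_adjoint_of_ne j i h _

/-- Together with the two lemmas that follow, this is all that is used about an element L(X) of 𝒜:
scalar slices on the diagonal, zero blocks off it, and zero on H₀. -/
theorem inner_block_of_mem [CompleteSpace H₀] (h𝒜 : IsAtomicWith 𝒜 P) {X : H →L[ℂ] H} (hX : X ∈ 𝒜) (j : I)
    (ψ ψ' : A j) : ∃ c : ℂ, ∀ b b' : B j,
      inner ℂ (((proj P j)†) (htmul ψ b)) (X (((proj P j)†) (htmul ψ' b'))) =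
        c * inner ℂ b b' := by
  obtain ⟨x, -, -, hx⟩ := (h𝒜 X).1 hX
  have hP := isDecomposition_proj P
  refine ⟨inner ℂ ψ (x j ψ'), fun b b' => ?_⟩
  rw [ContinuousLinearMap.adjoint_inner_left]
  have h1 : proj P j (X (((proj P j)†) (htmul ψ' b'))) =
      hR (x j) (B j) (proj P j (((proj P j)†) (htmul ψ' b'))) := DFunLike.congr_fun (hx j) _
  rw [h1, hP.apply_adjoint_self, hmap_htmul, inner_htmul]
  rfl

theorem inner_block_of_mem_of_ne [CompleteSpace H₀] (h𝒜 : IsAtomicWith 𝒜 P) {X : H →L[ℂ] H} (hX : X ∈ 𝒜) {j k : I}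
    (hjk : j ≠ k) (y : A j ⊗ₕ B j) (z : A k ⊗ₕ B k) :
    inner ℂ (((proj P j)†) y) (X (((proj P k)†) z)) = (0 : ℂ) := by
  obtain ⟨x, -, -, hx⟩ := (h𝒜 X).1 hX
  have hP := isDecomposition_proj P
  rw [ContinuousLinearMap.adjoint_inner_left]
  have h1 : proj P j (X (((proj P k)†) z)) =
      hR (x j) (B j) (proj P j (((proj P k)†) z)) := DFunLike.congr_fun (hx j) _
  rw [h1, hP.apply_adjoint_of_ne j k hjk, map_zero, inner_zero_right]

theorem apply_adjoint_zero_of_mem [CompleteSpace H₀] (h𝒜 : IsAtomicWith 𝒜 P) {X : H →L[ℂ] H} (hX : X ∈ 𝒜) (y : H₀) :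
    X (((proj₀ P)†) y) = 0 := by
  obtain ⟨x, -, hx₀, hx⟩ := (h𝒜 X).1 hX
  have hP := isDecomposition_proj P
  refine hP.eq_zero _ (DFunLike.congr_fun hx₀ _) fun i => ?_
  have h1 : proj P i (X (((proj₀ P)†) y)) =
      hR (x i) (B i) (proj P i (((proj₀ P)†) y)) := DFunLike.congr_fun (hx i) _
  rw [h1, hP.apply_adjoint_zero, map_zero]

variable [∀ i, CompleteSpace (B i)]

/-- The rank-one operator splits each of the three terms of L into a product of slices. The vectors
u, w stay arbitrary so that vectors of H₀ can be inserted as well. -/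
theorem inner_generator_embed (V : H →L[ℂ] H ⊗ₕ E) (K : H →L[ℂ] H) (i : I) (φ φ' : A i) (u w : H) :
    inner ℂ u (generator V K (embed P i (InnerProductSpace.rankOne ℂ φ φ')) w) =
      inner ℂ (bra φ _ (assocL (A i) (B i) E (hR (proj P i) E (V u))))
        (bra φ' _ (assocL (A i) (B i) E (hR (proj P i) E (V w)))) -
      inner ℂ (bra φ _ (proj P i (K u))) (bra φ' _ (proj P i w)) -
      inner ℂ (bra φ _ (proj P i u)) (bra φ' _ (proj P i (K w))) := by
  have hV : hR (embed P i (InnerProductSpace.rankOne ℂ φ φ')) E =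
      (hR (proj P i) E)† ∘L hR (hR (InnerProductSpace.rankOne ℂ φ φ') (B i)) E ∘L
        hR (proj P i) E := by
    rw [hR_adjoint, hmap_comp, hmap_comp]
    simp only [ContinuousLinearMap.id_comp]
    rfl
  simp only [generator, sub_apply, ContinuousLinearMap.comp_apply,
    inner_sub_right, ContinuousLinearMap.adjoint_inner_right, hV]
  simp only [embed, ContinuousLinearMap.comp_apply, ContinuousLinearMap.adjoint_inner_right,
    inner_hR_rankOne]
  rw [← inner_assocL, assocL_hR_hR, inner_hR_rankOne]

/-- The blocks of `L (P i† (|φ⟩⟨φ'| ⊗ 1) P i)` in terms of the slices of the blocks of `V`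
and `K`. -/
theorem inner_generator_block (V : H →L[ℂ] H ⊗ₕ E) (K : H →L[ℂ] H) (i j k : I) (φ φ' : A i)
    (ψ : A j) (ψ' : A k) (b : B j) (b' : B k) :
    inner ℂ (((proj P j)†) (htmul ψ b))
        (generator V K (embed P i (InnerProductSpace.rankOne ℂ φ φ'))
          (((proj P k)†) (htmul ψ' b'))) =
      inner ℂ (slice φ ψ (blockV P V i j) b) (slice φ' ψ' (blockV P V i k) b') -
      inner ℂ (slice φ ψ (blockK P K i j) b)
        (bra φ' _ (proj P i (((proj P k)†) (htmul ψ' b')))) -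
      inner ℂ (bra φ _ (proj P i (((proj P j)†) (htmul ψ b))))
        (slice φ' ψ' (blockK P K i k) b') := by
  rw [inner_generator_embed]
  rfl

variable [CompleteSpace H₀]

/-- Each K-term contains the i-th coordinate of one of the two vectors, so K drops out when both lie
outside the i-th summand. In `inner_generator_block_row` exactly one K-term survives. -/
theorem inner_generator_block_of_ne (V : H →L[ℂ] H ⊗ₕ E) (K : H →L[ℂ] H) {i j k : I}
    (hj : i ≠ j) (hk : i ≠ k) (φ φ' : A i) (ψ : A j) (ψ' : A k) (b : B j) (b' : B k) :
    inner ℂ (((proj P j)†) (htmul ψ b))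
        (generator V K (embed P i (InnerProductSpace.rankOne ℂ φ φ'))
          (((proj P k)†) (htmul ψ' b'))) =
      inner ℂ (slice φ ψ (blockV P V i j) b) (slice φ' ψ' (blockV P V i k) b') := by
  have hP := isDecomposition_proj P
  rw [inner_generator_block, hP.apply_adjoint_of_ne i k hk, hP.apply_adjoint_of_ne i j hj]
  simp

theorem inner_generator_block_row (V : H →L[ℂ] H ⊗ₕ E) (K : H →L[ℂ] H) {i k : I}
    (hk : i ≠ k) (φ φ' : A i) (ψ : A i) (ψ' : A k) (b : B i) (b' : B k) :
    inner ℂ (((proj P i)†) (htmul ψ b))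
        (generator V K (embed P i (InnerProductSpace.rankOne ℂ φ φ'))
          (((proj P k)†) (htmul ψ' b'))) =
      inner ℂ (slice φ ψ (blockV P V i i) b) (slice φ' ψ' (blockV P V i k) b') -
      inner ℂ ψ φ * inner ℂ b (slice φ' ψ' (blockK P K i k) b') := by
  have hP := isDecomposition_proj P
  rw [inner_generator_block, hP.apply_adjoint_of_ne i k hk, hP.apply_adjoint_self, bra_htmul,
    inner_smul_left, inner_conj_symm]
  simp

theorem inner_generator_block_self (V : H →L[ℂ] H ⊗ₕ E) (K : H →L[ℂ] H) (i : I)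
    (φ φ' : A i) (ψ ψ' : A i) (b b' : B i) :
    inner ℂ (((proj P i)†) (htmul ψ b))
        (generator V K (embed P i (InnerProductSpace.rankOne ℂ φ φ'))
          (((proj P i)†) (htmul ψ' b'))) =
      inner ℂ (slice φ ψ (blockV P V i i) b) (slice φ' ψ' (blockV P V i i) b') -
      inner ℂ φ' ψ' * inner ℂ (slice φ ψ (blockK P K i i) b) b' -
      inner ℂ ψ φ * inner ℂ b (slice φ' ψ' (blockK P K i i) b') := by
  have hP := isDecomposition_proj P
  rw [inner_generator_block, hP.apply_adjoint_self, hP.apply_adjoint_self, bra_htmul, bra_htmul,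
    inner_smul_left, inner_conj_symm, inner_smul_right]

/-- `V` maps `H₀` into `H₀ ⊗ E`. -/
theorem hR_proj_apply_adjoint_zero (h𝒜 : IsAtomicWith 𝒜 P) {V : H →L[ℂ] H ⊗ₕ E} {K : H →L[ℂ] H}
    (hgen : ∀ X ∈ 𝒜, generator V K X ∈ 𝒜) (i : I) (y : H₀) :
    hR (proj P i) E (V (((proj₀ P)†) y)) = 0 := by
  have hP := isDecomposition_proj P
  refine (hassoc (A i) (B i) E).injective (bra_ext fun φ => ?_)
  -- L(X) kills H₀ and the K-terms contain the vanishing i-th coordinate, so the diagonal choice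
  -- leaves a squared norm equal to 0.
  have h1 := inner_generator_embed (P := P) V K i φ φ (((proj₀ P)†) y) (((proj₀ P)†) y)
  rw [apply_adjoint_zero_of_mem h𝒜 (hgen _ (embed_mem h𝒜 i _)), hP.apply_adjoint_zero] at h1
  simp only [map_zero, inner_zero_right, inner_zero_left, sub_zero] at h1
  rw [map_zero, map_zero]
  exact inner_self_eq_zero.1 h1.symm

/-- `K` leaves `H₀` invariant. -/
theorem proj_apply_adjoint_zero (h𝒜 : IsAtomicWith 𝒜 P) {V : H →L[ℂ] H ⊗ₕ E} {K : H →L[ℂ] H}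
    (hgen : ∀ X ∈ 𝒜, generator V K X ∈ 𝒜) (i : I) [Nontrivial (A i)] (y : H₀) :
    proj P i (K (((proj₀ P)†) y)) = 0 := by
  have hP := isDecomposition_proj P
  obtain ⟨α, hα⟩ := exists_norm_eq (A i) zero_le_one
  refine bra_ext fun φ => ext_inner_left ℂ fun b => ?_
  -- The V-term is already known to vanish; testing against α ⊗ b isolates ⟨b, slice of K⟩ in the
  -- last term.
  have h1 := inner_generator_embed (P := P) V K i α φ (((proj P i)†) (htmul α b))
    (((proj₀ P)†) y)
  rw [apply_adjoint_zero_of_mem h𝒜 (hgen _ (embed_mem h𝒜 i _)), hP.apply_adjoint_zero,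
    hR_proj_apply_adjoint_zero h𝒜 hgen, hP.apply_adjoint_self, bra_htmul,
    inner_self_eq_norm_sq_to_K, hα] at h1
  simpa using h1.symm

/-! ### Relations between slices forced by invariance of the algebra. -/

section Relations

variable {V : H →L[ℂ] H ⊗ₕ E} {K : H →L[ℂ] H}

theorem inner_slice_blockV_of_ne (h𝒜 : IsAtomicWith 𝒜 P)
    (hgen : ∀ X ∈ 𝒜, generator V K X ∈ 𝒜) {i j k : I} (hj : i ≠ j) (hk : i ≠ k) (hjk : j ≠ k)
    (φ φ' : A i) (ψ : A j) (ψ' : A k) (b : B j) (b' : B k) :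
    inner ℂ (slice φ ψ (blockV P V i j) b) (slice φ' ψ' (blockV P V i k) b') = (0 : ℂ) := by
  rw [← inner_generator_block_of_ne V K hj hk]
  exact inner_block_of_mem_of_ne h𝒜 (hgen _ (embed_mem h𝒜 i _)) hjk _ _

theorem inner_slice_blockV_row (h𝒜 : IsAtomicWith 𝒜 P)
    (hgen : ∀ X ∈ 𝒜, generator V K X ∈ 𝒜) {i k : I} (hk : i ≠ k)
    (φ φ' : A i) (ψ : A i) (ψ' : A k) (b : B i) (b' : B k) :
    inner ℂ (slice φ ψ (blockV P V i i) b) (slice φ' ψ' (blockV P V i k) b') =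
      inner ℂ ψ φ * inner ℂ b (slice φ' ψ' (blockK P K i k) b') := by
  rw [← sub_eq_zero, ← inner_generator_block_row V K hk]
  exact inner_block_of_mem_of_ne h𝒜 (hgen _ (embed_mem h𝒜 i _)) hk _ _

theorem exists_inner_slice_blockV_of_ne (h𝒜 : IsAtomicWith 𝒜 P)
    (hgen : ∀ X ∈ 𝒜, generator V K X ∈ 𝒜) {i j : I} (hj : i ≠ j)
    (φ φ' : A i) (ψ ψ' : A j) : ∃ c : ℂ, ∀ b b',
    inner ℂ (slice φ ψ (blockV P V i j) b) (slice φ' ψ' (blockV P V i j) b') =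
      c * inner ℂ b b' := by
  obtain ⟨c, hc⟩ := inner_block_of_mem h𝒜 (hgen _ (embed_mem h𝒜 i
    (InnerProductSpace.rankOne ℂ φ φ'))) j ψ ψ'
  exact ⟨c, fun b b' => by rw [← hc, inner_generator_block_of_ne V K hj hj]⟩

theorem exists_inner_slice_blockV_self (h𝒜 : IsAtomicWith 𝒜 P)
    (hgen : ∀ X ∈ 𝒜, generator V K X ∈ 𝒜) (i : I) (φ φ' ψ ψ' : A i) : ∃ c : ℂ, ∀ b b',
    inner ℂ (slice φ ψ (blockV P V i i) b) (slice φ' ψ' (blockV P V i i) b') -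
      inner ℂ φ' ψ' * inner ℂ (slice φ ψ (blockK P K i i) b) b' -
      inner ℂ ψ φ * inner ℂ b (slice φ' ψ' (blockK P K i i) b') =
      c * inner ℂ b b' := by
  obtain ⟨c, hc⟩ := inner_block_of_mem h𝒜 (hgen _ (embed_mem h𝒜 i
    (InnerProductSpace.rankOne ℂ φ φ'))) i ψ ψ'
  exact ⟨c, fun b b' => by rw [← hc, inner_generator_block_self V K]⟩

end Relations

end Blocks

/-! ### Totality -/

section Total

variable {A A' B B' F F' G : Type*}
  [NormedAddCommGroup A] [InnerProductSpace ℂ A]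
  [NormedAddCommGroup A'] [InnerProductSpace ℂ A']
  [NormedAddCommGroup B] [InnerProductSpace ℂ B]
  [NormedAddCommGroup B'] [InnerProductSpace ℂ B']
  [NormedAddCommGroup F] [InnerProductSpace ℂ F]
  [NormedAddCommGroup F'] [InnerProductSpace ℂ F']
  [NormedAddCommGroup G] [InnerProductSpace ℂ G]

theorem isTotal_of_inner_eq_zero [CompleteSpace F] {S : Set F}
    (h : ∀ η, (∀ s ∈ S, inner ℂ s η = (0 : ℂ)) → η = 0) : IsTotal S := by
  rw [IsTotal, Submodule.dense_iff_topologicalClosure_eq_top,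
    Submodule.topologicalClosure_eq_top_iff, Submodule.eq_bot_iff]
  exact fun η hη => h η fun s hs => hη s (Submodule.subset_span hs)

theorem IsTotal.eq_of_inner {S : Set F} (hS : IsTotal S) {x y : F}
    (h : ∀ s ∈ S, inner ℂ s x = inner ℂ s y) : x = y :=
  inner_ext_of_dense hS h

theorem IsTotal.hext {S : Set F} (hS : IsTotal S) {M : Type*} [NormedAddCommGroup M]
    [NormedSpace ℂ M] {f g : F ⊗ₕ B →L[ℂ] M}
    (h : ∀ s ∈ S, ∀ b, f (htmul s b) = g (htmul s b)) : f = g := by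
  refine GKLS.hext fun x b => ?_
  have : f ∘L ketR F b = g ∘L ketR F b := ContinuousLinearMap.ext_on hS fun s hs => h s hs b
  exact congrArg (· x) this

theorem IsTotal.adjoint_comp_eq_zero [CompleteSpace G] {S : Set F} (hS : IsTotal S) {S' : Set F'}
    (hS' : IsTotal S') (f : F ⊗ₕ B →L[ℂ] G) (f' : F' ⊗ₕ B' →L[ℂ] G)
    (h : ∀ s ∈ S, ∀ s' ∈ S', ∀ b b', inner ℂ (f (htmul s b)) (f' (htmul s' b')) = (0 : ℂ)) :
    f† ∘L f' = 0 := by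
  refine hS'.hext fun s' hs' b' => ?_
  have : innerSL ℂ (f' (htmul s' b')) ∘L f = 0 := hS.hext fun s hs b => by
    have := congrArg (starRingEnd ℂ) (h s hs s' hs' b b')
    rw [inner_conj_symm, map_zero] at this
    simpa using this
  refine ext_inner_right ℂ fun x => ?_
  rw [ContinuousLinearMap.comp_apply, ContinuousLinearMap.adjoint_inner_left]
  have h2 := DFunLike.congr_fun this x
  simpa using h2

variable [CompleteSpace F]

theorem hR_rankOne (φ φ' : A) (x : A ⊗ₕ F) :
    hR (InnerProductSpace.rankOne ℂ φ φ') F x = htmul φ (bra φ' F x) :=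
  hinner_ext fun a f => by
    rw [inner_hR_rankOne, bra_htmul, inner_smul_left, inner_conj_symm, inner_htmul]

/-- The choice X = |χ⟩⟨φ| produces χ ⊗ (slice of a at (φ,ψ)), and such vectors are total. -/
theorem isTotal_stinespring {a : A' →L[ℂ] A ⊗ₕ F}
    (ha : IsTotal (Set.range fun p : A × A' => bra p.1 F (a p.2))) :
    IsTotal {x : A ⊗ₕ F | ∃ (X : A →L[ℂ] A) (ψ : A'), x = (hR X F ∘L a) ψ} := by
  refine isTotal_of_inner_eq_zero fun η hη => bra_ext fun χ => ha.eq_of_inner ?_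
  rintro _ ⟨p, rfl⟩
  rw [map_zero, inner_zero_right, inner_bra_right]
  have := hη _ ⟨InnerProductSpace.rankOne ℂ χ p.1, p.2, rfl⟩
  rwa [ContinuousLinearMap.comp_apply, hR_rankOne] at this

/-- For X = |χ⟩⟨φ| the vector is χ ⊗ (slice at (φ,ψ)) − ⟨φ,ψ⟩ aχ. Since the slice at (α,α) vanishes,
φ = ψ = α shows η ⊥ aχ, which removes the second term for all φ, ψ. -/
theorem isTotal_gkls {a : A →L[ℂ] A ⊗ₕ F}
    (ha : IsTotal (Set.range fun p : A × A => bra p.1 F (a p.2))) (α : A) (hα : ‖α‖ = 1)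
    (h0 : bra α F (a α) = 0) :
    IsTotal {x : A ⊗ₕ F | ∃ (X : A →L[ℂ] A) (ψ : A), x = (hR X F ∘L a - a ∘L X) ψ} := by
  refine isTotal_of_inner_eq_zero fun η hη => bra_ext fun χ => ha.eq_of_inner ?_
  rintro _ ⟨p, rfl⟩
  rw [map_zero, inner_zero_right, inner_bra_right]
  have h1 : ∀ φ ψ, inner ℂ (htmul χ (bra φ F (a ψ))) η =
      (starRingEnd ℂ (inner ℂ φ ψ) : ℂ) * inner ℂ (a χ) η := fun φ ψ => by
    have := hη _ ⟨InnerProductSpace.rankOne ℂ χ φ, ψ, rfl⟩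
    rwa [sub_apply, ContinuousLinearMap.comp_apply, hR_rankOne, ContinuousLinearMap.comp_apply,
      InnerProductSpace.rankOne_apply, map_smul, inner_sub_left, inner_smul_left,
      sub_eq_zero] at this
  have h2 := h1 α α
  rw [h0, htmul_zero_right, inner_zero_left, inner_self_eq_norm_sq_to_K, hα] at h2
  have h3 : inner ℂ (a χ) η = (0 : ℂ) := by simpa using h2.symm
  have h4 := h1 p.1 p.2
  rwa [h3, mul_zero] at h4

/-- Stinespring minimality means that the slices are total. -/
theorem isTotal_slices_of_stinespring [Nontrivial A] [CompleteSpace A] {a : A' →L[ℂ] A ⊗ₕ F}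
    (ha : IsTotal {x : A ⊗ₕ F | ∃ (X : A →L[ℂ] A) (ψ : A'), x = (hR X F ∘L a) ψ}) :
    IsTotal (Set.range fun p : A × A' => bra p.1 F (a p.2)) := by
  obtain ⟨α, hα⟩ := exists_norm_eq A zero_le_one
  refine isTotal_of_inner_eq_zero fun η hη => ?_
  have h1 : htmul α η = 0 := by
    refine ha.eq_of_inner ?_
    rintro _ ⟨X, ψ, rfl⟩
    rw [inner_zero_right, ContinuousLinearMap.comp_apply, ← inner_bra_left, bra_hR]
    exact hη _ ⟨(_, ψ), rfl⟩
  rw [← norm_eq_zero, norm_htmul, hα, one_mul, norm_eq_zero] at h1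
  exact h1

/-- GKLS minimality means that the centred slices are total. -/
theorem isTotal_slices_of_gkls [CompleteSpace A] {a : A →L[ℂ] A ⊗ₕ F} (α : A) (hα : ‖α‖ = 1)
    (ha : IsTotal {x : A ⊗ₕ F | ∃ (X : A →L[ℂ] A) (ψ : A), x = (hR X F ∘L a - a ∘L X) ψ}) :
    IsTotal (Set.range fun p : A × A =>
      bra p.1 F (a p.2) - (inner ℂ p.1 p.2 : ℂ) • bra α F (a α)) := by
  refine isTotal_of_inner_eq_zero fun η hη => ?_
  have h1 : htmul α η = 0 := by
    refine ha.eq_of_inner ?_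
    rintro _ ⟨X, ψ, rfl⟩
    rw [inner_zero_right, sub_apply, ContinuousLinearMap.comp_apply,
      ContinuousLinearMap.comp_apply, ← inner_bra_left, map_sub, bra_hR]
    -- Pairing with α ⊗ η gives the slices at (X†α, ψ) and (α, Xψ). Both are centred by the same
    -- number ⟨α, Xψ⟩, so the corrections cancel in the difference.
    have h2 := hη _ ⟨((X†) α, ψ), rfl⟩
    have h3 := hη _ ⟨(α, X ψ), rfl⟩
    simp only [inner_sub_left, ContinuousLinearMap.adjoint_inner_left] at h2 h3 ⊢
    linear_combination h2 - h3
  rw [← norm_eq_zero, norm_htmul, hα, one_mul, norm_eq_zero] at h1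
  exact h1

end Total

/-! ### Norms and adjoints -/

section Misc

variable {A A' B B' C : Type*}
  [NormedAddCommGroup A] [InnerProductSpace ℂ A]
  [NormedAddCommGroup A'] [InnerProductSpace ℂ A']
  [NormedAddCommGroup B] [InnerProductSpace ℂ B]
  [NormedAddCommGroup B'] [InnerProductSpace ℂ B']
  [NormedAddCommGroup C] [InnerProductSpace ℂ C]

theorem norm_hmap_le (f : A →L[ℂ] A') (g : B →L[ℂ] B') : ‖hmap f g‖ ≤ ‖f‖ * ‖g‖ := by
  refine ContinuousLinearMap.opNorm_le_bound _ (by positivity) fun x => ?_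
  refine (denseRange_hincl (A := A) (B := B)).induction_on
    (p := fun x => ‖hmap f g x‖ ≤ ‖f‖ * ‖g‖ * ‖x‖) x
    (isClosed_le (by fun_prop) (by fun_prop)) fun x => ?_
  rw [hmap_hincl, LinearIsometry.norm_map, LinearIsometry.norm_map]
  exact ContinuousLinearMap.le_of_opNorm_le _ (TensorProduct.norm_mapL_le f g) x

theorem norm_hL_le (g : B →L[ℂ] B') : ‖hL A g‖ ≤ ‖g‖ :=
  (norm_hmap_le _ _).trans <|
    (mul_le_mul_of_nonneg_right ContinuousLinearMap.norm_id_le (norm_nonneg _)).trans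
      (one_mul _).le

theorem norm_ampR_le (Y : B →L[ℂ] B' ⊗ₕ C) : ‖ampR A Y‖ ≤ ‖Y‖ := by
  refine ContinuousLinearMap.opNorm_le_bound _ (by positivity) fun x => ?_
  rw [ampR, ContinuousLinearMap.comp_apply, norm_assocR]
  exact ContinuousLinearMap.le_of_opNorm_le _ (norm_hL_le Y) x

theorem ampR_adjoint [CompleteSpace A] [CompleteSpace B] (Y : B →L[ℂ] B' ⊗ₕ C) :
    (ampR A Y)† = hL A (Y†) ∘L assocL A B' C := by
  refine ContinuousLinearMap.ext fun x => ext_inner_left ℂ fun z => ?_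
  rw [ContinuousLinearMap.adjoint_inner_right, ContinuousLinearMap.comp_apply, ← hL_adjoint,
    ContinuousLinearMap.adjoint_inner_right, ← inner_assocL, ampR,
    ContinuousLinearMap.comp_apply, assocL_assocR]

/-- If every slice is a scalar, that scalar is ⟨φ⊗β, T(ψ⊗β)⟩, a matrix element of the compression of
T to A ⊗ β. -/
theorem eq_hR_of_slices [CompleteSpace A] [CompleteSpace B] (T : A ⊗ₕ B →L[ℂ] A ⊗ₕ B) (β : B)
    (hβ : ‖β‖ = 1)
    (hT : ∀ φ ψ, ∃ c : ℂ, ∀ b b', inner ℂ b (slice φ ψ T b') = c * inner ℂ b b') :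
    T = hR ((ketR A β)† ∘L T ∘L ketR A β) B := by
  refine slice_ext fun φ ψ b => ext_inner_left ℂ fun b' => ?_
  obtain ⟨c, hc⟩ := hT φ ψ
  have h1 := hc β β
  rw [inner_self_eq_norm_sq_to_K, hβ, slice_apply, inner_bra_right] at h1
  rw [hc, slice_hR, inner_smul_right]
  congr 1
  rw [ContinuousLinearMap.comp_apply, ContinuousLinearMap.adjoint_inner_right]
  have h2 : c = inner ℂ (htmul φ β) (T (htmul ψ β)) := by simpa using h1.symm
  exact h2

end Misc

/-! ### Coordinates of strongly convergent block diagonal sums. -/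

namespace IsDecomposition

variable {I M G₀ : Type*} {G : I → Type*}
  [NormedAddCommGroup M] [InnerProductSpace ℂ M] [CompleteSpace M]
  [NormedAddCommGroup G₀] [InnerProductSpace ℂ G₀] [CompleteSpace G₀]
  [∀ i, NormedAddCommGroup (G i)] [∀ i, InnerProductSpace ℂ (G i)] [∀ i, CompleteSpace (G i)]
  {p₀ : M →L[ℂ] G₀} {p : ∀ i, M →L[ℂ] G i}

theorem norm_apply_le (h : IsDecomposition p₀ p) (i : I) (x : M) : ‖p i x‖ ≤ ‖x‖ := by
  have := h.sum_norm_sq_le x {i}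
  rw [Finset.sum_singleton] at this
  exact (sq_le_sq₀ (norm_nonneg _) (norm_nonneg _)).1 this

theorem hom_ext (h : IsDecomposition p₀ p) {X : Type*} [NormedAddCommGroup X] [NormedSpace ℂ X]
    {f g : M →L[ℂ] X} (h₀ : ∀ y, f ((p₀†) y) = g ((p₀†) y))
    (hi : ∀ i y, f (((p i)†) y) = g (((p i)†) y)) : f = g := by
  ext x
  have h1 := f.hasSum (h.hasSum x)
  have h2 := g.hasSum (h.hasSum x)
  simp only [hi] at h1
  have h3 := h1.unique h2
  rwa [map_sub, map_sub, h₀, sub_left_inj] at h3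

variable {N D₀ : Type*} {D : I → Type*} [NormedAddCommGroup N] [InnerProductSpace ℂ N] [CompleteSpace N]
  [NormedAddCommGroup D₀] [InnerProductSpace ℂ D₀] [CompleteSpace D₀]
  [∀ i, NormedAddCommGroup (D i)] [∀ i, InnerProductSpace ℂ (D i)] [∀ i, CompleteSpace (D i)]
  {q₀ : N →L[ℂ] D₀} {q : ∀ i, N →L[ℂ] D i}

theorem apply_sotHasSum {M : Type*} {G : I → Type*} [NormedAddCommGroup M]
    [InnerProductSpace ℂ M] [∀ i, NormedAddCommGroup (G i)] [∀ i, InnerProductSpace ℂ (G i)]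
    {p : ∀ i, M →L[ℂ] G i} (k : IsDecomposition q₀ q) {t : ∀ i, G i →L[ℂ] D i} {T : M →L[ℂ] N}
    (hT : SOTHasSum (fun i => (q i)† ∘L t i ∘L p i) T) (i : I) (x : M) :
    q i (T x) = t i (p i x) := by
  have h1 := (q i).hasSum (hT x)
  have h2 : HasSum (fun j => q i (((q j)† ∘L t j ∘L p j) x)) (q i (((q i)† ∘L t i ∘L p i) x)) :=
    hasSum_single i fun j hj => k.apply_adjoint_of_ne i j hj.symm _
  rw [h1.unique h2]
  exact k.apply_adjoint_self i _

theorem zero_apply_sotHasSum {M : Type*} {G : I → Type*} [NormedAddCommGroup M]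
    [InnerProductSpace ℂ M] [∀ i, NormedAddCommGroup (G i)] [∀ i, InnerProductSpace ℂ (G i)]
    {p : ∀ i, M →L[ℂ] G i} (k : IsDecomposition q₀ q) {t : ∀ i, G i →L[ℂ] D i} {T : M →L[ℂ] N}
    (hT : SOTHasSum (fun i => (q i)† ∘L t i ∘L p i) T) (x : M) : q₀ (T x) = 0 := by
  have h1 := q₀.hasSum (hT x)
  exact h1.unique (by
    have : (fun i => q₀ (((q i)† ∘L t i ∘L p i) x)) = fun _ => 0 :=
      funext fun i => k.zero_apply_adjoint i _
    rw [this]; exact hasSum_zero)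

end IsDecomposition

/-! ### Existence of minimal normal forms -/

section Existence

variable {I : Type v} {H H₀ E : Type u} {A B : I → Type u}
  [NormedAddCommGroup H] [InnerProductSpace ℂ H] [CompleteSpace H]
  [NormedAddCommGroup H₀] [InnerProductSpace ℂ H₀] [CompleteSpace H₀]
  [NormedAddCommGroup E] [InnerProductSpace ℂ E] [CompleteSpace E]
  [∀ i, NormedAddCommGroup (A i)] [∀ i, InnerProductSpace ℂ (A i)]
  [∀ i, NormedAddCommGroup (B i)] [∀ i, InnerProductSpace ℂ (B i)]
  {P : BlockSpace H₀ A B ≃ₗᵢ[ℂ] H}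

/-- The map b ↦ α ⊗ b embeds B_i isometrically into H. Separability of B_i ⊗ E is what makes the
spaces F_ij separable. -/
theorem separableSpace_right [TopologicalSpace.SeparableSpace H]
    (P : BlockSpace H₀ A B ≃ₗᵢ[ℂ] H) (i : I) [Nontrivial (A i)] :
    TopologicalSpace.SeparableSpace (B i) := by
  obtain ⟨α, hα⟩ := exists_norm_eq (A i) zero_le_one
  have : ∀ b : B i, ‖((proj P i)† ∘L ketL α (B i)) b‖ = ‖b‖ := fun b => by
    rw [ContinuousLinearMap.comp_apply, (isDecomposition_proj P).norm_adjoint, ketL_apply,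
      norm_htmul, hα, one_mul]
  exact separableSpace_of_isometry (AddMonoidHomClass.isometry_of_norm _ this)

theorem norm_blockK_le (K : H →L[ℂ] H) (i j : I) : ‖blockK P K i j‖ ≤ ‖K‖ := by
  have hP := isDecomposition_proj P
  refine ContinuousLinearMap.opNorm_le_bound _ (norm_nonneg _) fun x => ?_
  refine (hP.norm_apply_le i _).trans ?_
  rw [← hP.norm_adjoint j x]
  exact K.le_opNorm _

theorem norm_blockV_le (V : H →L[ℂ] H ⊗ₕ E) (i j : I) : ‖blockV P V i j‖ ≤ ‖V‖ := by
  have hP := isDecomposition_proj P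
  refine ContinuousLinearMap.opNorm_le_bound _ (norm_nonneg _) fun x => ?_
  rw [blockV, ContinuousLinearMap.comp_apply, norm_assocL]
  refine (hP.hR.norm_apply_le i _).trans ?_
  rw [← hP.norm_adjoint j x]
  exact V.le_opNorm _

/-- `V` is the sum of its part with values in `H₀ ⊗ E`, of `T = ∑ i, (P i† ⊗ 1)(1 ⊗ b i)(P i)`,
and of `S`. -/
structure IsReduced (P : BlockSpace H₀ A B ≃ₗᵢ[ℂ] H) (V T S : H →L[ℂ] H ⊗ₕ E)
    (b : ∀ i, B i →L[ℂ] B i ⊗ₕ E) : Prop where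
  hasSum : SOTHasSum (fun i => (hR (proj P i) E)† ∘L ampR (A i) (b i) ∘L proj P i) T
  eq : V = hR ((proj₀ P)†) E ∘L hR (proj₀ P) E ∘L V + S + T

namespace IsReduced

variable {V T S : H →L[ℂ] H ⊗ₕ E} {b : ∀ i, B i →L[ℂ] B i ⊗ₕ E}

theorem apply_T (h : IsReduced P V T S b) (i : I) (x : H) :
    hR (proj P i) E (T x) = ampR (A i) (b i) (proj P i x) :=
  (isDecomposition_proj P).hR.apply_sotHasSum h.hasSum i x

theorem zero_apply_T (h : IsReduced P V T S b) (x : H) : hR (proj₀ P) E (T x) = 0 :=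
  (isDecomposition_proj P).hR.zero_apply_sotHasSum h.hasSum x

theorem zero_apply_S (h : IsReduced P V T S b) (x : H) : hR (proj₀ P) E (S x) = 0 := by
  have hQ := (isDecomposition_proj P).hR (E := E)
  have h1 := congrArg (hR (proj₀ P) E) (DFunLike.congr_fun h.eq x)
  rw [← hR_adjoint] at h1
  simp only [add_apply, ContinuousLinearMap.comp_apply, map_add, h.zero_apply_T,
    hQ.zero_apply_adjoint_zero] at h1
  simpa using h1

theorem apply_S (h : IsReduced P V T S b) (i : I) (x : H) :
    hR (proj P i) E (V x) = hR (proj P i) E (S x) + ampR (A i) (b i) (proj P i x) := by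
  have hQ := (isDecomposition_proj P).hR (E := E)
  have h1 := congrArg (hR (proj P i) E) (DFunLike.congr_fun h.eq x)
  rw [← hR_adjoint] at h1
  simp only [add_apply, ContinuousLinearMap.comp_apply, map_add, h.apply_T] at h1
  rw [h1, hQ.apply_adjoint_zero, zero_add]

theorem slice_of_ne (h : IsReduced P V T S b) {i j : I} (hij : i ≠ j) (φ : A i) (ψ : A j)
    (c : B j) : slice φ ψ (blockV P V i j) c = slice φ ψ (blockV P S i j) c := by
  have hP := isDecomposition_proj P
  simp only [slice_apply, blockV, ContinuousLinearMap.comp_apply, h.apply_S,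
    hP.apply_adjoint_of_ne i j hij, map_zero, add_zero]

theorem slice_self (h : IsReduced P V T S b) (i : I) (φ ψ : A i) (c : B i) :
    slice φ ψ (blockV P V i i) c =
      slice φ ψ (blockV P S i i) c + (inner ℂ φ ψ : ℂ) • b i c := by
  have hP := isDecomposition_proj P
  rw [← slice_ampR]
  simp only [slice_apply, blockV, ContinuousLinearMap.comp_apply, h.apply_S,
    hP.apply_adjoint_self, map_add]

theorem adjoint_T_comp (h : IsReduced P V T S b) (i : I) :
    T† ∘L (hR (proj P i) E)† = (proj P i)† ∘L (ampR (A i) (b i))† := by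
  rw [← ContinuousLinearMap.adjoint_comp, ← ContinuousLinearMap.adjoint_comp]
  congr 1
  exact ContinuousLinearMap.ext (h.apply_T i)

theorem zero_adjoint_T (h : IsReduced P V T S b) (w : H ⊗ₕ E) :
    proj₀ P ((T†) w) = 0 := by
  have hP := isDecomposition_proj P
  have hQ := hP.hR (E := E)
  refine ext_inner_left ℂ fun y => ?_
  have h1 : T (((proj₀ P)†) y) = 0 := by
    refine hQ.eq_zero _ (h.zero_apply_T _) fun j => ?_
    rw [h.apply_T, hP.apply_adjoint_zero, map_zero]
  rw [← ContinuousLinearMap.adjoint_inner_left,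
    ContinuousLinearMap.adjoint_inner_right, h1, inner_zero_left, inner_zero_right]

theorem slice_base {α : ∀ i, A i} (h : IsReduced P V T S b) (hα : ∀ i, ‖α i‖ = 1)
    (hb : ∀ i, b i = slice (α i) (α i) (blockV P V i i)) (i : I) (c : B i) :
    slice (α i) (α i) (blockV P S i i) c = 0 := by
  have h1 := h.slice_self i (α i) (α i) c
  rw [← hb, inner_self_eq_norm_sq_to_K, hα] at h1
  simpa using h1

variable [∀ i, CompleteSpace (B i)] {𝒜 : NonUnitalStarSubalgebra ℂ (H →L[ℂ] H)} {K : H →L[ℂ] H}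
  {α : ∀ i, A i}

theorem apply_adjoint_zero (h : IsReduced P V T S b) (h𝒜 : IsAtomicWith 𝒜 P)
    (hgen : ∀ X ∈ 𝒜, generator V K X ∈ 𝒜) (y : H₀) : S (((proj₀ P)†) y) = 0 := by
  have hP := isDecomposition_proj P
  refine hP.hR.eq_zero _ (h.zero_apply_S _) fun i => ?_
  have h1 := h.apply_S i (((proj₀ P)†) y)
  rw [hR_proj_apply_adjoint_zero h𝒜 hgen, hP.apply_adjoint_zero, map_zero, add_zero] at h1
  exact h1.symm

/-- On the diagonal, the relations at (φ,ψ;φ',ψ') and with either or both pairs replaced by (α,α)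
are combined by inclusion–exclusion. All K-terms cancel, and the V-terms become inner products of
centred slices, which are the slices of S. -/
theorem exists_inner_slice (h : IsReduced P V T S b) (hα : ∀ i, ‖α i‖ = 1)
    (hb : ∀ i, b i = slice (α i) (α i) (blockV P V i i)) (h𝒜 : IsAtomicWith 𝒜 P)
    (hgen : ∀ X ∈ 𝒜, generator V K X ∈ 𝒜) (i j : I) (φ : A i) (ψ : A j) (φ' : A i) (ψ' : A j) :
    ∃ c : ℂ, ∀ x x', inner ℂ (slice φ ψ (blockV P S i j) x) (slice φ' ψ' (blockV P S i j) x') =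
      c * inner ℂ x x' := by
  by_cases hij : i = j
  · subst hij
    have hαα : inner ℂ (α i) (α i) = (1 : ℂ) := by
      rw [inner_self_eq_norm_sq_to_K, hα]; simp
    obtain ⟨c₁, h₁⟩ := exists_inner_slice_blockV_self h𝒜 hgen i φ φ' ψ ψ'
    obtain ⟨c₂, h₂⟩ := exists_inner_slice_blockV_self h𝒜 hgen i φ (α i) ψ (α i)
    obtain ⟨c₃, h₃⟩ := exists_inner_slice_blockV_self h𝒜 hgen i (α i) φ' (α i) ψ'
    obtain ⟨c₄, h₄⟩ := exists_inner_slice_blockV_self h𝒜 hgen i (α i) (α i) (α i) (α i)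
    refine ⟨c₁ - inner ℂ φ' ψ' * c₂ - inner ℂ ψ φ * c₃ + inner ℂ ψ φ * inner ℂ φ' ψ' * c₄,
      fun x x' => ?_⟩
    have e : ∀ φ ψ x, slice φ ψ (blockV P S i i) x =
        slice φ ψ (blockV P V i i) x -
          (inner ℂ φ ψ : ℂ) • slice (α i) (α i) (blockV P V i i) x := fun φ ψ x => by
      rw [h.slice_self i φ ψ, hb]; simp
    rw [e, e]
    simp only [inner_sub_left, inner_sub_right, inner_smul_left, inner_smul_right, inner_conj_symm]
    have h₁ := h₁ x x'
    have h₂ := h₂ x x'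
    have h₃ := h₃ x x'
    have h₄ := h₄ x x'
    rw [hαα] at h₂ h₃ h₄
    linear_combination h₁ - inner ℂ φ' ψ' * h₂ - inner ℂ ψ φ * h₃ +
      inner ℂ ψ φ * inner ℂ φ' ψ' * h₄
  · obtain ⟨c, hc⟩ := exists_inner_slice_blockV_of_ne h𝒜 hgen hij φ φ' ψ ψ'
    exact ⟨c, fun x x' => by rw [← hc, h.slice_of_ne hij, h.slice_of_ne hij]⟩

/-- The surviving K-term is ⟨ψ,φ⟩ times its value at φ = ψ = α; subtracting the relation at α
removes it and replaces the diagonal slice of V by that of S. -/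
theorem inner_slice_row (h : IsReduced P V T S b) (hα : ∀ i, ‖α i‖ = 1)
    (hb : ∀ i, b i = slice (α i) (α i) (blockV P V i i)) (h𝒜 : IsAtomicWith 𝒜 P)
    (hgen : ∀ X ∈ 𝒜, generator V K X ∈ 𝒜) {i l : I} (hil : i ≠ l)
    (φ ψ : A i) (φ' : A i) (ψ' : A l) (x : B i) (x' : B l) :
    inner ℂ (slice φ ψ (blockV P S i i) x) (slice φ' ψ' (blockV P S i l) x') = (0 : ℂ) := by
  have hαα : inner ℂ (α i) (α i) = (1 : ℂ) := by
    rw [inner_self_eq_norm_sq_to_K, hα]; simp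
  have h1 := inner_slice_blockV_row h𝒜 hgen hil φ φ' ψ ψ' x x'
  have h2 := inner_slice_blockV_row h𝒜 hgen hil (α i) φ' (α i) ψ' x x'
  rw [hαα, ← hb] at h2
  rw [h.slice_self, inner_add_left, inner_smul_left, h2, inner_conj_symm, h.slice_of_ne hil] at h1
  linear_combination h1

theorem inner_slice_of_ne (h : IsReduced P V T S b) (hα : ∀ i, ‖α i‖ = 1)
    (hb : ∀ i, b i = slice (α i) (α i) (blockV P V i i)) (h𝒜 : IsAtomicWith 𝒜 P)
    (hgen : ∀ X ∈ 𝒜, generator V K X ∈ 𝒜) {i j l : I} (hjl : j ≠ l)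
    (φ φ' : A i) (ψ : A j) (ψ' : A l) (x : B j) (x' : B l) :
    inner ℂ (slice φ ψ (blockV P S i j) x) (slice φ' ψ' (blockV P S i l) x') = (0 : ℂ) := by
  by_cases hj : i = j
  · subst hj
    exact h.inner_slice_row hα hb h𝒜 hgen hjl φ ψ φ' ψ' x x'
  · by_cases hl : i = l
    · subst hl
      rw [← inner_conj_symm, h.inner_slice_row hα hb h𝒜 hgen hj φ' ψ' φ ψ x' x, map_zero]
    · rw [← h.slice_of_ne hj, ← h.slice_of_ne hl]
      exact inner_slice_blockV_of_ne h𝒜 hgen hj hl hjl φ φ' ψ ψ' x x'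

variable [∀ i, CompleteSpace (A i)]

theorem proj_adjoint_T (h : IsReduced P V T S b) (i : I) (w : H ⊗ₕ E) :
    proj P i ((T†) w) = hL (A i) ((b i)†) (assocL (A i) (B i) E (hR (proj P i) E w)) := by
  have hP := isDecomposition_proj P
  have hQ := hP.hR (E := E)
  refine ext_inner_left ℂ fun y => ?_
  have h1 : T (((proj P i)†) y) = ((hR (proj P i) E)†) (ampR (A i) (b i) y) := by
    refine hQ.ext ?_ fun j => ?_
    · rw [h.zero_apply_T, hQ.zero_apply_adjoint]
    · rw [h.apply_T]
      by_cases hj : j = i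
      · subst hj
        rw [hP.apply_adjoint_self, hQ.apply_adjoint_self]
      · rw [hP.apply_adjoint_of_ne j i hj, hQ.apply_adjoint_of_ne j i hj, map_zero]
  have h2 := DFunLike.congr_fun (ampR_adjoint (A := A i) (b i)) (hR (proj P i) E w)
  rw [ContinuousLinearMap.comp_apply] at h2
  rw [← h2, ContinuousLinearMap.adjoint_inner_right, ← ContinuousLinearMap.adjoint_inner_left,
    ContinuousLinearMap.adjoint_inner_right, h1, ContinuousLinearMap.adjoint_inner_left]

/-- `K` without the terms of a normal form that involve `b`. -/
def remainder (K : H →L[ℂ] H) (T S : H →L[ℂ] H ⊗ₕ E) : H →L[ℂ] H :=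
  K - T† ∘L S - (1 / 2 : ℂ) • (T† ∘L T)

theorem slice_remainder_of_ne (h : IsReduced P V T S b) (K : H →L[ℂ] H) {i j : I} (hij : i ≠ j)
    (φ : A i) (ψ : A j) (c : B j) :
    slice φ ψ (blockK P (remainder K T S) i j) c =
      slice φ ψ (blockK P K i j) c - ((b i)†) (slice φ ψ (blockV P S i j) c) := by
  have hP := isDecomposition_proj P
  simp only [slice_apply, blockK, blockV, remainder, ContinuousLinearMap.comp_apply,
    sub_apply, smul_apply, map_sub, map_smul, h.proj_adjoint_T, h.apply_T,
    hP.apply_adjoint_of_ne i j hij, map_zero, smul_zero, sub_zero, bra_hL]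

theorem slice_remainder_self (h : IsReduced P V T S b) (K : H →L[ℂ] H) (i : I) (φ ψ : A i)
    (c : B i) :
    slice φ ψ (blockK P (remainder K T S) i i) c =
      slice φ ψ (blockK P K i i) c - ((b i)†) (slice φ ψ (blockV P S i i) c) -
        ((1 / 2 : ℂ) * inner ℂ φ ψ) • ((b i)†) (b i c) := by
  have hP := isDecomposition_proj P
  have h1 : ((b i)†) (bra φ _ (assocL (A i) (B i) E (ampR (A i) (b i) (htmul ψ c)))) =
      (inner ℂ φ ψ : ℂ) • ((b i)†) (b i c) := by
    rw [← map_smul, ← slice_ampR]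
    rfl
  simp only [slice_apply, blockK, blockV, remainder, ContinuousLinearMap.comp_apply,
    sub_apply, smul_apply, map_sub, map_smul, h.proj_adjoint_T, h.apply_T,
    hP.apply_adjoint_self, bra_hL, h1, smul_smul]

/-- The row relation at (α,α) says that the off-diagonal slices of K are b_i† applied to those of S.
-/
theorem blockK_remainder_of_ne (h : IsReduced P V T S b) (hα : ∀ i, ‖α i‖ = 1)
    (hb : ∀ i, b i = slice (α i) (α i) (blockV P V i i)) (h𝒜 : IsAtomicWith 𝒜 P)
    (hgen : ∀ X ∈ 𝒜, generator V K X ∈ 𝒜) {i j : I} (hij : i ≠ j) :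
    blockK P (remainder K T S) i j = 0 := by
  refine slice_ext fun φ ψ c => ext_inner_left ℂ fun x => ?_
  have hαα : inner ℂ (α i) (α i) = (1 : ℂ) := by
    rw [inner_self_eq_norm_sq_to_K, hα]; simp
  have h2 := inner_slice_blockV_row h𝒜 hgen hij (α i) φ (α i) ψ x c
  rw [hαα, ← hb, h.slice_of_ne hij, one_mul] at h2
  rw [h.slice_remainder_of_ne K hij, inner_sub_right, ContinuousLinearMap.adjoint_inner_right, h2,
    sub_self]
  simp [slice_apply]

/-- The diagonal blocks of the remainder are of the form `K_A ⊗ 1 + i (1 ⊗ H_B)`. -/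
theorem exists_blockK_remainder_self (h : IsReduced P V T S b) (hα : ∀ i, ‖α i‖ = 1)
    (hb : ∀ i, b i = slice (α i) (α i) (blockV P V i i)) (h𝒜 : IsAtomicWith 𝒜 P)
    (hgen : ∀ X ∈ 𝒜, generator V K X ∈ 𝒜) (i : I) [Nontrivial (B i)] :
    ∃ (KA : A i →L[ℂ] A i) (HB : B i →L[ℂ] B i), IsSelfAdjoint HB ∧
      ‖HB‖ ≤ ‖remainder K T S‖ ∧
      blockK P (remainder K T S) i i = hR KA (B i) + Complex.I • hL (A i) HB := by
  obtain ⟨β, hβ⟩ := exists_norm_eq (B i) zero_le_one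
  have hαα : inner ℂ (α i) (α i) = (1 : ℂ) := by
    rw [inner_self_eq_norm_sq_to_K, hα]; simp
  set k := blockK P (remainder K T S) i i with hk
  -- Expanding the slices of V as slices of S plus multiples of b_i, the terms subtracted in
  -- `remainder` absorb every occurrence of b_i; the part with S alone is scalar.
  have key : ∀ φ φ' ψ ψ', ∃ c : ℂ, ∀ x x', inner ℂ φ' ψ' * inner ℂ (slice φ ψ k x) x' +
      inner ℂ ψ φ * inner ℂ x (slice φ' ψ' k x') = c * inner ℂ x x' := by
    intro φ φ' ψ ψ'
    obtain ⟨c₁, h₁⟩ := exists_inner_slice_blockV_self h𝒜 hgen i φ φ' ψ ψ'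
    obtain ⟨c₂, h₂⟩ := h.exists_inner_slice hα hb h𝒜 hgen i i φ ψ φ' ψ'
    refine ⟨c₂ - c₁, fun x x' => ?_⟩
    have h₁ := h₁ x x'
    have h₂ := h₂ x x'
    rw [hk, h.slice_remainder_self, h.slice_remainder_self]
    rw [h.slice_self i φ ψ, h.slice_self i φ' ψ'] at h₁
    simp only [inner_sub_left, inner_sub_right, inner_add_left, inner_add_right, inner_smul_left,
      inner_smul_right, inner_conj_symm, ContinuousLinearMap.adjoint_inner_left,
      ContinuousLinearMap.adjoint_inner_right, map_mul, map_div₀, map_one, map_ofNat] at h₁ ⊢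
    linear_combination h₂ - h₁
  set h0 := slice (α i) (α i) k with hh0
  have hn0 : ‖h0‖ ≤ ‖remainder K T S‖ := by
    refine (norm_slice_le _ _ _).trans ?_
    rw [hα, one_mul, one_mul]
    exact norm_blockK_le _ _ _
  -- Thus i·HB is the skew-adjoint part of the slice h0 of k at (α,α).
  set HB := (-Complex.I / 2) • (h0 - h0†) with hHB
  have hsa : IsSelfAdjoint HB := by
    rw [ContinuousLinearMap.isSelfAdjoint_iff']
    rw [hHB, map_smulₛₗ, map_sub, ContinuousLinearMap.adjoint_adjoint, ← neg_sub, smul_neg,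
      ← neg_smul]
    congr 1
    simp only [map_div₀, map_neg, Complex.conj_I, map_ofNat]
    ring
  have hnHB : ‖HB‖ ≤ ‖remainder K T S‖ := by
    rw [hHB, norm_smul]
    have h1 : ‖h0 - h0†‖ ≤ ‖h0‖ + ‖h0‖ := by
      refine (norm_sub_le _ _).trans ?_
      rw [LinearIsometryEquiv.norm_map]
    have h2 : ‖-Complex.I / 2‖ = 1 / 2 := by simp
    rw [h2]
    linarith
  have hI : ∀ x x', inner ℂ x (Complex.I • HB x') =
      (1 / 2 : ℂ) * (inner ℂ x (h0 x') - inner ℂ (h0 x) x') := fun x x' => by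
    rw [hHB, smul_apply, smul_smul, inner_smul_right, sub_apply, inner_sub_right,
      ContinuousLinearMap.adjoint_inner_right]
    congr 1
    linear_combination (-1 / 2 : ℂ) * Complex.I_mul_I
  -- By `key` both k_φψ + ⟨φ,ψ⟩ h0† and h0 + h0† are scalars. Subtracting ½⟨φ,ψ⟩ times the second
  -- from the first leaves k_φψ − i⟨φ,ψ⟩ HB.
  have hscal := eq_hR_of_slices (k - Complex.I • hL (A i) HB) β hβ fun φ ψ => by
    obtain ⟨c₁, h₁⟩ := key (α i) φ (α i) ψ
    obtain ⟨c₂, h₂⟩ := key (α i) (α i) (α i) (α i)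
    rw [hαα] at h₁ h₂
    refine ⟨c₁ - 1 / 2 * inner ℂ φ ψ * c₂, fun x x' => ?_⟩
    have h₁ := h₁ x x'
    have h₂ := h₂ x x'
    rw [slice_sub, slice_smul, slice_hL, smul_comm, inner_sub_right, inner_smul_right, hI]
    rw [← hh0] at h₁ h₂
    linear_combination h₁ - 1 / 2 * inner ℂ φ ψ * h₂
  exact ⟨_, HB, hsa, hnHB, (sub_eq_iff_eq_add.1 hscal)⟩

end IsReduced

end Existence

section Orthogonal

variable {I : Type v} {H H₀ E : Type u} {A B : I → Type u}
  [NormedAddCommGroup H] [InnerProductSpace ℂ H]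
  [NormedAddCommGroup H₀] [InnerProductSpace ℂ H₀]
  [NormedAddCommGroup E] [InnerProductSpace ℂ E]
  [∀ i, NormedAddCommGroup (A i)] [∀ i, InnerProductSpace ℂ (A i)] [∀ i, CompleteSpace (A i)]
  [∀ i, NormedAddCommGroup (B i)] [∀ i, InnerProductSpace ℂ (B i)]

theorem inner_vsc_vsc_of_orthogonal (D : NormalFormData H H₀ E A B) {i j l : I}
    (h : (D.U i j)† ∘L D.U i l = 0) (y : A j ⊗ₕ B j) (z : A l ⊗ₕ B l) :
    inner ℂ (D.vsc i j y) (D.vsc i l z) = (0 : ℂ) := by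
  simp only [NormalFormData.vsc, semilocal, ampR, ContinuousLinearMap.comp_apply]
  refine ((hassoc (A i) (B i) E).symm.inner_map_map _ _).trans ?_
  rw [← ContinuousLinearMap.adjoint_inner_right, hL_adjoint, hmap_comp_apply, h]
  have h0 : hmap (ContinuousLinearMap.id ℂ (A i) ∘L ContinuousLinearMap.id ℂ (A i))
      (0 : D.F i l ⊗ₕ B l →L[ℂ] D.F i j ⊗ₕ B j) = 0 := hext fun a b => by simp [hmap_htmul]
  rw [h0]
  exact inner_zero_right _

end Orthogonal

/-! ### Assembly of a minimal normal form. -/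

section ExistenceTheorem

variable {I : Type v} [Countable I] {H H₀ E : Type u} {A B : I → Type u}
  [NormedAddCommGroup H] [InnerProductSpace ℂ H] [CompleteSpace H]
  [NormedAddCommGroup H₀] [InnerProductSpace ℂ H₀] [CompleteSpace H₀]
  [NormedAddCommGroup E] [InnerProductSpace ℂ E] [CompleteSpace E]
  [∀ i, NormedAddCommGroup (A i)] [∀ i, InnerProductSpace ℂ (A i)]
  [∀ i, NormedAddCommGroup (B i)] [∀ i, InnerProductSpace ℂ (B i)]
  {P : BlockSpace H₀ A B ≃ₗᵢ[ℂ] H}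

theorem exists_isReduced (V : H →L[ℂ] H ⊗ₕ E) (b : ∀ i, B i →L[ℂ] B i ⊗ₕ E) (C : ℝ)
    (hb : ∀ i, ‖b i‖ ≤ C) : ∃ T S : H →L[ℂ] H ⊗ₕ E, IsReduced P V T S b := by
  have hP := isDecomposition_proj P
  obtain ⟨T, hT⟩ := hP.exists_blockDiagonal (hP.hR (E := E)) (fun i => ampR (A i) (b i)) C
    fun i => (norm_ampR_le _).trans (hb i)
  exact ⟨T, V - T - hR ((proj₀ P)†) E ∘L hR (proj₀ P) E ∘L V, hT, by abel⟩

variable [∀ i, CompleteSpace (A i)] [∀ i, CompleteSpace (B i)]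

theorem exists_isNormalForm_isMinimal [TopologicalSpace.SeparableSpace H]
    [TopologicalSpace.SeparableSpace E] [∀ i, Nontrivial (A i)] [∀ i, Nontrivial (B i)]
    {𝒜 : NonUnitalStarSubalgebra ℂ (H →L[ℂ] H)} (h𝒜 : IsAtomicWith 𝒜 P)
    (V : H →L[ℂ] H ⊗ₕ E) (K : H →L[ℂ] H) (hgen : ∀ X ∈ 𝒜, generator V K X ∈ 𝒜) :
    ∃ D : NormalFormData H H₀ E A B, D.IsNormalForm P V K ∧ D.IsMinimal := by
  have hP := isDecomposition_proj P
  have hQ := hP.hR (E := E)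
  have hsepB := fun i => separableSpace_right P i
  choose α hα using fun i => exists_norm_eq (A i) zero_le_one
  obtain ⟨b, hb⟩ : ∃ b : ∀ i, B i →L[ℂ] B i ⊗ₕ E,
      ∀ i, b i = slice (α i) (α i) (blockV P V i i) := ⟨_, fun _ => rfl⟩
  have hbn : ∀ i, ‖b i‖ ≤ ‖V‖ := fun i => by
    rw [hb]
    refine (norm_slice_le _ _ _).trans ?_
    rw [hα, one_mul, one_mul]
    exact norm_blockV_le V i i
  obtain ⟨T, S, h⟩ := exists_isReduced (P := P) V b _ hbn
  have fac : ∀ i j, Factorization (blockV P S i j) := fun i j =>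
    (nonempty_factorization _ fun φ ψ φ' ψ' =>
      h.exists_inner_slice hα hb h𝒜 hgen i j φ ψ φ' ψ').some
  choose KA HB hsa hHBn hrem using fun i =>
    h.exists_blockK_remainder_self hα hb h𝒜 hgen i
  let D : NormalFormData H H₀ E A B :=
    { F := fun i j => (fac i j).F
      V₀ := hR (proj₀ P) E ∘L V
      K₀ := proj₀ P ∘L K
      U := fun i j => (fac i j).U
      a := fun i j => (fac i j).a
      b := b
      KA := KA
      HB := HB }
  have hvsc : ∀ i j, assocL (A i) (B i) E ∘L D.vsc i j = blockV P S i j := fun i j =>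
    slice_ext fun φ ψ c => by
      rw [NormalFormData.vsc, slice_semilocal]
      exact (fac i j).U_htmul φ ψ c
  have hvsc' : ∀ i j y, D.vsc i j y = hR (proj P i) E (S (((proj P j)†) y)) := fun i j y =>
    (hassoc (A i) (B i) E).injective (DFunLike.congr_fun (hvsc i j) y)
  have horth : ∀ i k l, k ≠ l → (D.U i k)† ∘L D.U i l = 0 := fun i k l hkl =>
    (fac i k).total.adjoint_comp_eq_zero (fac i l).total _ _ (by
      rintro _ ⟨p, rfl⟩ _ ⟨q, rfl⟩ c c'
      rw [(fac i k).U_htmul, (fac i l).U_htmul]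
      exact h.inner_slice_of_ne hα hb h𝒜 hgen hkl _ _ _ _ _ _)
  have hS : SOTHasSum (fun ij : I × I =>
      hR ((proj P ij.1)†) E ∘L D.vsc ij.1 ij.2 ∘L proj P ij.2) S := by
    intro x
    have h1 := hP.hasSum_blocks hQ S (h.apply_adjoint_zero h𝒜 hgen) h.zero_apply_S
      (fun i j l hjl y z => by
        rw [← hvsc', ← hvsc']
        exact inner_vsc_vsc_of_orthogonal D (horth i j l hjl) y z) x
    simpa only [ContinuousLinearMap.comp_apply, hvsc', hR_adjoint] using h1
  obtain ⟨KAlg, hKAlg⟩ := hP.exists_blockDiagonal hP (fun i => hR (KA i) (B i))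
    (‖IsReduced.remainder K T S‖ + ‖IsReduced.remainder K T S‖) fun i => by
      rw [eq_sub_of_add_eq (hrem i).symm]
      refine (norm_sub_le _ _).trans (add_le_add (norm_blockK_le _ i i) ?_)
      rw [norm_smul, Complex.norm_I, one_mul]
      exact (norm_hL_le _).trans (hHBn i)
  obtain ⟨HComm, hHComm⟩ := hP.exists_blockDiagonal hP (fun i => hL (A i) (HB i))
    ‖IsReduced.remainder K T S‖ fun i => (norm_hL_le _).trans (hHBn i)
  refine ⟨D, ⟨?_, horth, hsa, ⟨S, T, hS, ?_, h.eq⟩, T† ∘L S, T† ∘L T, KAlg, HComm, ?_, ?_, hKAlg,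
    hHComm, ?_⟩, ⟨fun i => ?_, fun i j _ => ?_⟩⟩
  · intro i j
    refine AddMonoidHomClass.isometry_of_norm (fac i j).U fun x => ?_
    rw [@norm_eq_sqrt_re_inner ℂ, (fac i j).inner_U, ← @norm_eq_sqrt_re_inner ℂ]
  · simpa only [hR_adjoint] using h.hasSum
  · intro x
    -- Applying the bounded operator T† termwise to the series for S gives the cross terms of K; the
    -- series for T gives the quadratic ones in the same way.
    have h1 := (T†).hasSum (hS x)
    have h2 : ∀ ij : I × I, (T†) ((hR ((proj P ij.1)†) E ∘L D.vsc ij.1 ij.2 ∘L proj P ij.2) x) =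
        ((proj P ij.1)† ∘L hL (A ij.1) ((D.b ij.1)†) ∘L
          assocL (A ij.1) (B ij.1) E ∘L D.vsc ij.1 ij.2 ∘L proj P ij.2) x := fun ij => by
      have h3 := DFunLike.congr_fun (h.adjoint_T_comp ij.1) (D.vsc ij.1 ij.2 (proj P ij.2 x))
      rw [ampR_adjoint, hR_adjoint] at h3
      exact h3
    simp only [h2] at h1
    exact h1
  · intro x
    have h1 := (T†).hasSum (h.hasSum x)
    have h2 : ∀ i, (T†) (((hR (proj P i) E)† ∘L ampR (A i) (b i) ∘L proj P i) x) =
        ((proj P i)† ∘L hL (A i) ((D.b i)† ∘L D.b i) ∘L proj P i) x := fun i => by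
      have h3 := DFunLike.congr_fun (h.adjoint_T_comp i) (ampR (A i) (b i) (proj P i x))
      rw [ampR_adjoint] at h3
      have h4 : hL (A i) ((D.b i)† ∘L D.b i) (proj P i x) =
          hL (A i) ((b i)†) (assocL (A i) (B i) E (ampR (A i) (b i) (proj P i x))) := by
        rw [ampR, ContinuousLinearMap.comp_apply, assocL_assocR, hmap_comp_apply]
        rfl
      refine h3.trans ?_
      simp only [ContinuousLinearMap.comp_apply, h4]
    simp only [h2] at h1
    exact h1
  · have h1 : IsReduced.remainder K T S =
        KAlg + Complex.I • HComm + (proj₀ P)† ∘L D.K₀ := by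
      refine ContinuousLinearMap.ext fun x => hP.ext ?_ fun i => ?_
      · simp only [IsReduced.remainder, sub_apply, add_apply, smul_apply,
          ContinuousLinearMap.comp_apply, map_sub, map_add, map_smul, h.zero_adjoint_T,
          hP.zero_apply_sotHasSum hKAlg, hP.zero_apply_sotHasSum hHComm,
          hP.zero_apply_adjoint_zero, smul_zero, sub_zero, zero_add, D]
      · simp only [add_apply, smul_apply, ContinuousLinearMap.comp_apply, map_add, map_smul,
          hP.apply_sotHasSum hKAlg, hP.apply_sotHasSum hHComm, hP.apply_adjoint_zero, add_zero]
        have h2 : proj P i ∘L IsReduced.remainder K T S =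
            blockK P (IsReduced.remainder K T S) i i ∘L proj P i := by
          refine hP.hom_ext (fun y => ?_) fun j y => ?_
          · simp only [ContinuousLinearMap.comp_apply, hP.apply_adjoint_zero, map_zero]
            rw [IsReduced.remainder]
            have hT0 : T (((proj₀ P)†) y) = 0 := by
              refine hQ.eq_zero _ (h.zero_apply_T _) fun j => ?_
              rw [h.apply_T, hP.apply_adjoint_zero, map_zero]
            simp [h.apply_adjoint_zero h𝒜 hgen, hT0, proj_apply_adjoint_zero h𝒜 hgen i y]
          · by_cases hij : i = j
            · subst hij
              simp only [ContinuousLinearMap.comp_apply, hP.apply_adjoint_self]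
              rfl
            · simp only [ContinuousLinearMap.comp_apply, hP.apply_adjoint_of_ne i j hij, map_zero]
              exact DFunLike.congr_fun (h.blockK_remainder_of_ne hα hb h𝒜 hgen hij) y
        have h3 := DFunLike.congr_fun h2 x
        rw [hrem] at h3
        exact h3
    have h2 : K = T† ∘L S + (1 / 2 : ℂ) • (T† ∘L T) + IsReduced.remainder K T S := by
      rw [IsReduced.remainder]; abel
    rw [h1] at h2
    refine h2.trans ?_
    abel
  -- The (α,α)-slice of S vanishes by the choice of b_i, and U_ii is isometric, so the (α,α)-slice
  -- of A_ii vanishes too.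
  · refine isTotal_gkls (fac i i).total (α i) (hα i) ?_
    obtain ⟨β, hβ⟩ := exists_norm_eq (B i) zero_le_one
    have h1 := (fac i i).U_htmul (α i) (α i) β
    rw [h.slice_base hα hb] at h1
    have h2 := (fac i i).inner_U (htmul (bra (α i) _ ((fac i i).a (α i))) β)
      (htmul (bra (α i) _ ((fac i i).a (α i))) β)
    rw [h1, inner_zero_left, eq_comm, inner_self_eq_zero, ← norm_eq_zero, norm_htmul, hβ, mul_one,
      norm_eq_zero] at h2
    exact h2
  · exact isTotal_stinespring (fac i j).total

end ExistenceTheorem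

/-! ### Uniqueness of minimal Stinespring and GKLS data -/

section Uniqueness

variable {A A' F F' : Type*}
  [NormedAddCommGroup A] [InnerProductSpace ℂ A]
  [NormedAddCommGroup A'] [InnerProductSpace ℂ A']
  [NormedAddCommGroup F] [InnerProductSpace ℂ F] [CompleteSpace F]
  [NormedAddCommGroup F'] [InnerProductSpace ℂ F'] [CompleteSpace F']

/-- Equal Gram matrices give equal norms of finite linear combinations; totality on both sides
extends the correspondence to a unitary. -/
theorem exists_unitary_of_inner_eq {ι : Type*} {f : ι → F} {f' : ι → F'}
    (hf : IsTotal (Set.range f)) (hf' : IsTotal (Set.range f'))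
    (h : ∀ p q, inner ℂ (f p) (f q) = inner ℂ (f' p) (f' q)) :
    ∃ W : F ≃ₗᵢ[ℂ] F', ∀ p, W (f p) = f' p := by
  have hd : DenseRange (Finsupp.linearCombination ℂ f) := by
    rw [IsTotal, ← Finsupp.range_linearCombination] at hf
    exact hf
  have hd' : DenseRange (Finsupp.linearCombination ℂ f') := by
    rw [IsTotal, ← Finsupp.range_linearCombination] at hf'
    exact hf'
  have hn : ∀ x, ‖Finsupp.linearCombination ℂ f' (LinearEquiv.refl ℂ (ι →₀ ℂ) x)‖ =
      ‖Finsupp.linearCombination ℂ f x‖ := fun x => by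
    rw [@norm_eq_sqrt_re_inner ℂ, @norm_eq_sqrt_re_inner ℂ]
    congr 2
    simp only [LinearEquiv.refl_apply, Finsupp.linearCombination_apply, Finsupp.sum, sum_inner,
      inner_sum, inner_smul_left, inner_smul_right, h]
  refine ⟨LinearEquiv.extendOfIsometry (LinearEquiv.refl ℂ (ι →₀ ℂ)) _ _ hd hd' hn, fun p => ?_⟩
  have := LinearEquiv.extendOfIsometry_eq (LinearEquiv.refl ℂ (ι →₀ ℂ)) _ _ hd hd' hn
    (Finsupp.single p 1)
  simpa using this

theorem inner_ketR_adjoint [CompleteSpace A] (ψ : F) (φ : A) (x : A ⊗ₕ F) :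
    inner ℂ φ (((ketR A ψ)†) x) = inner ℂ ψ (bra φ F x) := by
  rw [ContinuousLinearMap.adjoint_inner_right, inner_bra_right, ketR_apply]

theorem bra_ketR (φ χ : A) (ψ : F) : bra φ F (ketR A ψ χ) = (inner ℂ φ χ : ℂ) • ψ :=
  bra_htmul φ χ ψ

theorem exists_unitary_stinespring [CompleteSpace A] [Nontrivial A]
    {a : A' →L[ℂ] A ⊗ₕ F} {a' : A' →L[ℂ] A ⊗ₕ F'}
    (ha : IsTotal {x : A ⊗ₕ F | ∃ (X : A →L[ℂ] A) (ψ : A'), x = (hR X F ∘L a) ψ})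
    (ha' : IsTotal {x : A ⊗ₕ F' | ∃ (X : A →L[ℂ] A) (ψ : A'), x = (hR X F' ∘L a') ψ})
    (h : ∀ φ φ' ψ ψ', inner ℂ (bra φ F (a ψ)) (bra φ' F (a ψ')) =
      inner ℂ (bra φ F' (a' ψ)) (bra φ' F' (a' ψ'))) :
    ∃ W : F ≃ₗᵢ[ℂ] F', a' = hL A (unitaryL W) ∘L a := by
  obtain ⟨W, hW⟩ := exists_unitary_of_inner_eq (isTotal_slices_of_stinespring ha)
    (isTotal_slices_of_stinespring ha') fun p q => h p.1 q.1 p.2 q.2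
  refine ⟨W, ContinuousLinearMap.ext fun ψ => bra_ext fun φ => ?_⟩
  rw [ContinuousLinearMap.comp_apply, bra_hL]
  exact (hW (φ, ψ)).symm

/-- Centring at α removes k and k' from the hypothesis, which yields W; ξ measures how the uncentred
slices at (α,α) differ. The explicit norm bounds are there to give suprema over i. -/
theorem exists_unitary_gkls [CompleteSpace A] [Nontrivial A]
    {a : A →L[ℂ] A ⊗ₕ F} {a' : A →L[ℂ] A ⊗ₕ F'} {k k' : A →L[ℂ] A}
    (ha : IsTotal {x : A ⊗ₕ F | ∃ (X : A →L[ℂ] A) (ψ : A), x = (hR X F ∘L a - a ∘L X) ψ})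
    (ha' : IsTotal {x : A ⊗ₕ F' | ∃ (X : A →L[ℂ] A) (ψ : A), x = (hR X F' ∘L a' - a' ∘L X) ψ})
    (h : ∀ φ φ' ψ ψ', inner ℂ (bra φ F (a ψ)) (bra φ' F (a ψ')) -
        inner ℂ φ' ψ' * inner ℂ (k ψ) φ - inner ℂ ψ φ * inner ℂ φ' (k ψ') =
      inner ℂ (bra φ F' (a' ψ)) (bra φ' F' (a' ψ')) -
        inner ℂ φ' ψ' * inner ℂ (k' ψ) φ - inner ℂ ψ φ * inner ℂ φ' (k' ψ')) :
    ∃ (W : F ≃ₗᵢ[ℂ] F') (ξ : F') (μ : ℝ),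
      a' = hL A (unitaryL W) ∘L a + ketR A ξ ∧
      k' = k + (ketR A ξ)† ∘L hL A (unitaryL W) ∘L a +
        (1 / 2 * (‖ξ‖ : ℂ) ^ 2 + Complex.I * (μ : ℂ)) • ContinuousLinearMap.id ℂ A ∧
      ‖ξ‖ ≤ ‖a‖ + ‖a'‖ ∧
      |μ| ≤ ‖k‖ + ‖k'‖ + (‖a‖ + ‖a'‖) * ‖a‖ + (‖a‖ + ‖a'‖) ^ 2 := by
  obtain ⟨α, hα⟩ := exists_norm_eq A zero_le_one
  have hαα : inner ℂ α α = (1 : ℂ) := by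
    rw [inner_self_eq_norm_sq_to_K, hα]; simp
  obtain ⟨W, hW⟩ := exists_unitary_of_inner_eq (isTotal_slices_of_gkls α hα ha)
    (isTotal_slices_of_gkls α hα ha') fun p q => by
      have h₁ := h p.1 q.1 p.2 q.2
      have h₂ := h p.1 α p.2 α
      have h₃ := h α q.1 α q.2
      have h₄ := h α α α α
      simp only [inner_sub_left, inner_sub_right, inner_smul_left, inner_smul_right,
        inner_conj_symm]
      rw [hαα] at h₂ h₃ h₄
      linear_combination h₁ - inner ℂ q.1 q.2 * h₂ - inner ℂ p.2 p.1 * h₃ +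
        inner ℂ p.2 p.1 * inner ℂ q.1 q.2 * h₄
  set ξ : F' := bra α F' (a' α) - W (bra α F (a α)) with hξ
  have hba : ∀ φ ψ, bra φ F' (a' ψ) = W (bra φ F (a ψ)) + (inner ℂ φ ψ : ℂ) • ξ := fun φ ψ => by
    have := hW (φ, ψ)
    rw [map_sub, map_smul] at this
    rw [hξ, smul_sub, sub_eq_iff_eq_add.1 this.symm]
    abel
  have hnξ : ‖ξ‖ ≤ ‖a‖ + ‖a'‖ := by
    have h1 : ‖bra α F' (a' α)‖ ≤ ‖a'‖ := by
      have := (norm_bra_le α (a' α)).trans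
        (mul_le_mul_of_nonneg_left (a'.le_opNorm α) (norm_nonneg _))
      simpa [hα] using this
    have h2 : ‖bra α F (a α)‖ ≤ ‖a‖ := by
      have := (norm_bra_le α (a α)).trans
        (mul_le_mul_of_nonneg_left (a.le_opNorm α) (norm_nonneg _))
      simpa [hα] using this
    refine (norm_sub_le _ _).trans ?_
    rw [LinearIsometryEquiv.norm_map]
    linarith
  have hξξ : inner ℂ ξ ξ = (‖ξ‖ : ℂ) ^ 2 := inner_self_eq_norm_sq_to_K _
  -- This is the matrix element of the discrepancy in the formula for k' without the iμ term. The
  -- hypothesis with (α,α) as first pair gives q(φ,ψ) = −⟨φ,ψ⟩ conj q(α,α); hence q(α,α) is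
  -- imaginary and q is iμ times the inner product.
  set q : A → A → ℂ := fun φ ψ => inner ℂ φ (k' ψ) - inner ℂ φ (k ψ) -
    inner ℂ ξ (W (bra φ F (a ψ))) - 1 / 2 * inner ℂ φ ψ * (‖ξ‖ : ℂ) ^ 2 with hq
  have hq1 : ∀ φ ψ, q φ ψ = - inner ℂ φ ψ * starRingEnd ℂ (q α α) := fun φ ψ => by
    have h1 := h α φ α ψ
    rw [hba, hba] at h1
    simp only [inner_add_left, inner_add_right, inner_smul_left, inner_smul_right,
      LinearIsometryEquiv.inner_map_map, hαα, hξξ, map_one, one_mul] at h1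
    simp only [hq, map_sub, map_mul, map_div₀, map_one, map_ofNat, map_pow, inner_conj_symm,
      Complex.conj_ofReal, hαα]
    linear_combination h1
  have hq2 : q α α = Complex.I * ((q α α).im : ℂ) := by
    have h1 := hq1 α α
    rw [hαα] at h1
    have h2 := congrArg Complex.re h1
    simp at h2
    apply Complex.ext
    · simp; linarith
    · simp
  have hq3 : ∀ φ ψ, q φ ψ = inner ℂ φ ψ * (Complex.I * ((q α α).im : ℂ)) := fun φ ψ => by
    rw [hq1, hq2]
    simp
  refine ⟨W, ξ, (q α α).im, ?_, ?_, hnξ, ?_⟩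
  · refine ContinuousLinearMap.ext fun ψ => bra_ext fun φ => ?_
    rw [hba, add_apply, map_add, ContinuousLinearMap.comp_apply, bra_hL, bra_ketR]
    rfl
  · refine ContinuousLinearMap.ext fun ψ => ext_inner_left ℂ fun φ => ?_
    simp only [add_apply, smul_apply, ContinuousLinearMap.comp_apply, inner_add_right,
      inner_smul_right, inner_ketR_adjoint, bra_hL, ContinuousLinearMap.id_apply]
    have h1 := hq3 φ ψ
    simp only [hq] at h1
    change _ = inner ℂ φ (k ψ) + inner ℂ ξ (W (bra φ F (a ψ))) + _
    linear_combination h1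
  · refine (Complex.abs_im_le_norm _).trans ?_
    have h1 : ∀ l : A →L[ℂ] A, ‖(inner ℂ α (l α) : ℂ)‖ ≤ ‖l‖ := fun l => by
      have := (norm_inner_le_norm (𝕜 := ℂ) α (l α)).trans
        (mul_le_mul_of_nonneg_left (l.le_opNorm α) (norm_nonneg _))
      simpa [hα] using this
    have h2 : ‖(inner ℂ ξ (W (bra α F (a α))) : ℂ)‖ ≤ (‖a‖ + ‖a'‖) * ‖a‖ := by
      refine (norm_inner_le_norm (𝕜 := ℂ) _ _).trans ?_
      rw [LinearIsometryEquiv.norm_map]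
      gcongr
      have := (norm_bra_le α (a α)).trans
        (mul_le_mul_of_nonneg_left (a.le_opNorm α) (norm_nonneg _))
      simpa [hα] using this
    have h3 : ‖1 / 2 * (inner ℂ α α : ℂ) * (‖ξ‖ : ℂ) ^ 2‖ ≤ (‖a‖ + ‖a'‖) ^ 2 := by
      rw [hαα]
      have : ‖ξ‖ ^ 2 ≤ (‖a‖ + ‖a'‖) ^ 2 := by gcongr
      simp
      nlinarith [sq_nonneg ‖ξ‖]
    simp only [hq]
    refine (norm_sub_le _ _).trans (add_le_add ((norm_sub_le _ _).trans (add_le_add ?_ h2)) h3)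
    exact (norm_sub_le _ _).trans (by linarith [h1 k, h1 k'])

end Uniqueness

/-! ### Blocks of a normal form -/

namespace IsDecomposition

variable {I M G₀ N D₀ : Type*} {G D : I → Type*}
  [NormedAddCommGroup M] [InnerProductSpace ℂ M] [CompleteSpace M]
  [NormedAddCommGroup G₀] [InnerProductSpace ℂ G₀] [CompleteSpace G₀]
  [∀ i, NormedAddCommGroup (G i)] [∀ i, InnerProductSpace ℂ (G i)] [∀ i, CompleteSpace (G i)]
  {p₀ : M →L[ℂ] G₀} {p : ∀ i, M →L[ℂ] G i}
  [NormedAddCommGroup N] [InnerProductSpace ℂ N] [CompleteSpace N]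
  [NormedAddCommGroup D₀] [InnerProductSpace ℂ D₀] [CompleteSpace D₀]
  [∀ i, NormedAddCommGroup (D i)] [∀ i, InnerProductSpace ℂ (D i)] [∀ i, CompleteSpace (D i)]
  {q₀ : N →L[ℂ] D₀} {q : ∀ i, N →L[ℂ] D i}

theorem apply_sotHasSum_blocks (h : IsDecomposition p₀ p) (k : IsDecomposition q₀ q)
    {s : ∀ i j, G j →L[ℂ] D i} {S : M →L[ℂ] N}
    (hS : SOTHasSum (fun ij : I × I => (q ij.1)† ∘L s ij.1 ij.2 ∘L p ij.2) S) (i j : I) (y : G j) :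
    q i (S (((p j)†) y)) = s i j y := by
  have h1 := (q i).hasSum (hS (((p j)†) y))
  have h2 := h1.unique (hasSum_single (i, j) ?_)
  · rw [h2]
    simp only [ContinuousLinearMap.comp_apply, h.apply_adjoint_self, k.apply_adjoint_self]
  · rintro ⟨i', j'⟩ hij
    by_cases hi : i = i'
    · have hj : j' ≠ j := fun e => hij (by rw [hi, e])
      simp only [ContinuousLinearMap.comp_apply, h.apply_adjoint_of_ne j' j hj, map_zero]
    · exact k.apply_adjoint_of_ne i i' hi _

end IsDecomposition

theorem IsDecomposition.zero_apply_sotHasSum_blocks {I M N D₀ : Type*} {G D : I → Type*}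
    [NormedAddCommGroup M] [InnerProductSpace ℂ M]
    [∀ i, NormedAddCommGroup (G i)] [∀ i, InnerProductSpace ℂ (G i)] {p : ∀ i, M →L[ℂ] G i}
    [NormedAddCommGroup N] [InnerProductSpace ℂ N] [CompleteSpace N]
    [NormedAddCommGroup D₀] [InnerProductSpace ℂ D₀] [CompleteSpace D₀]
    [∀ i, NormedAddCommGroup (D i)] [∀ i, InnerProductSpace ℂ (D i)] [∀ i, CompleteSpace (D i)]
    {q₀ : N →L[ℂ] D₀} {q : ∀ i, N →L[ℂ] D i} (k : IsDecomposition q₀ q)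
    {s : ∀ i j, G j →L[ℂ] D i} {S : M →L[ℂ] N}
    (hS : SOTHasSum (fun ij : I × I => (q ij.1)† ∘L s ij.1 ij.2 ∘L p ij.2) S) (x : M) :
    q₀ (S x) = 0 := by
  have h1 := q₀.hasSum (hS x)
  refine h1.unique ?_
  have : (fun ij : I × I => q₀ (((q ij.1)† ∘L s ij.1 ij.2 ∘L p ij.2) x)) = fun _ => 0 :=
    funext fun ij => k.zero_apply_adjoint ij.1 _
  rw [this]
  exact hasSum_zero

namespace NormalFormData

variable {I : Type v} {H H₀ E : Type u} {A B : I → Type u}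
  [NormedAddCommGroup H] [InnerProductSpace ℂ H] [CompleteSpace H]
  [NormedAddCommGroup H₀] [InnerProductSpace ℂ H₀] [CompleteSpace H₀]
  [NormedAddCommGroup E] [InnerProductSpace ℂ E]
  [∀ i, NormedAddCommGroup (A i)] [∀ i, InnerProductSpace ℂ (A i)]
  [∀ i, NormedAddCommGroup (B i)] [∀ i, InnerProductSpace ℂ (B i)] [∀ i, CompleteSpace (B i)]
  {P : BlockSpace H₀ A B ≃ₗᵢ[ℂ] H} {V : H →L[ℂ] H ⊗ₕ E} {K : H →L[ℂ] H}
  {D : NormalFormData H H₀ E A B}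

theorem IsNormalForm.inner_U (h : D.IsNormalForm P V K) (i j : I) (x y : D.F i j ⊗ₕ B j) :
    inner ℂ (D.U i j x) (D.U i j y) = inner ℂ x y :=
  (LinearIsometry.mk (D.U i j).toLinearMap
    ((AddMonoidHomClass.isometry_iff_norm _).1 (h.isometry_U i j))).inner_map_map x y

theorem IsNormalForm.K₀_eq (h : D.IsNormalForm P V K) : D.K₀ = proj₀ P ∘L K := by
  have hP := isDecomposition_proj P
  obtain ⟨S, T, KAlg, HComm, hS, hT, hKAlg, hHComm, hK⟩ := h.K_eq
  refine ContinuousLinearMap.ext fun x => ?_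
  have hS0 := hP.zero_apply_sotHasSum_blocks (s := fun i j => hL (A i) ((D.b i)†) ∘L
      assocL (A i) (B i) E ∘L D.vsc i j) hS
  rw [hK]
  simp only [ContinuousLinearMap.comp_apply, add_apply, smul_apply, map_add, map_smul,
    hS0, hP.zero_apply_sotHasSum hT, hP.zero_apply_sotHasSum hKAlg,
    hP.zero_apply_sotHasSum hHComm, hP.zero_apply_adjoint_zero, smul_zero, zero_add]

theorem IsNormalForm.slice_blockK_self (h : D.IsNormalForm P V K) (i : I) (φ ψ : A i) (c : B i) :
    slice φ ψ (blockK P K i i) c =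
      ((D.b i)†) (D.U i i (htmul (bra φ _ (D.a i i ψ)) c)) +
      (1 / 2 * inner ℂ φ ψ : ℂ) • ((D.b i)†) (D.b i c) +
      (inner ℂ φ (D.KA i ψ) : ℂ) • c + (Complex.I * inner ℂ φ ψ : ℂ) • D.HB i c := by
  have hP := isDecomposition_proj P
  obtain ⟨S, T, KAlg, HComm, hS, hT, hKAlg, hHComm, hK⟩ := h.K_eq
  have h1 : blockK P K i i = hL (A i) ((D.b i)†) ∘L assocL (A i) (B i) E ∘L D.vsc i i +
      (1 / 2 : ℂ) • hL (A i) ((D.b i)† ∘L D.b i) + hR (D.KA i) (B i) +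
      Complex.I • hL (A i) (D.HB i) := by
    refine ContinuousLinearMap.ext fun y => ?_
    have hS1 := hP.apply_sotHasSum_blocks hP (s := fun i j => hL (A i) ((D.b i)†) ∘L
      assocL (A i) (B i) E ∘L D.vsc i j) hS i i y
    rw [blockK, hK]
    simp only [ContinuousLinearMap.comp_apply, add_apply, smul_apply, map_add, map_smul,
      hP.apply_sotHasSum hT, hP.apply_sotHasSum hKAlg, hP.apply_sotHasSum hHComm,
      hP.apply_adjoint_zero, hP.apply_adjoint_self, add_zero]
    rw [hS1]
    rfl
  rw [h1, slice_add, slice_add, slice_add, slice_smul, slice_smul, slice_hL, slice_hL, slice_hR,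
    slice_hL_comp, vsc, slice_semilocal, smul_smul, smul_smul]
  rfl

variable [CompleteSpace E]

theorem IsNormalForm.V₀_eq (h : D.IsNormalForm P V K) : D.V₀ = hR (proj₀ P) E ∘L V := by
  have hQ := (isDecomposition_proj P).hR (E := E)
  obtain ⟨S, T, hS, hT, hV⟩ := h.V_eq
  simp only [← hR_adjoint] at hS hT
  have hS0 := hQ.zero_apply_sotHasSum_blocks hS
  have hT0 := hQ.zero_apply_sotHasSum hT
  refine ContinuousLinearMap.ext fun x => ?_
  rw [hV, ← hR_adjoint]
  simp only [ContinuousLinearMap.comp_apply, add_apply, map_add, hS0, hT0, add_zero,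
    hQ.zero_apply_adjoint_zero]

/-- The decomposition of `V` in a normal form. -/
theorem IsNormalForm.exists_isReduced (h : D.IsNormalForm P V K) :
    ∃ T S : H →L[ℂ] H ⊗ₕ E, IsReduced P V T S D.b ∧
      ∀ i j, assocL (A i) (B i) E ∘L D.vsc i j = blockV P S i j := by
  have hP := isDecomposition_proj P
  have hQ := hP.hR (E := E)
  obtain ⟨S, T, hS, hT, hV⟩ := h.V_eq
  simp only [← hR_adjoint] at hS hT
  refine ⟨T, S, ⟨hT, by rw [← h.V₀_eq]; exact hV⟩, fun i j => ContinuousLinearMap.ext fun y => ?_⟩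
  exact congrArg (assocL (A i) (B i) E) (hP.apply_sotHasSum_blocks hQ hS i j y).symm

theorem IsNormalForm.slice_blockV_of_ne (h : D.IsNormalForm P V K) {i j : I} (hij : i ≠ j)
    (φ : A i) (ψ : A j) (c : B j) :
    slice φ ψ (blockV P V i j) c = D.U i j (htmul (bra φ _ (D.a i j ψ)) c) := by
  obtain ⟨T, S, hr, hS⟩ := h.exists_isReduced
  rw [hr.slice_of_ne hij, ← hS, vsc, slice_semilocal]

theorem IsNormalForm.slice_blockV_self (h : D.IsNormalForm P V K) (i : I) (φ ψ : A i) (c : B i) :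
    slice φ ψ (blockV P V i i) c =
      D.U i i (htmul (bra φ _ (D.a i i ψ)) c) + (inner ℂ φ ψ : ℂ) • D.b i c := by
  obtain ⟨T, S, hr, hS⟩ := h.exists_isReduced
  rw [hr.slice_self, ← hS, vsc, slice_semilocal]

/-- By isometry of U_ii, ‖A_ii φ‖ is the norm of a block of the bounded operator S at φ ⊗ β;
likewise K_A ⊗ 1 is a block of the bounded operator `KAlg`. -/
theorem IsNormalForm.exists_bound [∀ i, Nontrivial (B i)] (h : D.IsNormalForm P V K) :
    ∃ C : ℝ, ∀ i, ‖D.a i i‖ ≤ C ∧ ‖D.KA i‖ ≤ C := by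
  have hP := isDecomposition_proj P
  obtain ⟨T, S, hr, hS⟩ := h.exists_isReduced
  obtain ⟨-, -, KAlg, -, -, -, hKAlg, -⟩ := h.K_eq
  refine ⟨max ‖S‖ ‖KAlg‖, fun i => ⟨le_max_of_le_left ?_, le_max_of_le_right ?_⟩⟩
  · obtain ⟨β, hβ⟩ := exists_norm_eq (B i) zero_le_one
    refine ContinuousLinearMap.opNorm_le_bound _ (norm_nonneg _) fun φ => ?_
    have h1 : ‖assocL (A i) (B i) E (D.vsc i i (htmul φ β))‖ = ‖D.a i i φ‖ := by
      rw [vsc, semilocal, ampR]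
      simp only [ContinuousLinearMap.comp_apply, assocL_assocR]
      rw [norm_hL_of_isometry (h.inner_U i i), norm_assocL, hmap_htmul, norm_htmul]
      simp [hβ]
    have h2 := DFunLike.congr_fun (hS i i) (htmul φ β)
    rw [ContinuousLinearMap.comp_apply] at h2
    rw [← h1, h2]
    refine (ContinuousLinearMap.le_of_opNorm_le _ (norm_blockV_le S i i) _).trans ?_
    rw [norm_htmul, hβ, mul_one]
  · obtain ⟨β, hβ⟩ := exists_norm_eq (B i) zero_le_one
    refine ContinuousLinearMap.opNorm_le_bound _ (norm_nonneg _) fun φ => ?_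
    have h1 : ‖hR (D.KA i) (B i) (htmul φ β)‖ = ‖D.KA i φ‖ := by
      rw [hmap_htmul, norm_htmul]
      simp [hβ]
    have h2 : blockK P KAlg i i (htmul φ β) = hR (D.KA i) (B i) (htmul φ β) := by
      rw [blockK, ContinuousLinearMap.comp_apply, ContinuousLinearMap.comp_apply,
        hP.apply_sotHasSum hKAlg, hP.apply_adjoint_self]
    rw [← h1, ← h2]
    refine (ContinuousLinearMap.le_of_opNorm_le _ (norm_blockK_le KAlg i i) _).trans ?_
    rw [norm_htmul, hβ, mul_one]

/-! ### Uniqueness of minimal normal forms -/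

theorem IsNormalForm.inner_generator_of_ne [∀ i, Nontrivial (B i)] (h : D.IsNormalForm P V K)
    {i j : I} (hij : i ≠ j) (φ φ' : A i) (ψ ψ' : A j) (c c' : B j) :
    inner ℂ (((proj P j)†) (htmul ψ c))
        (generator V K (embed P i (InnerProductSpace.rankOne ℂ φ φ'))
          (((proj P j)†) (htmul ψ' c'))) =
      inner ℂ (bra φ _ (D.a i j ψ)) (bra φ' _ (D.a i j ψ')) * inner ℂ c c' := by
  rw [inner_generator_block_of_ne V K hij hij, h.slice_blockV_of_ne hij, h.slice_blockV_of_ne hij,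
    h.inner_U, inner_htmul]

/-- The terms of K containing b_i complete a square that cancels those of V, H_B cancels by
self-adjointness, and U_ii drops out as an isometry. -/
theorem IsNormalForm.inner_generator_self (h : D.IsNormalForm P V K)
    (i : I) (φ φ' ψ ψ' : A i) (c c' : B i) :
    inner ℂ (((proj P i)†) (htmul ψ c))
        (generator V K (embed P i (InnerProductSpace.rankOne ℂ φ φ'))
          (((proj P i)†) (htmul ψ' c'))) =
      (inner ℂ (bra φ _ (D.a i i ψ)) (bra φ' _ (D.a i i ψ')) -
        inner ℂ φ' ψ' * inner ℂ (D.KA i ψ) φ - inner ℂ ψ φ * inner ℂ φ' (D.KA i ψ')) *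
          inner ℂ c c' := by
  rw [inner_generator_block_self V K, h.slice_blockV_self, h.slice_blockV_self,
    h.slice_blockK_self, h.slice_blockK_self]
  have h1 := h.inner_U i i (htmul (bra φ _ (D.a i i ψ)) c) (htmul (bra φ' _ (D.a i i ψ')) c')
  rw [inner_htmul] at h1
  have h2 : inner ℂ (D.HB i c) c' = inner ℂ c (D.HB i c') :=
    (ContinuousLinearMap.isSelfAdjoint_iff_isSymmetric.1 (h.selfAdjoint_HB i)) c c'
  simp only [inner_add_left, inner_add_right, inner_smul_left,
      inner_smul_right, inner_conj_symm, ContinuousLinearMap.adjoint_inner_left,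
      ContinuousLinearMap.adjoint_inner_right, map_mul, map_div₀, map_one, map_ofNat,
      Complex.conj_I, h1, h2]
  ring

end NormalFormData

namespace NormalFormData

variable {I : Type v} {H H₀ E E' : Type u} {A B : I → Type u}
  [NormedAddCommGroup H] [InnerProductSpace ℂ H] [CompleteSpace H]
  [NormedAddCommGroup H₀] [InnerProductSpace ℂ H₀] [CompleteSpace H₀]
  [NormedAddCommGroup E] [InnerProductSpace ℂ E] [CompleteSpace E]
  [NormedAddCommGroup E'] [InnerProductSpace ℂ E'] [CompleteSpace E']
  [∀ i, NormedAddCommGroup (A i)] [∀ i, InnerProductSpace ℂ (A i)] [∀ i, CompleteSpace (A i)]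
  [∀ i, Nontrivial (A i)]
  [∀ i, NormedAddCommGroup (B i)] [∀ i, InnerProductSpace ℂ (B i)] [∀ i, CompleteSpace (B i)]
  {P : BlockSpace H₀ A B ≃ₗᵢ[ℂ] H} {𝒜 : NonUnitalStarSubalgebra ℂ (H →L[ℂ] H)}

theorem exists_areRelated [∀ i, Nontrivial (B i)] (h𝒜 : IsAtomicWith 𝒜 P) {V : H →L[ℂ] H ⊗ₕ E} {K : H →L[ℂ] H}
    {V' : H →L[ℂ] H ⊗ₕ E'} {K' : H →L[ℂ] H}
    {D : NormalFormData H H₀ E A B} {D' : NormalFormData H H₀ E' A B}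
    (h : D.IsNormalForm P V K) (hm : D.IsMinimal)
    (h' : D'.IsNormalForm P V' K') (hm' : D'.IsMinimal)
    (hgen : ∀ X ∈ 𝒜, generator V K X = generator V' K' X) :
    ∃ (W : ∀ i j, D.F i j ≃ₗᵢ[ℂ] D'.F i j) (ψ : ∀ i, D'.F i i) (μ : I → ℝ),
      D.AreRelated D' W ψ μ := by
  classical
  choose β hβ using fun i => exists_norm_eq (B i) zero_le_one
  have hββ : ∀ i, inner ℂ (β i) (β i) = (1 : ℂ) := fun i => by
    rw [inner_self_eq_norm_sq_to_K, hβ]; simp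
  have hoff : ∀ i j, ∃ W : D.F i j ≃ₗᵢ[ℂ] D'.F i j, i ≠ j →
      D'.a i j = hL (A i) (unitaryL W) ∘L D.a i j := fun i j => by
    by_cases hij : i = j
    · subst hij
      obtain ⟨W, -⟩ := exists_unitary_gkls (k := D.KA i) (k' := D'.KA i) (hm.gkls i) (hm'.gkls i)
        fun φ φ' ψ ψ' => by
          have h1 := h.inner_generator_self i φ φ' ψ ψ' (β i) (β i)
          rw [hgen _ (embed_mem h𝒜 i _), h'.inner_generator_self, hββ, mul_one, mul_one] at h1
          exact h1.symm
      exact ⟨W, fun h => absurd rfl h⟩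
    · obtain ⟨W, hW⟩ := exists_unitary_stinespring (hm.stinespring i j hij)
        (hm'.stinespring i j hij) fun φ φ' ψ ψ' => by
          have h1 := h.inner_generator_of_ne hij φ φ' ψ ψ' (β j) (β j)
          rw [hgen _ (embed_mem h𝒜 i _), h'.inner_generator_of_ne hij, hββ, mul_one, mul_one] at h1
          exact h1.symm
      exact ⟨W, fun _ => hW⟩
  choose Woff hWoff using hoff
  choose Wd ξ μ ha hk hξ hμ using fun i => exists_unitary_gkls (k := D.KA i) (k' := D'.KA i)
    (hm.gkls i) (hm'.gkls i) fun φ φ' ψ ψ' => by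
      have h1 := h.inner_generator_self i φ φ' ψ ψ' (β i) (β i)
      rw [hgen _ (embed_mem h𝒜 i _), h'.inner_generator_self, hββ, mul_one, mul_one] at h1
      exact h1.symm
  obtain ⟨C, hC⟩ := h.exists_bound
  obtain ⟨C', hC'⟩ := h'.exists_bound
  refine ⟨fun i => Function.update (Woff i) i (Wd i), ξ, μ, ⟨C + C', ?_⟩,
    ⟨C + C' + (C + C') * C + (C + C') ^ 2, ?_⟩, fun i => ?_, fun i => ?_, fun i j hij => ?_⟩
  · rintro _ ⟨i, rfl⟩
    exact (hξ i).trans (add_le_add (hC i).1 (hC' i).1)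
  · rintro _ ⟨i, rfl⟩
    refine (hμ i).trans ?_
    have h1 := (hC i).1
    have h2 := (hC' i).1
    have h3 := (hC i).2
    have h4 := (hC' i).2
    have h5 : 0 ≤ C + C' := (add_nonneg (norm_nonneg _) (norm_nonneg _)).trans (add_le_add h1 h2)
    gcongr
  · rw [Function.update_self]
    exact ha i
  · rw [Function.update_self]
    exact hk i
  · rw [Function.update_of_ne (Ne.symm hij)]
    exact hWoff i j hij

theorem AreRelated.relations {V : H →L[ℂ] H ⊗ₕ E} {K : H →L[ℂ] H}
    {D D' : NormalFormData H H₀ E A B}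
    (h : D.IsNormalForm P V K) (hm : D.IsMinimal) (h' : D'.IsNormalForm P V K)
    {W : ∀ i j, D.F i j ≃ₗᵢ[ℂ] D'.F i j} {ψ : ∀ i, D'.F i i} {μ : I → ℝ}
    (hr : D.AreRelated D' W ψ μ) :
    (∀ i, D'.b i = D.b i - D.shift D' W ψ i) ∧
    (∀ i, D'.HB i = D.HB i +
      (Complex.I / 2) • ((D.b i)† ∘L D.shift D' W ψ i - ((D.b i)† ∘L D.shift D' W ψ i)†) -
      (μ i : ℂ) • ContinuousLinearMap.id ℂ (B i)) ∧
    ∀ i j, D'.U i j = D.U i j ∘L hR (unitaryL (W i j).symm) (B j) := by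
  choose α hα using fun i => exists_norm_eq (A i) zero_le_one
  have hαα : ∀ i, inner ℂ (α i) (α i) = (1 : ℂ) := fun i => by
    rw [inner_self_eq_norm_sq_to_K, hα]; simp
  have hbra : ∀ i φ χ, bra φ _ (D'.a i i χ) =
      W i i (bra φ _ (D.a i i χ)) + (inner ℂ φ χ : ℂ) • ψ i := fun i φ χ => by
    rw [hr.a_diag, add_apply, map_add, ContinuousLinearMap.comp_apply, bra_hL, bra_ketR]
    rfl
  have hslice : ∀ i φ χ c, D.U i i (htmul (bra φ _ (D.a i i χ)) c) +
      (inner ℂ φ χ : ℂ) • D.b i c = D'.U i i (htmul (W i i (bra φ _ (D.a i i χ))) c) +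
      (inner ℂ φ χ : ℂ) • (D'.U i i (htmul (ψ i) c) + D'.b i c) := fun i φ χ c => by
    rw [← h.slice_blockV_self, h'.slice_blockV_self, hbra, htmul_add_left, map_add,
      htmul_smul_left, map_smul, smul_add, add_assoc]
  -- It suffices to compare on a total set. For i = j these are the centred slices, where the b- and
  -- ψ-terms of `hslice` cancel.
  have hUW : ∀ i j, D'.U i j ∘L hR (unitaryL (W i j)) (B j) = D.U i j := fun i j => by
    by_cases hij : i = j
    · subst hij
      refine (isTotal_slices_of_gkls (α i) (hα i) (hm.gkls i)).hext ?_
      rintro _ ⟨p, rfl⟩ c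
      rw [ContinuousLinearMap.comp_apply, hmap_htmul]
      change D'.U i i (htmul (W i i _) c) = _
      have h1 := hslice i p.1 p.2 c
      have h2 := hslice i (α i) (α i) c
      rw [hαα, one_smul, one_smul] at h2
      rw [map_sub, map_smul, htmul_sub_left, htmul_sub_left, map_sub, map_sub, htmul_smul_left,
        htmul_smul_left, map_smul, map_smul]
      rw [eq_sub_of_add_eq h1, eq_sub_of_add_eq h2]
      module
    · refine (isTotal_slices_of_stinespring (hm.stinespring i j hij)).hext ?_
      rintro _ ⟨p, rfl⟩ c
      rw [ContinuousLinearMap.comp_apply, hmap_htmul, ← h.slice_blockV_of_ne hij,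
        h'.slice_blockV_of_ne hij, hr.a_offDiag i j hij, ContinuousLinearMap.comp_apply, bra_hL]
      rfl
  have hUW' : ∀ i j f c, D'.U i j (htmul (W i j f) c) = D.U i j (htmul f c) := fun i j f c => by
    rw [← hUW, ContinuousLinearMap.comp_apply, hmap_htmul]
    rfl
  have hs : ∀ i c, D.shift D' W ψ i c = D'.U i i (htmul (ψ i) c) := fun i c => by
    rw [shift, ContinuousLinearMap.comp_apply, ketL_apply, ← hUW', LinearIsometryEquiv.apply_symm_apply]
  -- With the U-terms identified, the slice of V at (α,α) leaves only the b-terms.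
  have hb : ∀ i, D'.b i = D.b i - D.shift D' W ψ i := fun i => ContinuousLinearMap.ext fun c => by
    have h2 := hslice i (α i) (α i) c
    rw [hαα, one_smul, one_smul, hUW', ← hs] at h2
    rw [sub_apply, add_left_cancel h2]
    abel
  refine ⟨hb, fun i => ContinuousLinearMap.ext fun c => ext_inner_left ℂ fun x => ?_,
    fun i j => ?_⟩
  · have h1 := congrArg (inner ℂ x) (h.slice_blockK_self i (α i) (α i) c)
    rw [h'.slice_blockK_self, hbra, hαα, hb, hr.KA_eq, htmul_add_left, map_add, hUW',
      one_smul, ← hs] at h1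
    have h3 : inner ℂ (D.shift D' W ψ i x) (D.U i i (htmul (bra (α i) _ (D.a i i (α i))) c)) =
        inner ℂ (ψ i) (W i i (bra (α i) _ (D.a i i (α i)))) * inner ℂ x c := by
      rw [hs, ← hUW', h'.inner_U, inner_htmul]
    have h4 : inner ℂ (D.shift D' W ψ i x) (D.shift D' W ψ i c) =
        (‖ψ i‖ : ℂ) ^ 2 * inner ℂ x c := by
      rw [hs, hs, h'.inner_U, inner_htmul, inner_self_eq_norm_sq_to_K]
      rfl
    have h5 : inner ℂ (α i) (((ketR (A i) (ψ i))†)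
        (hL (A i) (unitaryL (W i i)) (D.a i i (α i)))) =
        inner ℂ (ψ i) (W i i (bra (α i) _ (D.a i i (α i)))) := by
      rw [inner_ketR_adjoint, bra_hL]
      rfl
    simp only [inner_sub_left, inner_sub_right, inner_add_right, inner_smul_right, ContinuousLinearMap.adjoint_inner_left,
      ContinuousLinearMap.adjoint_inner_right, sub_apply, add_apply, smul_apply,
      ContinuousLinearMap.comp_apply, ContinuousLinearMap.id_apply, h3, h4, h5, hαα] at h1 ⊢
    -- The (α,α)-slice of K contains i·H_B and iμ; multiplying by −i solves for H_B, with i² = −1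
    -- supplied by the second summand.
    linear_combination (-Complex.I) * h1 + (inner ℂ x (D'.HB i c) - inner ℂ x (D.HB i c) +
      (μ i : ℂ) * inner ℂ x c) * Complex.I_mul_I
  · refine ContinuousLinearMap.ext fun x => ?_
    rw [← hUW, ContinuousLinearMap.comp_apply, ContinuousLinearMap.comp_apply, hmap_comp_apply]
    have : unitaryL (W i j) ∘L unitaryL (W i j).symm = ContinuousLinearMap.id ℂ _ :=
      ContinuousLinearMap.ext fun f => (W i j).apply_symm_apply f
    rw [this, ContinuousLinearMap.comp_id, hmap_id]
    rfl

end NormalFormData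

end

end GKLS

/-! ### The main theorem. -/

open GKLS in
theorem mainTheorem4 {I : Type v} [Countable I] {H H₀ : Type u} {A B : I → Type u}
    [NormedAddCommGroup H] [InnerProductSpace ℂ H] [CompleteSpace H]
    [TopologicalSpace.SeparableSpace H]
    [NormedAddCommGroup H₀] [InnerProductSpace ℂ H₀] [CompleteSpace H₀]
    [∀ i, NormedAddCommGroup (A i)] [∀ i, InnerProductSpace ℂ (A i)] [∀ i, CompleteSpace (A i)]
    [∀ i, Nontrivial (A i)]
    [∀ i, NormedAddCommGroup (B i)] [∀ i, InnerProductSpace ℂ (B i)] [∀ i, CompleteSpace (B i)]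
    [∀ i, Nontrivial (B i)]
    (P : BlockSpace H₀ A B ≃ₗᵢ[ℂ] H) (𝒜 : NonUnitalStarSubalgebra ℂ (H →L[ℂ] H))
    (h𝒜 : IsAtomicWith 𝒜 P)
    {E : Type u} [NormedAddCommGroup E] [InnerProductSpace ℂ E] [CompleteSpace E]
    [TopologicalSpace.SeparableSpace E]
    {E' : Type u} [NormedAddCommGroup E'] [InnerProductSpace ℂ E'] [CompleteSpace E']
    [TopologicalSpace.SeparableSpace E'] :
    -- existence of minimal normal forms
    (∀ (V : H →L[ℂ] H ⊗ₕ E) (K : H →L[ℂ] H),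
      (∀ X ∈ 𝒜, generator V K X ∈ 𝒜) →
      ∃ D : NormalFormData H H₀ E A B, D.IsNormalForm P V K ∧ D.IsMinimal) ∧
    -- minimal normal forms of generators that agree on `𝒜`
    (∀ (V : H →L[ℂ] H ⊗ₕ E) (K : H →L[ℂ] H) (V' : H →L[ℂ] H ⊗ₕ E') (K' : H →L[ℂ] H),
      (∀ X ∈ 𝒜, generator V K X ∈ 𝒜) → (∀ X ∈ 𝒜, generator V' K' X ∈ 𝒜) →
      ∀ (D : NormalFormData H H₀ E A B) (D' : NormalFormData H H₀ E' A B),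
      D.IsNormalForm P V K → D.IsMinimal → D'.IsNormalForm P V' K' → D'.IsMinimal →
      (∀ X ∈ 𝒜, generator V K X = generator V' K' X) →
      ∃ (W : ∀ i j, D.F i j ≃ₗᵢ[ℂ] D'.F i j) (ψ : ∀ i, D'.F i i) (μ : I → ℝ),
        D.AreRelated D' W ψ μ) ∧
    -- minimal normal forms of the same pair `(V, K)`
    (∀ (V : H →L[ℂ] H ⊗ₕ E) (K : H →L[ℂ] H),
      (∀ X ∈ 𝒜, generator V K X ∈ 𝒜) →
      ∀ D D' : NormalFormData H H₀ E A B,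
      D.IsNormalForm P V K → D.IsMinimal → D'.IsNormalForm P V K → D'.IsMinimal →
      D'.V₀ = D.V₀ ∧ D'.K₀ = D.K₀ ∧
      (∃ (W : ∀ i j, D.F i j ≃ₗᵢ[ℂ] D'.F i j) (ψ : ∀ i, D'.F i i) (μ : I → ℝ),
        D.AreRelated D' W ψ μ) ∧
      ∀ (W : ∀ i j, D.F i j ≃ₗᵢ[ℂ] D'.F i j) (ψ : ∀ i, D'.F i i) (μ : I → ℝ),
        D.AreRelated D' W ψ μ →
        (∀ i, D'.b i = D.b i - D.shift D' W ψ i) ∧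
        (∀ i, D'.HB i = D.HB i +
          (Complex.I / 2) • ((D.b i)† ∘L D.shift D' W ψ i - ((D.b i)† ∘L D.shift D' W ψ i)†) -
          (μ i : ℂ) • ContinuousLinearMap.id ℂ (B i)) ∧
        ∀ i j, D'.U i j = D.U i j ∘L hR (unitaryL (W i j).symm) (B j)) := by
  refine ⟨fun V K hgen => exists_isNormalForm_isMinimal h𝒜 V K hgen,
    fun V K V' K' _ _ D D' h hm h' hm' hgen =>
      NormalFormData.exists_areRelated h𝒜 h hm h' hm' hgen,
    fun V K _ D D' h hm h' hm' => ⟨?_, ?_, ?_, fun W ψ μ hr => hr.relations h hm h'⟩⟩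
  · rw [h.V₀_eq, h'.V₀_eq]
  · rw [h.K₀_eq, h'.K₀_eq]
  · exact NormalFormData.exists_areRelated h𝒜 h hm h' hm' fun _ _ => rfl
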